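/- Let $\mathbb H$ be the upper half-plane, and for an integer $k$, $f\colon\mathbb H\to\mathbb C$ and $\gamma=\begin{pmatrix}a&b\\c&d\end{pmatrix}\in \mathrm{SL}_2(\mathbb Z)$ let $(f|_k\gamma)(z)=(cz+d)^{-k}f\big(\tfrac{az+b}{cz+d}\big)$. For even $k$ this gives an action of $\mathrm{PSL}_2(\mathbb Z)$, extended linearly to the group algebra $R=\mathbb C[\mathrm{PSL}_2(\mathbb Z)]$. Let $I$ be the identity, $S=\begin{pmatrix}0&-1\\1&0\end{pmatrix}$, $T=\begin{pmatrix}1&1\\0&1\end{pmatrix}$, and define the right ideals $$\mathcal I_\pm=(S\pm I)R+(T-I)^2R,\qquad \widetilde{\mathcal I}_\pm=(T-2+T^{-1}\mp2S)R+(I\mp STS)R .$$ Let $\mathcal P$ be the space of holomorphic $F\colon\mathbb H\to\mathbb C$ such that $|F(\tau)|\le\alpha(\operatorname{Im}(\tau)^{-\beta}+|\tau|^\gamma)$ on $\mathbb H$ for some $\alpha,\beta,\gamma\ge0$, and for a right ideal $J$ of $R$ let $\operatorname{Ann}_k(J,\mathcal P)=\{f\in\mathcal P: f|_kr=0\text{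 for all }r\in J\}$. Let $\mathcal M_k$ be the space of holomorphic modular forms of weight $k$ for $\mathrm{SL}_2(\mathbb Z)$, and $E_2(z)=1-24\sum_{n\ge1}\sigma_1(n)e^{2\pi inz}$. Let $$U(z)=\Big(\sum_{n\in\mathbb Z}e^{\pi in^2z}\Big)^4,\quad V(z)=\Big(\sum_{n\in\mathbb Z}e^{\pi i(n+1/2)^2z}\Big)^4,\quad W(z)=\Big(\sum_{n\in\mathbb Z}(-1)^ne^{\pi in^2z}\Big)^4,$$ $\lambda=V/U$, $\lambda_S(z)=\lambda(-1/z)$, and $$\mathcal L(z)=\int_0^z\frac{\lambda'(w)}{\lambda(w)}\,dw,\qquad \mathcal L_S(z)=-\int_z^{\infty}\frac{\lambda_S'(w)}{\lambda_S(w)}\,dw,$$ where the contours lie in $\mathbb H$ and approach $0$, respectively $i\infty$, along vertical lines. Then the following hold for every even integer $k$ (the sums of spaces are sums of subspaces of the space of functions on $\mathbb H$). 1. $\operatorname{Ann}_k(\mathcal I_+,\mathcal P)$, i.e. the set of $f\in\mathcal P$ with $f|_k(T-I)^2=0$ and $f|_k(S+I)=0$, equals $\varphi_2\mathcal M_{k-2}+\varphi_0\mathcal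 M_k+\varphi_{-2}\mathcal M_{k+2}$, where $\varphi_2(\tau)=\tau E_2(\tau)^2-\frac{6i}{\pi}E_2(\tau)$, $\varphi_0(\tau)=\tau E_2(\tau)-\frac{3i}{\pi}$, $\varphi_{-2}(\tau)=\tau$. Its dimension is $\max(0,\lceil k/4\rceil+1)$. 2. $\operatorname{Ann}_k(\mathcal I_-,\mathcal P)$, i.e. the set of $f\in\mathcal P$ with $f|_k(T-I)^2=0$ and $f|_k(S-I)=0$, equals $\psi_4\mathcal M_{k-4}+\psi_2\mathcal M_{k-2}+\psi_0\mathcal M_k$, where $\psi_4=\xi_4\mathcal L+(\xi_4|_4S)\mathcal L_S$, $\psi_2=\xi_2\mathcal L+(\xi_2|_2S)\mathcal L_S$, $\psi_0=1$, with $\xi_4=U^2+W^2-2V^2$ and $\xi_2=U+W$. Its dimension is $\max(0,\lceil (k-2)/4\rceil+1)$. 3. $\operatorname{Ann}_k(\widetilde{\mathcal I}_+,\mathcal P)$, i.e. the set of $f\in\mathcal P$ with $f|_k(T-2+T^{-1}-2S)=0$ and $f|_k(I-STS)=0$, equals $\widetilde\varphi_2\mathcal M_{k-2}+\widetilde\varphi_0\mathcal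 M_k+\widetilde\varphi_{-2}\mathcal M_{k+2}$, where $\widetilde\varphi_2(z)=z^2\big((E_2|_2S)(z)\big)^2$, $\widetilde\varphi_0(z)=z^2(E_2|_2S)(z)$, $\widetilde\varphi_{-2}(z)=z^2$. Its dimension is $\max(0,\lceil k/4\rceil+1)$. 4. $\operatorname{Ann}_k(\widetilde{\mathcal I}_-,\mathcal P)$, i.e. the set of $f\in\mathcal P$ with $f|_k(T-2+T^{-1}+2S)=0$ and $f|_k(I+STS)=0$, equals $\widetilde\psi_4\mathcal M_{k-4}+\widetilde\psi_2\mathcal M_{k-2}+\widetilde\psi_0\mathcal M_k$, where $\widetilde\psi_4=U^2-V^2$, $\widetilde\psi_2=W$, $\widetilde\psi_0=\mathcal L$. Its dimension is $\max(0,\lceil (k-2)/4\rceil+1)$. -/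

import Mathlib

open UpperHalfPlane hiding I
open scoped ModularForm MatrixGroups Manifold MulOpposite

noncomputable section

namespace ModularAnn

/-! ### Holomorphic functions of moderate growth on the upper half-plane -/

/-- `|F(τ)| ≤ α (Im(τ)^(-β) + |τ|^γ)` for some `α, β, γ ≥ 0`. -/
def ModerateGrowth (F : ℍ → ℂ) : Prop :=
  ∃ α β γ : ℝ, 0 ≤ α ∧ 0 ≤ β ∧ 0 ≤ γ ∧
    ∀ τ : ℍ, ‖F τ‖ ≤ α * (τ.im ^ (-β) + ‖(τ : ℂ)‖ ^ γ)

theorem growth_mono (τ : ℍ) {β γ β' γ' : ℝ} (hβ : 0 ≤ β) (hγ : 0 ≤ γ) (hβ' : β ≤ β')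
    (hγ' : γ ≤ γ') :
    τ.im ^ (-β) + ‖(τ : ℂ)‖ ^ γ ≤ 2 * (τ.im ^ (-β') + ‖(τ : ℂ)‖ ^ γ') := by
  have hy : 0 < τ.im := τ.im_pos
  have hle : τ.im ≤ ‖(τ : ℂ)‖ := (le_abs_self _).trans (Complex.abs_im_le_norm (τ : ℂ))
  have hn : 0 < ‖(τ : ℂ)‖ := hy.trans_le hle
  have p1 : 0 < τ.im ^ (-β') := Real.rpow_pos_of_pos hy _
  have p2 : 0 < ‖(τ : ℂ)‖ ^ γ' := Real.rpow_pos_of_pos hn _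
  have h1 : τ.im ^ (-β) ≤ τ.im ^ (-β') + ‖(τ : ℂ)‖ ^ γ' := by
    rcases le_total τ.im 1 with h | h
    · have := Real.rpow_le_rpow_of_exponent_ge hy h (neg_le_neg hβ')
      linarith
    · have a := Real.rpow_le_one_of_one_le_of_nonpos h (neg_nonpos.mpr hβ)
      have b := Real.one_le_rpow (h.trans hle) (hγ.trans hγ')
      linarith
  have h2 : ‖(τ : ℂ)‖ ^ γ ≤ τ.im ^ (-β') + ‖(τ : ℂ)‖ ^ γ' := by
    rcases le_total 1 ‖(τ : ℂ)‖ with h | h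
    · have := Real.rpow_le_rpow_of_exponent_le h hγ'
      linarith
    · have a := Real.rpow_le_one hn.le h hγ
      have b := Real.one_le_rpow_of_pos_of_le_one_of_nonpos hy (hle.trans h)
        (neg_nonpos.mpr (hβ.trans hβ'))
      linarith
  linarith

/-- The space `𝒫` of holomorphic functions of moderate growth on the upper half-plane. -/
def classP : Submodule ℂ (ℍ → ℂ) where
  carrier := {F | MDiff F ∧ ModerateGrowth F}
  zero_mem' := ⟨mdifferentiable_const, 0, 0, 0, le_rfl, le_rfl, le_rfl, fun τ => by simp⟩
  add_mem' := by
    rintro F G ⟨hF, α, β, γ, hα, hβ, hγ, h⟩ ⟨hG, α', β', γ', hα', hβ', hγ', h'⟩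
    refine ⟨hF.add hG, 2 * α + 2 * α', max β β', max γ γ', by positivity,
      hβ.trans (le_max_left _ _), hγ.trans (le_max_left _ _), fun τ => ?_⟩
    have e1 := growth_mono τ hβ hγ (le_max_left β β') (le_max_left γ γ')
    have e2 := growth_mono τ hβ' hγ' (le_max_right β β') (le_max_right γ γ')
    calc ‖(F + G) τ‖ ≤ ‖F τ‖ + ‖G τ‖ := norm_add_le _ _
      _ ≤ α * (2 * (τ.im ^ (-max β β') + ‖(τ : ℂ)‖ ^ max γ γ'))
          + α' * (2 * (τ.im ^ (-max β β') + ‖(τ : ℂ)‖ ^ max γ γ')) :=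
        add_le_add ((h τ).trans (mul_le_mul_of_nonneg_left e1 hα))
          ((h' τ).trans (mul_le_mul_of_nonneg_left e2 hα'))
      _ = _ := by ring
  smul_mem' := by
    rintro c F ⟨hF, α, β, γ, hα, hβ, hγ, h⟩
    refine ⟨hF.const_smul c, ‖c‖ * α, β, γ, by positivity, hβ, hγ, fun τ => ?_⟩
    rw [Pi.smul_apply, norm_smul, mul_assoc]
    exact mul_le_mul_of_nonneg_left (h τ) (norm_nonneg c)

/-! ### The group algebra `R = ℂ[PSL₂(ℤ)]`, its slash action, and annihilators -/

/-- `PSL₂(ℤ) = SL₂(ℤ) / {±I}`. -/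
abbrev PSL2Z : Type := Matrix.ProjectiveSpecialLinearGroup (Fin 2) ℤ

/-- The group algebra `R = ℂ[PSL₂(ℤ)]`. -/
abbrev R : Type := MonoidAlgebra ℂ PSL2Z

/-- The basis element of `R` given by the class of a matrix in `SL₂(ℤ)`. -/
def toR (γ : SL(2, ℤ)) : R := MonoidAlgebra.of ℂ PSL2Z (QuotientGroup.mk γ)

/-- The element `S` of `R`, the class of `!![0, -1; 1, 0]`. -/
def S : R := toR ModularGroup.S

/-- The element `T` of `R`, the class of `!![1, 1; 0, 1]`. -/
def T : R := toR ModularGroup.T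

/-- The element `T⁻¹` of `R`. -/
def Tinv : R := toR ModularGroup.T⁻¹

/-- The weight `k` slash operator of an element of `PSL₂(ℤ)`, through a representative in
`SL₂(ℤ)`. For even `k` the choice of the representative does not matter, see `slashPSL_mk`. -/
def slashPSL (k : ℤ) (f : ℍ → ℂ) (γ : PSL2Z) : ℍ → ℂ :=
  f ∣[k] (Quotient.out γ : SL(2, ℤ))

theorem slash_neg_of_even {k : ℤ} (hk : Even k) (f : ℍ → ℂ) (γ : SL(2, ℤ)) :
    f ∣[k] (-γ) = f ∣[k] γ := by
  ext τ
  rw [ModularForm.SL_slash_apply, ModularForm.SL_slash_apply, ModularGroup.SL_neg_smul,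
    ModularGroup.denom_apply, ModularGroup.denom_apply]
  congr 1
  rw [← (hk.neg).neg_zpow]
  congr 1
  simp
  ring

theorem slashPSL_mk {k : ℤ} (hk : Even k) (f : ℍ → ℂ) (γ : SL(2, ℤ)) :
    slashPSL k f (QuotientGroup.mk γ) = f ∣[k] γ := by
  unfold slashPSL
  obtain ⟨z, hz⟩ := QuotientGroup.mk_out_eq_mul
    (Subgroup.center (Matrix.SpecialLinearGroup (Fin 2) ℤ)) γ
  have hz2 := z.2
  rw [Matrix.SpecialLinearGroup.mem_center_iff] at hz2
  obtain ⟨r, hr, hrz⟩ := hz2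
  have hr' : r = 1 ∨ r = -1 := by
    rw [Fintype.card_fin] at hr
    simpa using hr
  have hz' : (z : SL(2, ℤ)) = 1 ∨ (z : SL(2, ℤ)) = -1 := by
    refine hr'.imp (fun h => ?_) (fun h => ?_) <;> subst h <;> apply Subtype.ext <;>
      rw [← hrz] <;> simp
  have e : (Quotient.out (QuotientGroup.mk γ : PSL2Z) : SL(2, ℤ)) = γ * z := hz
  rw [e]
  rcases hz' with h | h
  · rw [h, mul_one]
  · rw [h, mul_neg, mul_one, slash_neg_of_even hk]

/-- The linear extension to `R` of the weight `k` slash action: `f|_k (∑ c_γ γ) = ∑ c_γ f|_k γ`. -/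
def slashR (k : ℤ) (f : ℍ → ℂ) (r : R) : ℍ → ℂ :=
  r.coeff.sum fun γ c => c • slashPSL k f γ

theorem slashR_zero (k : ℤ) (r : R) : slashR k 0 r = 0 := by
  simp [slashR, slashPSL]

theorem slashR_add (k : ℤ) (f g : ℍ → ℂ) (r : R) :
    slashR k (f + g) r = slashR k f r + slashR k g r := by
  simp [slashR, slashPSL, Finsupp.sum, Finset.sum_add_distrib]

theorem slashR_smul (k : ℤ) (c : ℂ) (f : ℍ → ℂ) (r : R) :
    slashR k (c • f) r = c • slashR k f r := by
  simp [slashR, slashPSL, Finsupp.sum, Finset.smul_sum, ModularForm.SL_smul_slash,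
    smul_comm c]

/-- Right ideals of `R`. -/
abbrev RightIdeal : Type := Submodule Rᵐᵒᵖ R

/-- The right ideal `a R + b R`. -/
def rightIdeal (a b : R) : RightIdeal := Submodule.span Rᵐᵒᵖ {a} ⊔ Submodule.span Rᵐᵒᵖ {b}

/-- `Ann_k(J, 𝒫) = {f ∈ 𝒫 : f|_k r = 0 for all r ∈ J}`. -/
def Ann (k : ℤ) (J : RightIdeal) : Submodule ℂ (ℍ → ℂ) where
  carrier := {f | f ∈ classP ∧ ∀ r ∈ J, slashR k f r = 0}
  zero_mem' := ⟨classP.zero_mem, fun r _ => slashR_zero k r⟩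
  add_mem' := fun {f g} hf hg => ⟨classP.add_mem hf.1 hg.1, fun r hr => by
    rw [slashR_add, hf.2 r hr, hg.2 r hr, add_zero]⟩
  smul_mem' := fun c f hf => ⟨classP.smul_mem c hf.1, fun r hr => by
    rw [slashR_smul, hf.2 r hr, smul_zero]⟩

/-- `I₊ = (S + I) R + (T - I)² R`. -/
def idealPlus : RightIdeal := rightIdeal (S + 1) ((T - 1) ^ 2)

/-- `I₋ = (S - I) R + (T - I)² R`. -/
def idealMinus : RightIdeal := rightIdeal (S - 1) ((T - 1) ^ 2)

/-- `Ĩ₊ = (T - 2 + T⁻¹ - 2S) R + (I - STS) R`. -/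
def idealTildePlus : RightIdeal := rightIdeal (T - 2 + Tinv - 2 * S) (1 - S * T * S)

/-- `Ĩ₋ = (T - 2 + T⁻¹ + 2S) R + (I + STS) R`. -/
def idealTildeMinus : RightIdeal := rightIdeal (T - 2 + Tinv + 2 * S) (1 + S * T * S)

/-! ### Modular forms, theta functions and logarithms of the modular lambda function -/

/-- The space `φ · M_k(SL₂(ℤ))` of functions on the upper half-plane. -/
def mulForms (φ : ℍ → ℂ) (k : ℤ) : Submodule ℂ (ℍ → ℂ) where
  carrier := {f | ∃ g : ModularForm 𝒮ℒ k, f = φ * ⇑g}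
  zero_mem' := ⟨0, by simp⟩
  add_mem' := by
    rintro _ _ ⟨g, rfl⟩ ⟨h, rfl⟩
    exact ⟨g + h, by ext τ; simp [mul_add]⟩
  smul_mem' := by
    rintro c _ ⟨g, rfl⟩
    exact ⟨c • g, by ext τ; simp [mul_left_comm]⟩

/-- `θ₀₀(z) = ∑ exp(π i n² z)`. -/
def theta00 (z : ℂ) : ℂ := ∑' n : ℤ, Complex.exp (Real.pi * Complex.I * (n : ℂ) ^ 2 * z)

/-- `θ₀₁(z) = ∑ (-1)ⁿ exp(π i n² z)`. -/
def theta01 (z : ℂ) : ℂ :=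
  ∑' n : ℤ, (-1 : ℂ) ^ n * Complex.exp (Real.pi * Complex.I * (n : ℂ) ^ 2 * z)

/-- `θ₁₀(z) = ∑ exp(π i (n + 1/2)² z)`. -/
def theta10 (z : ℂ) : ℂ :=
  ∑' n : ℤ, Complex.exp (Real.pi * Complex.I * ((n : ℂ) + 1 / 2) ^ 2 * z)

/-- `U = θ₀₀⁴`. -/
def U (z : ℍ) : ℂ := theta00 z ^ 4

/-- `V = θ₁₀⁴`. -/
def V (z : ℍ) : ℂ := theta10 z ^ 4

/-- `W = θ₀₁⁴`. -/
def W (z : ℍ) : ℂ := theta01 z ^ 4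

/-- The modular function `λ = V / U`, as a function of a complex variable; only its values at
points of the upper half-plane are used. -/
def lam (z : ℂ) : ℂ := theta10 z ^ 4 / theta00 z ^ 4

/-- `λ_S(z) = λ(-1/z)`. -/
def lamS (z : ℂ) : ℂ := lam (-1 / z)

/-- `ℒ(z) = ∫₀ᶻ λ'(w)/λ(w) dw`, along the path from `0` vertically to `i Im z` and from there
horizontally to `z`. -/
def logLam (z : ℍ) : ℂ :=
  (∫ t in (0 : ℝ)..z.im, logDeriv lam (t * Complex.I) * Complex.I) +
    ∫ x in (0 : ℝ)..z.re, logDeriv lam (x + z.im * Complex.I)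

/-- `ℒ_S(z) = -∫_z^∞ λ_S'(w)/λ_S(w) dw`, along the vertical ray from `z` to `i∞`. -/
def logLamS (z : ℍ) : ℂ :=
  -∫ t in Set.Ioi z.im, logDeriv lamS (z.re + t * Complex.I) * Complex.I

/-! ### The explicit multipliers -/

/-- The quasimodular Eisenstein series `E₂ = 1 - 24 ∑ σ₁(n) qⁿ`. -/
abbrev E₂ : ℍ → ℂ := EisensteinSeries.E2

/-- `φ₂ = τ E₂² - (6i/π) E₂`. -/
def phi2 (τ : ℍ) : ℂ := τ * E₂ τ ^ 2 - 6 * Complex.I / Real.pi * E₂ τ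

/-- `φ₀ = τ E₂ - 3i/π`. -/
def phi0 (τ : ℍ) : ℂ := τ * E₂ τ - 3 * Complex.I / Real.pi

/-- `φ₋₂ = τ`. -/
def phiNeg2 (τ : ℍ) : ℂ := τ

/-- `φ̃₂ = z² (E₂|₂S)²`. -/
def phiTilde2 (z : ℍ) : ℂ := (z : ℂ) ^ 2 * ((E₂ ∣[(2 : ℤ)] ModularGroup.S) z) ^ 2

/-- `φ̃₀ = z² (E₂|₂S)`. -/
def phiTilde0 (z : ℍ) : ℂ := (z : ℂ) ^ 2 * (E₂ ∣[(2 : ℤ)] ModularGroup.S) z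

/-- `φ̃₋₂ = z²`. -/
def phiTildeNeg2 (z : ℍ) : ℂ := (z : ℂ) ^ 2

/-- `ξ₄ = U² + W² - 2V²`. -/
def xi4 : ℍ → ℂ := U ^ 2 + W ^ 2 - 2 * V ^ 2

/-- `ξ₂ = U + W`. -/
def xi2 : ℍ → ℂ := U + W

/-- `ψ₄ = ξ₄ ℒ + (ξ₄|₄S) ℒ_S`. -/
def psi4 : ℍ → ℂ := xi4 * logLam + (xi4 ∣[(4 : ℤ)] ModularGroup.S) * logLamS

/-- `ψ₂ = ξ₂ ℒ + (ξ₂|₂S) ℒ_S`. -/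
def psi2 : ℍ → ℂ := xi2 * logLam + (xi2 ∣[(2 : ℤ)] ModularGroup.S) * logLamS

/-- `ψ₀ = 1`. -/
def psi0 : ℍ → ℂ := 1

/-- `ψ̃₄ = U² - V²`. -/
def psiTilde4 : ℍ → ℂ := U ^ 2 - V ^ 2

/-- `ψ̃₂ = W`. -/
def psiTilde2 : ℍ → ℂ := W

/-- `ψ̃₀ = ℒ`. -/
def psiTilde0 : ℍ → ℂ := logLam

/-- `X` is a complex vector space of finite dimension `d`. -/
def HasDim (X : Submodule ℂ (ℍ → ℂ)) (d : ℤ) : Prop :=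
  Module.Finite ℂ X ∧ (Module.finrank ℂ X : ℤ) = d

end ModularAnn

end

open ModularAnn

noncomputable section

namespace ModularAnn

open Filter Topology Asymptotics

/-! ### Moderate growth through the height function -/

/-! In each case the generators of the ideal, together with the relation `STS = T⁻¹ST⁻¹`, make
finitely many translates of `f` transform among themselves. The resulting representation is then
resolved by explicit functions with modular forms as coefficients. Analysis enters through one
principle: a function in `𝒫` fixed by `S` and `T` is a level one modular form
(`exists_modularForm`), since moderate growth and periodicity force boundedness at `i∞`.

For `I₊`, put `p = f|(T - I)` and `h = p|S`. Then `p, f, h` transform like `1, z, z²`, that is,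
through the symmetric square of the standard representation. The polynomial `P(X) = h - 2fX + pX²`
has a modular value `P(z)` of weight `k - 2`, and the quasimodularity of `E₂` corrects `P'(z)` and
`P''(z)` to modular forms of weights `k` and `k + 2` (`exists_E2_decomposition`). The case `Ĩ₊` is
the image of `I₊` under the slash action of `(T - I)S`, which is inverted by `(T - T⁻¹)/4`.

The minus cases use the two-dimensional representation of `SL₂(ℤ/2) ≅ S₃`. Pairs of this type are
combinations of `(U² - V², U² - W²)` and `(W, -V)`: Cramer's rule has determinant `-3UVW`, and `UVW`
has no zeros because its square is a nonzero multiple of the discriminant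
(`exists_psiTilde_decomposition`). For `Ĩ₋`, `f|T = f - f|S + c` with `c` modular; the logarithm `ℒ`
satisfies the same relation with `c = πi` (`logLam_one_vadd`), so subtracting `ℒ c/(πi)` leaves a
pair of the above type. For `I₋`, the difference `f|(T - I)` is a `T`-invariant vector of this type,
equal to `πi(ξ₄x + ξ₂y)`, and subtracting `ψ₄x + ψ₂y` leaves a modular form.

The logarithms are controlled by `λ'/λ = πi W`, a Wronskian identity in weight 6 (`wronskianVU_eq`).
Dimensions follow because the coefficients are unique, so the dimensions of three spaces of level
one forms add up. -/

/-- The height `(1 + |z|²) / Im z`, which is invariant under `z ↦ -1/z`. -/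
def height (z : ℍ) : ℝ := (1 + ‖(z : ℂ)‖ ^ 2) / z.im

theorem im_le_norm (z : ℍ) : z.im ≤ ‖(z : ℂ)‖ :=
  (le_abs_self _).trans (Complex.abs_im_le_norm (z : ℂ))

theorem norm_coe_pos (z : ℍ) : 0 < ‖(z : ℂ)‖ := z.im_pos.trans_le (im_le_norm z)

theorem inv_im_le_height (z : ℍ) : 1 / z.im ≤ height z := by
  unfold height
  have := z.im_pos
  gcongr
  nlinarith [sq_nonneg ‖(z : ℂ)‖]

theorem norm_le_height (z : ℍ) : ‖(z : ℂ)‖ ≤ height z := by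
  unfold height
  rw [le_div_iff₀ z.im_pos]
  nlinarith [im_le_norm z, norm_coe_pos z]

theorem one_le_height (z : ℍ) : 1 ≤ height z := by
  unfold height
  rw [le_div_iff₀ z.im_pos]
  nlinarith [im_le_norm z, norm_coe_pos z, sq_nonneg (‖(z : ℂ)‖ - 1)]

theorem height_pos (z : ℍ) : 0 < height z := one_pos.trans_le (one_le_height z)

theorem height_S_smul (z : ℍ) : height (ModularGroup.S • z) = height z := by
  have h := norm_coe_pos z
  have hz := z.im_pos
  have h1 : ((ModularGroup.S • z : ℍ) : ℂ) = (-(z : ℂ))⁻¹ := by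
    rw [UpperHalfPlane.modular_S_smul]
  have h2 : (ModularGroup.S • z : ℍ).im = z.im / ‖(z : ℂ)‖ ^ 2 := by
    rw [← UpperHalfPlane.coe_im, h1, Complex.inv_im, Complex.normSq_eq_norm_sq]
    simp
  unfold height
  rw [h1, h2, norm_inv, norm_neg]
  field_simp
  ring

theorem height_vadd_le (x : ℝ) (hx : x ^ 2 ≤ 1) (z : ℍ) : height (x +ᵥ z) ≤ 3 * height z := by
  unfold height
  rw [UpperHalfPlane.vadd_im, ← mul_div_assoc]
  have := z.im_pos
  gcongr
  rw [UpperHalfPlane.coe_vadd, ← Complex.normSq_eq_norm_sq, ← Complex.normSq_eq_norm_sq,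
    Complex.normSq_apply, Complex.normSq_apply]
  simp only [Complex.add_re, Complex.ofReal_re, Complex.add_im, Complex.ofReal_im]
  -- `(x + a)² ≤ 2x² + 2a²` with `x² ≤ 1` gives `1 + |x + z|² ≤ 3 + 2|z|²`, hence the factor 3.
  nlinarith [sq_nonneg (x - (z : ℂ).re), sq_nonneg (z : ℂ).im]

theorem T_inv_smul (z : ℍ) : ModularGroup.T⁻¹ • z = (-1 : ℝ) +ᵥ z := by
  have := UpperHalfPlane.modular_T_zpow_smul z (-1)
  simpa using this

/-- The height is at least 1 and dominates both `1 / Im z` and `|z|`; conversely its powers split by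
the inequality `2xy ≤ x² + y²`. Since `S` and `T^{±1}` change it by at most a constant factor, this
form of the bound makes stability of `𝒫` under the group immediate. -/
theorem moderateGrowth_iff (F : ℍ → ℂ) :
    ModerateGrowth F ↔ ∃ (C : ℝ) (N : ℕ), 0 ≤ C ∧ ∀ z, ‖F z‖ ≤ C * height z ^ N := by
  constructor
  · rintro ⟨α, β, γ, hα, hβ, hγ, h⟩
    obtain ⟨N, hN⟩ := exists_nat_ge (max β γ)
    refine ⟨α * 2, N, by positivity, fun z => (h z).trans ?_⟩
    rw [mul_assoc]
    refine mul_le_mul_of_nonneg_left ?_ hα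
    have hy := z.im_pos
    have e1 : z.im ^ (-β) ≤ height z ^ N := by
      rw [Real.rpow_neg hy.le, ← Real.inv_rpow hy.le, ← Real.rpow_natCast]
      calc (z.im⁻¹) ^ β ≤ height z ^ β := by
            refine Real.rpow_le_rpow (by positivity) ?_ hβ
            simpa using inv_im_le_height z
        _ ≤ _ := Real.rpow_le_rpow_of_exponent_le (one_le_height z) ((le_max_left _ _).trans hN)
    have e2 : ‖(z : ℂ)‖ ^ γ ≤ height z ^ N := by
      rw [← Real.rpow_natCast]
      calc ‖(z : ℂ)‖ ^ γ ≤ height z ^ γ :=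
            Real.rpow_le_rpow (norm_nonneg _) (norm_le_height z) hγ
        _ ≤ _ := Real.rpow_le_rpow_of_exponent_le (one_le_height z) ((le_max_right _ _).trans hN)
    linarith
  · rintro ⟨C, N, hC, h⟩
    refine ⟨C * (1 + 2 ^ (2 * N) * 2), 2 * N, 4 * N, by positivity, by positivity, by positivity,
      fun z => (h z).trans ?_⟩
    rw [mul_assoc]
    refine mul_le_mul_of_nonneg_left ?_ hC
    have hy := z.im_pos
    -- With exponents 0 on the left this says `1 ≤ a + b`, which absorbs the constant term of `(1 +
    -- |z|²)^(2N)`.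
    have g := growth_mono z (β := 0) (γ := 0) (β' := 2 * N) (γ' := 4 * N) le_rfl le_rfl
      (by positivity) (by positivity)
    simp only [neg_zero, Real.rpow_zero] at g
    set a := z.im ^ (-(2 * N : ℝ)) with ha
    set b := ‖(z : ℂ)‖ ^ (4 * N : ℝ) with hb
    have ha' : a = (z.im⁻¹ ^ N) ^ 2 := by
      rw [ha, Real.rpow_neg hy.le, ← Real.inv_rpow hy.le, ← pow_mul, ← Real.rpow_natCast]
      push_cast
      ring_nf
    have hb' : b = (‖(z : ℂ)‖ ^ 2) ^ (2 * N) := by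
      rw [hb, ← pow_mul, ← Real.rpow_natCast]
      push_cast
      ring_nf
    have hc : ((1 + ‖(z : ℂ)‖ ^ 2) ^ N) ^ 2 ≤ 2 ^ (2 * N) * (1 + b) := by
      rw [← pow_mul, mul_comm N 2, hb']
      calc (1 + ‖(z : ℂ)‖ ^ 2) ^ (2 * N)
          ≤ 2 ^ (2 * N - 1) * (1 ^ (2 * N) + (‖(z : ℂ)‖ ^ 2) ^ (2 * N)) :=
            add_pow_le zero_le_one (by positivity) _
        _ ≤ _ := by
            rw [one_pow]
            gcongr
            · norm_num
            · omega
    have hm : height z ^ N = z.im⁻¹ ^ N * (1 + ‖(z : ℂ)‖ ^ 2) ^ N := by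
      rw [height, div_eq_inv_mul, mul_pow]
    have ha0 : 0 ≤ a := by rw [ha']; positivity
    have hb0 : 0 ≤ b := by rw [hb']; positivity
    have h4 : (0 : ℝ) ≤ 2 ^ (2 * N) := by positivity
    rw [hm]
    have := two_mul_le_add_sq (z.im⁻¹ ^ N) ((1 + ‖(z : ℂ)‖ ^ 2) ^ N)
    nlinarith [mul_nonneg h4 ha0, mul_nonneg h4 hb0]

theorem ModerateGrowth.mul {F G : ℍ → ℂ} (hF : ModerateGrowth F) (hG : ModerateGrowth G) :
    ModerateGrowth (F * G) := by
  rw [moderateGrowth_iff] at *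
  obtain ⟨C, N, hC, h⟩ := hF
  obtain ⟨D, M, hD, h'⟩ := hG
  refine ⟨C * D, N + M, by positivity, fun z => ?_⟩
  rw [Pi.mul_apply, norm_mul, pow_add]
  calc _ ≤ (C * height z ^ N) * (D * height z ^ M) :=
        mul_le_mul (h z) (h' z) (norm_nonneg _) (mul_nonneg hC (pow_nonneg (height_pos z).le _))
    _ = _ := by ring

theorem moderateGrowth_of_im_bound {F : ℍ → ℂ} (C : ℝ) (N : ℕ) (hC : 0 ≤ C)
    (h : ∀ z : ℍ, ‖F z‖ ≤ C * (1 + 1 / z.im) ^ N) : ModerateGrowth F := by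
  rw [moderateGrowth_iff]
  refine ⟨C * 2 ^ N, N, by positivity, fun z => (h z).trans ?_⟩
  rw [mul_assoc, ← mul_pow]
  have := z.im_pos
  gcongr
  linarith [inv_im_le_height z, one_le_height z]

theorem ModerateGrowth.comp_of_height_le {F : ℍ → ℂ} (hF : ModerateGrowth F) (φ : ℍ → ℍ) (c : ℝ)
    (hφ : ∀ z, height (φ z) ≤ c * height z) : ModerateGrowth (F ∘ φ) := by
  rw [moderateGrowth_iff] at *
  obtain ⟨C, N, hC, h⟩ := hF
  have hc : 0 < c := by
    have := (height_pos _).trans_le (hφ UpperHalfPlane.I)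
    exact (pos_iff_pos_of_mul_pos this).mpr (height_pos _)
  refine ⟨C * c ^ N, N, by positivity, fun z => (h _).trans ?_⟩
  rw [mul_assoc, ← mul_pow]
  have := height_pos (φ z)
  gcongr
  exact hφ z

/-! ### Slash action of the generators and closure properties of `𝒫`. -/

theorem slash_S_apply (k : ℤ) (f : ℍ → ℂ) (z : ℍ) :
    (f ∣[k] ModularGroup.S) z = f (ModularGroup.S • z) * (z : ℂ) ^ (-k) := by
  rw [SlashInvariantForm.slash_S_apply, UpperHalfPlane.modular_S_smul]

theorem slash_T_apply (k : ℤ) (f : ℍ → ℂ) (z : ℍ) :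
    (f ∣[k] ModularGroup.T) z = f ((1 : ℝ) +ᵥ z) := by
  rw [ModularForm.SL_slash_apply, UpperHalfPlane.modular_T_smul, ModularGroup.denom_apply]
  simp [ModularGroup.coe_T]

theorem slash_T_inv_apply (k : ℤ) (f : ℍ → ℂ) (z : ℍ) :
    (f ∣[k] ModularGroup.T⁻¹) z = f ((-1 : ℝ) +ᵥ z) := by
  rw [ModularForm.SL_slash_apply, T_inv_smul, ModularGroup.denom_apply]
  simp

theorem moderateGrowth_coe : ModerateGrowth (fun z : ℍ => (z : ℂ)) :=
  (moderateGrowth_iff _).mpr ⟨1, 1, zero_le_one, fun z => by simpa using norm_le_height z⟩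

theorem moderateGrowth_coe_zpow (k : ℤ) : ModerateGrowth (fun z : ℍ => (z : ℂ) ^ k) := by
  rw [moderateGrowth_iff]
  refine ⟨1, k.natAbs, zero_le_one, fun z => ?_⟩
  rw [norm_zpow, one_mul]
  rcases k.natAbs_eq with h | h
  · conv_lhs => rw [h]
    rw [zpow_natCast]
    exact pow_le_pow_left₀ (norm_nonneg _) (norm_le_height z) _
  · conv_lhs => rw [h]
    rw [zpow_neg, zpow_natCast, ← inv_pow]
    refine pow_le_pow_left₀ (by positivity) (le_trans ?_ (inv_im_le_height z)) _
    rw [one_div]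
    exact inv_anti₀ z.im_pos (im_le_norm z)

theorem mdifferentiable_slash {f : ℍ → ℂ} (hf : MDiff f) (k : ℤ) (γ : SL(2, ℤ)) :
    MDiff (f ∣[k] γ) := by
  rw [ModularForm.SL_slash]
  exact hf.slash k _

theorem classP.slash_S {f : ℍ → ℂ} (hf : f ∈ classP) (k : ℤ) : f ∣[k] ModularGroup.S ∈ classP := by
  refine ⟨mdifferentiable_slash hf.1 k _, ?_⟩
  have e : f ∣[k] ModularGroup.S = (f ∘ (ModularGroup.S • ·)) * fun z : ℍ => (z : ℂ) ^ (-k) := by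
    ext z
    exact slash_S_apply k f z
  rw [e]
  exact (hf.2.comp_of_height_le _ 1 fun z => by rw [height_S_smul, one_mul]).mul
    (moderateGrowth_coe_zpow _)

theorem classP.slash_T {f : ℍ → ℂ} (hf : f ∈ classP) (k : ℤ) : f ∣[k] ModularGroup.T ∈ classP := by
  refine ⟨mdifferentiable_slash hf.1 k _, ?_⟩
  have e : f ∣[k] ModularGroup.T = (f ∘ ((1 : ℝ) +ᵥ ·)) := by
    ext z
    exact slash_T_apply k f z
  rw [e]
  exact hf.2.comp_of_height_le _ 3 (height_vadd_le 1 (by norm_num))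

theorem classP.slash_T_inv {f : ℍ → ℂ} (hf : f ∈ classP) (k : ℤ) :
    f ∣[k] ModularGroup.T⁻¹ ∈ classP := by
  refine ⟨mdifferentiable_slash hf.1 k _, ?_⟩
  have e : f ∣[k] ModularGroup.T⁻¹ = (f ∘ ((-1 : ℝ) +ᵥ ·)) := by
    ext z
    exact slash_T_inv_apply k f z
  rw [e]
  exact hf.2.comp_of_height_le _ 3 (height_vadd_le (-1) (by norm_num))

theorem classP.mul {f g : ℍ → ℂ} (hf : f ∈ classP) (hg : g ∈ classP) : f * g ∈ classP :=
  ⟨hf.1.mul hg.1, hf.2.mul hg.2⟩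

theorem classP.one : (1 : ℍ → ℂ) ∈ classP :=
  ⟨mdifferentiable_const, (moderateGrowth_iff _).mpr ⟨1, 0, zero_le_one, fun z => by simp⟩⟩

theorem classP.pow {f : ℍ → ℂ} (hf : f ∈ classP) (n : ℕ) : f ^ n ∈ classP := by
  induction n with
  | zero => simpa using classP.one
  | succ n ih => rw [pow_succ]; exact classP.mul ih hf

theorem classP.coe : (fun z : ℍ => (z : ℂ)) ∈ classP :=
  ⟨UpperHalfPlane.mdifferentiable_coe, moderateGrowth_coe⟩

/-! ### The action of the group algebra -/

/-- The slash action of the group algebra as a linear map in the algebra element. -/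
def slashLin (k : ℤ) (f : ℍ → ℂ) : R →ₗ[ℂ] (ℍ → ℂ) where
  toFun := slashR k f
  map_add' a b := by
    unfold slashR
    rw [MonoidAlgebra.coeff_add, Finsupp.sum_add_index'] <;> simp [add_smul]
  map_smul' c a := by
    unfold slashR
    rw [MonoidAlgebra.coeff_smul, Finsupp.sum_smul_index'] <;>
      simp [Finsupp.smul_sum, mul_smul]

theorem slashLin_apply (k : ℤ) (f : ℍ → ℂ) (r : R) : slashLin k f r = slashR k f r := rfl

theorem slashR_of (k : ℤ) (f : ℍ → ℂ) (γ : PSL2Z) :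
    slashR k f (MonoidAlgebra.of ℂ PSL2Z γ) = slashPSL k f γ := by
  simp [slashR, MonoidAlgebra.of_apply]

theorem slashPSL_mul {k : ℤ} (hk : Even k) (f : ℍ → ℂ) (γ δ : PSL2Z) :
    slashPSL k f (γ * δ) = slashPSL k (slashPSL k f γ) δ := by
  obtain ⟨a, rfl⟩ := QuotientGroup.mk_surjective γ
  obtain ⟨b, rfl⟩ := QuotientGroup.mk_surjective δ
  rw [← QuotientGroup.mk_mul, slashPSL_mk hk, slashPSL_mk hk, slashPSL_mk hk,
    SlashAction.slash_mul]

theorem slashR_mul {k : ℤ} (hk : Even k) (f : ℍ → ℂ) (r s : R) :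
    slashR k f (r * s) = slashR k (slashR k f r) s := by
  induction s using MonoidAlgebra.induction_on with
  | of δ =>
    induction r using MonoidAlgebra.induction_on with
    | of γ => rw [← map_mul, slashR_of, slashR_of, slashR_of, slashPSL_mul hk]
    | add x y hx hy =>
      rw [add_mul, ← slashLin_apply, map_add, slashLin_apply, slashLin_apply, hx, hy,
        ← slashR_add, ← slashLin_apply k f (x + y), map_add, slashLin_apply, slashLin_apply]
    | smul c x hx =>
      rw [smul_mul_assoc, ← slashLin_apply, map_smul, slashLin_apply, hx, ← slashR_smul,
        ← slashLin_apply k f (c • x), map_smul, slashLin_apply]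
  | add x y hx hy =>
    rw [mul_add, ← slashLin_apply, map_add, slashLin_apply, slashLin_apply, hx, hy,
      ← slashLin_apply _ _ (x + y), map_add, slashLin_apply, slashLin_apply]
  | smul c x hx =>
    rw [mul_smul_comm, ← slashLin_apply, map_smul, slashLin_apply, hx,
      ← slashLin_apply _ _ (c • x), map_smul, slashLin_apply]

theorem slashR_toR {k : ℤ} (hk : Even k) (f : ℍ → ℂ) (γ : SL(2, ℤ)) :
    slashR k f (toR γ) = f ∣[k] γ := by
  rw [toR, slashR_of, slashPSL_mk hk]

theorem slashR_one {k : ℤ} (hk : Even k) (f : ℍ → ℂ) :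
    slashR k f 1 = f := by
  have : (1 : R) = toR 1 := by
    rw [toR, QuotientGroup.mk_one, map_one]
  rw [this, slashR_toR hk, SlashAction.slash_one]

/-- By `slashR_mul` the elements of `R` that annihilate `f` form a right ideal, so testing the two
generators is enough. -/
theorem mem_Ann_rightIdeal {k : ℤ} (hk : Even k) (a b : R) (f : ℍ → ℂ) :
    f ∈ Ann k (rightIdeal a b) ↔ f ∈ classP ∧ slashR k f a = 0 ∧ slashR k f b = 0 := by
  constructor
  · rintro ⟨hf, h⟩
    exact ⟨hf, h a (Submodule.mem_sup_left (Submodule.mem_span_singleton_self a)),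
      h b (Submodule.mem_sup_right (Submodule.mem_span_singleton_self b))⟩
  · rintro ⟨hf, ha, hb⟩
    refine ⟨hf, ?_⟩
    let K : RightIdeal :=
      { carrier := {r | slashR k f r = 0}
        zero_mem' := (slashLin k f).map_zero
        add_mem' := fun {x y} hx hy => by
          have := (slashLin k f).map_add x y
          simp only [slashLin_apply] at this
          simp only [Set.mem_ofPred_eq] at hx hy ⊢
          rw [this, hx, hy, add_zero]
        smul_mem' := fun c x hx => by
          simp only [Set.mem_ofPred_eq] at hx ⊢
          rw [show c • x = x * c.unop from rfl, slashR_mul hk, hx, slashR_zero] }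
    have : rightIdeal a b ≤ K := sup_le
      ((Submodule.span_singleton_le_iff_mem _ _).mpr ha)
      ((Submodule.span_singleton_le_iff_mem _ _).mpr hb)
    exact fun r hr => this hr

theorem coe_Ann_rightIdeal {k : ℤ} (hk : Even k) (a b : R) :
    (Ann k (rightIdeal a b) : Set (ℍ → ℂ)) =
      {f | f ∈ classP ∧ slashR k f a = 0 ∧ slashR k f b = 0} := by
  ext f
  exact mem_Ann_rightIdeal hk a b f

theorem two_eq_smul_one : (2 : R) = (2 : ℂ) • 1 := by
  rw [two_smul]
  exact one_add_one_eq_two.symm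

theorem slashR_S_add_one {k : ℤ} (hk : Even k) (f : ℍ → ℂ) :
    slashR k f (S + 1) = f ∣[k] ModularGroup.S + f := by
  rw [← slashLin_apply, map_add, slashLin_apply, slashLin_apply, slashR_one hk, S, slashR_toR hk]

theorem slashR_S_sub_one {k : ℤ} (hk : Even k) (f : ℍ → ℂ) :
    slashR k f (S - 1) = f ∣[k] ModularGroup.S - f := by
  rw [← slashLin_apply, map_sub, slashLin_apply, slashLin_apply, slashR_one hk, S, slashR_toR hk]

theorem slashR_T_sub_one {k : ℤ} (hk : Even k) (f : ℍ → ℂ) :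
    slashR k f (T - 1) = f ∣[k] ModularGroup.T - f := by
  rw [← slashLin_apply, map_sub, slashLin_apply, slashLin_apply, slashR_one hk, T, slashR_toR hk]

theorem slashR_T_sub_one_sq {k : ℤ} (hk : Even k) (f : ℍ → ℂ) :
    slashR k f ((T - 1) ^ 2) =
    (f ∣[k] ModularGroup.T - f) ∣[k] ModularGroup.T - (f ∣[k] ModularGroup.T - f) := by
  rw [pow_two, slashR_mul hk, slashR_T_sub_one hk, slashR_T_sub_one hk]

theorem slashR_STS {k : ℤ} (hk : Even k) (f : ℍ → ℂ) :
    slashR k f (S * T * S) =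
    ((f ∣[k] ModularGroup.S) ∣[k] ModularGroup.T) ∣[k] ModularGroup.S := by
  rw [slashR_mul hk, slashR_mul hk, S, T, slashR_toR hk, slashR_toR hk, slashR_toR hk]

theorem slashR_one_sub_STS {k : ℤ} (hk : Even k) (f : ℍ → ℂ) :
    slashR k f (1 - S * T * S) =
    f - ((f ∣[k] ModularGroup.S) ∣[k] ModularGroup.T) ∣[k] ModularGroup.S := by
  rw [← slashLin_apply, map_sub, slashLin_apply, slashLin_apply, slashR_one hk, slashR_STS hk]

theorem slashR_one_add_STS {k : ℤ} (hk : Even k) (f : ℍ → ℂ) :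
    slashR k f (1 + S * T * S) =
    f + ((f ∣[k] ModularGroup.S) ∣[k] ModularGroup.T) ∣[k] ModularGroup.S := by
  rw [← slashLin_apply, map_add, slashLin_apply, slashLin_apply, slashR_one hk, slashR_STS hk]

theorem slashR_second_difference_sub {k : ℤ} (hk : Even k) (f : ℍ → ℂ) :
    slashR k f (T - 2 + Tinv - 2 * S) =
    f ∣[k] ModularGroup.T - (2 : ℂ) • f + f ∣[k] ModularGroup.T⁻¹
      - (2 : ℂ) • f ∣[k] ModularGroup.S := by
  have e : (T - 2 + Tinv - 2 * S : R) = T - (2 : ℂ) • 1 + Tinv - (2 : ℂ) • S := by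
    rw [← two_eq_smul_one, two_smul, two_mul]
  rw [e, ← slashLin_apply, map_sub, map_add, map_sub, map_smul, map_smul]
  simp only [slashLin_apply]
  rw [slashR_one hk, T, Tinv, S, slashR_toR hk, slashR_toR hk, slashR_toR hk]

theorem slashR_second_difference_add {k : ℤ} (hk : Even k) (f : ℍ → ℂ) :
    slashR k f (T - 2 + Tinv + 2 * S) =
    f ∣[k] ModularGroup.T - (2 : ℂ) • f + f ∣[k] ModularGroup.T⁻¹
      + (2 : ℂ) • f ∣[k] ModularGroup.S := by
  have e : (T - 2 + Tinv + 2 * S : R) = T - (2 : ℂ) • 1 + Tinv + (2 : ℂ) • S := by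
    rw [← two_eq_smul_one, two_smul, two_mul]
  rw [e, ← slashLin_apply, map_add, map_add, map_sub, map_smul, map_smul]
  simp only [slashLin_apply]
  rw [slashR_one hk, T, Tinv, S, slashR_toR hk, slashR_toR hk, slashR_toR hk]

theorem slash_S_slash_S {k : ℤ} (hk : Even k) (f : ℍ → ℂ) :
    (f ∣[k] ModularGroup.S) ∣[k] ModularGroup.S = f := by
  rw [← SlashAction.slash_mul]
  have : ModularGroup.S * ModularGroup.S = -1 := by decide
  rw [this, slash_neg_of_even hk, SlashAction.slash_one]

theorem slash_T_slash_T_inv (k : ℤ) (f : ℍ → ℂ) :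
    (f ∣[k] ModularGroup.T) ∣[k] ModularGroup.T⁻¹ = f := by
  rw [← SlashAction.slash_mul, mul_inv_cancel, SlashAction.slash_one]

theorem slash_T_inv_slash_T (k : ℤ) (f : ℍ → ℂ) :
    (f ∣[k] ModularGroup.T⁻¹) ∣[k] ModularGroup.T = f := by
  rw [← SlashAction.slash_mul, inv_mul_cancel, SlashAction.slash_one]

/-- The braid form of the relation for `ST`; it holds in `SL₂(ℤ)` without a sign. All four ideals
are analysed by evaluating it on suitable functions. -/
theorem slash_STS (k : ℤ) (f : ℍ → ℂ) :
    ((f ∣[k] ModularGroup.S) ∣[k] ModularGroup.T) ∣[k] ModularGroup.S =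
      ((f ∣[k] ModularGroup.T⁻¹) ∣[k] ModularGroup.S) ∣[k] ModularGroup.T⁻¹ := by
  rw [← SlashAction.slash_mul, ← SlashAction.slash_mul, ← SlashAction.slash_mul,
    ← SlashAction.slash_mul]
  congr 1
  decide

theorem sub_slash (k : ℤ) (f g : ℍ → ℂ) (γ : SL(2, ℤ)) :
    (f - g) ∣[k] γ = f ∣[k] γ - g ∣[k] γ := by
  rw [sub_eq_add_neg, SlashAction.add_slash, SlashAction.neg_slash, sub_eq_add_neg]

theorem mul_slash_sub (k j : ℤ) (f g : ℍ → ℂ) (γ : SL(2, ℤ)) :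
    (f * g) ∣[k] γ = f ∣[k - j] γ * g ∣[j] γ := by
  have := ModularForm.mul_slash_SL2 (k - j) j γ f g
  rwa [sub_add_cancel] at this

/-! ### Modular forms of level one -/

theorem periodic_of_slash_T {k : ℤ} {f : ℍ → ℂ} (hT : f ∣[k] ModularGroup.T = f) :
    Function.Periodic (f ∘ ofComplex) (1 : ℝ) := by
  intro w
  have h1 : ∀ z : ℍ, f ((1 : ℝ) +ᵥ z) = f z := fun z => by
    rw [← slash_T_apply k f z, hT]
  by_cases hw : 0 < w.im
  · have hw' : 0 < (w + (1 : ℝ)).im := by simpa using hw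
    simp only [Function.comp_apply]
    rw [ofComplex_apply_of_im_pos hw, ofComplex_apply_of_im_pos hw', ← h1 ⟨w, hw⟩]
    congr 1
    ext
    simp [add_comm]
  -- Off the upper half-plane `ofComplex` takes a single default value, so periodicity persists
  -- there.
  · have hw' : (w + (1 : ℝ)).im ≤ 0 := by simpa using hw
    simp only [Function.comp_apply]
    rw [ofComplex_apply_of_im_nonpos (not_lt.mp hw), ofComplex_apply_of_im_nonpos hw']

/-- A level one modular form from a holomorphic function, bounded at infinity and invariant under
the two generators. -/
def modularFormOfBounded {k : ℤ} (f : ℍ → ℂ) (hf : MDiff f)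
    (hS : f ∣[k] ModularGroup.S = f) (hT : f ∣[k] ModularGroup.T = f)
    (hb : IsBoundedAtImInfty f) : ModularForm 𝒮ℒ k where
  toFun := f
  slash_action_eq' A hA := by
    obtain ⟨A, rfl⟩ := hA
    exact SlashInvariantForm.slash_action_generators_SL2Z hS hT A
  holo' := hf
  bdd_at_cusps' {c} hc := by
    rw [OnePoint.isBoundedAt_iff_forall_SL2Z hc]
    intro γ _
    rw [SlashInvariantForm.slash_action_generators_SL2Z hS hT γ]
    exact hb

/-- A level one cusp form from a holomorphic function, vanishing at infinity and invariant under
the two generators. -/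
def cuspFormOfZero {k : ℤ} (f : ℍ → ℂ) (hf : MDiff f)
    (hS : f ∣[k] ModularGroup.S = f) (hT : f ∣[k] ModularGroup.T = f)
    (hb : IsZeroAtImInfty f) : CuspForm 𝒮ℒ k where
  toFun := f
  slash_action_eq' A hA := by
    obtain ⟨A, rfl⟩ := hA
    exact SlashInvariantForm.slash_action_generators_SL2Z hS hT A
  holo' := hf
  zero_at_cusps' {c} hc := by
    rw [OnePoint.isZeroAt_iff_forall_SL2Z hc]
    intro γ _
    rw [SlashInvariantForm.slash_action_generators_SL2Z hS hT γ]
    exact hb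

theorem modularForm_slash {k : ℤ} (g : ModularForm 𝒮ℒ k) (γ : SL(2, ℤ)) :
    (g : ℍ → ℂ) ∣[k] γ = g :=
  g.slash_action_eq' _ ⟨γ, rfl⟩

/-! ### Decay at the cusp of periodic and antiperiodic functions. -/

/-- Multiplication by `exp(2π i c z)`. -/
def expMul (c : ℝ) (z : ℍ) : ℂ := Complex.exp (2 * Real.pi * Complex.I * c * z)

theorem norm_expMul (c : ℝ) (z : ℍ) : ‖expMul c z‖ = Real.exp (-2 * Real.pi * c * z.im) := by
  rw [expMul, Complex.norm_exp]
  congr 1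
  simp

theorem mdifferentiable_expMul (c : ℝ) : MDiff (expMul c) := by
  rw [UpperHalfPlane.mdifferentiable_iff]
  have : DifferentiableOn ℂ (fun w : ℂ => Complex.exp (2 * Real.pi * Complex.I * c * w))
      {z | 0 < z.im} := by fun_prop
  refine this.congr fun w hw => ?_
  simp [expMul, ofComplex_apply_of_im_pos hw]

theorem exists_vadd_re_mem (z : ℍ) : ∃ n : ℤ, ((n : ℝ) +ᵥ z).re ∈ Set.Ico (0 : ℝ) 1 := by
  refine ⟨-⌊z.re⌋, ?_⟩
  rw [UpperHalfPlane.vadd_re]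
  push_cast
  constructor
  · linarith [Int.floor_le z.re]
  · linarith [Int.lt_floor_add_one z.re]

/-- A function of moderate growth with `|f(z+1)| = |f(z)|` grows polynomially at `i∞`. -/
theorem ModerateGrowth.norm_le_im_pow {f : ℍ → ℂ} (hf : ModerateGrowth f)
    (hT : ∀ z, ‖f ((1 : ℝ) +ᵥ z)‖ = ‖f z‖) :
    ∃ (C : ℝ) (N : ℕ), 0 ≤ C ∧ ∀ z : ℍ, 1 ≤ z.im → ‖f z‖ ≤ C * z.im ^ N := by
  obtain ⟨C, N, hC, h⟩ := (moderateGrowth_iff f).mp hf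
  have hn : ∀ (n : ℤ) (z : ℍ), ‖f ((n : ℝ) +ᵥ z)‖ = ‖f z‖ := by
    intro n
    induction n using Int.induction_on with
    | zero => simp
    | succ n ih =>
      intro z
      rw [← ih z, ← hT (((n : ℤ) : ℝ) +ᵥ z), vadd_vadd]
      push_cast
      rw [add_comm]
    | pred n ih =>
      intro z
      rw [← ih z, ← hT, vadd_vadd]
      push_cast
      ring_nf
  refine ⟨C * 3 ^ N, N, by positivity, fun z hz => ?_⟩
  -- After translation to `0 ≤ x < 1`, the height `(1 + x² + y²)/y` is at most `3y` for `y ≥ 1`.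
  obtain ⟨n, h0, h1⟩ := exists_vadd_re_mem z
  rw [← hn n z, mul_assoc, ← mul_pow]
  refine (h _).trans ?_
  have := (height_pos ((n : ℝ) +ᵥ z)).le
  gcongr
  rw [height, ← Complex.normSq_eq_norm_sq, Complex.normSq_apply, UpperHalfPlane.coe_re,
    UpperHalfPlane.coe_im, UpperHalfPlane.vadd_im, div_le_iff₀ z.im_pos]
  nlinarith

theorem isZeroAtImInfty_expMul_mul {f : ℍ → ℂ} {c C : ℝ} {N : ℕ} (hc : 0 < c)
    (h : ∀ z : ℍ, 1 ≤ z.im → ‖f z‖ ≤ C * z.im ^ N) : IsZeroAtImInfty (expMul c * f) := by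
  have h1 : Tendsto (fun y : ℝ => C * (y ^ N * Real.exp (-(2 * Real.pi * c) * y))) atTop (𝓝 0) := by
    have := (tendsto_rpow_mul_exp_neg_mul_atTop_nhds_zero N (2 * Real.pi * c)
      (by positivity)).const_mul C
    simpa [Real.rpow_natCast] using this
  rw [IsZeroAtImInfty, ZeroAtFilter]
  refine squeeze_zero_norm' ?_ (h1.comp tendsto_comap)
  filter_upwards [preimage_mem_comap (Ici_mem_atTop (1 : ℝ))] with z hz
  rw [Pi.mul_apply, norm_mul, norm_expMul]
  have := h z hz
  have e : -2 * Real.pi * c * z.im = -(2 * Real.pi * c) * z.im := by ring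
  rw [e]
  calc _ ≤ Real.exp (-(2 * Real.pi * c) * z.im) * (C * z.im ^ N) := by gcongr
    _ = _ := by
      simp only [Function.comp_apply]
      ring

/-- The product `expMul c * f` is 1-periodic and vanishes at `i∞`, since the exponential beats
polynomial growth. It is therefore `O(|q|)` with `q = exp(2πiz)`, and dividing by `expMul c` leaves
the exponent `1 - c`. The value `c = 1` yields boundedness of periodic functions, `c = 1/2` the
decay `exp(-πy)` of antiperiodic ones. -/
theorem decay_of_growth {f : ℍ → ℂ} (hf : f ∈ classP) {c : ℝ} (hc : 0 < c)
    (hT : ∀ z, expMul c ((1 : ℝ) +ᵥ z) * f ((1 : ℝ) +ᵥ z) = expMul c z * f z) :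
    ∃ C A : ℝ, 0 ≤ C ∧ ∀ z : ℍ, A ≤ z.im →
      ‖f z‖ ≤ C * Real.exp (-2 * Real.pi * (1 - c) * z.im) := by
  have hnorm : ∀ z, ‖f ((1 : ℝ) +ᵥ z)‖ = ‖f z‖ := fun z => by
    have := congrArg norm (hT z)
    rw [norm_mul, norm_mul, norm_expMul, norm_expMul, UpperHalfPlane.vadd_im] at this
    exact mul_left_cancel₀ (Real.exp_pos _).ne' this
  obtain ⟨C, N, hC, h⟩ := hf.2.norm_le_im_pow hnorm
  have hz := isZeroAtImInfty_expMul_mul hc h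
  have hslash : (expMul c * f) ∣[(0 : ℤ)] ModularGroup.T = expMul c * f := by
    ext z
    rw [slash_T_apply]
    exact hT z
  have hO := hz.exp_decay_atImInfty one_pos (periodic_of_slash_T hslash)
    ((mdifferentiable_expMul c).mul hf.1) hz.isBoundedAtImInfty
  obtain ⟨D, hD⟩ := hO.bound
  rw [atImInfty, eventually_comap, eventually_atTop] at hD
  obtain ⟨A, hA⟩ := hD
  refine ⟨max D 0, A, le_max_right _ _, fun z hz => ?_⟩
  have := hA z.im hz z rfl
  rw [Pi.mul_apply, norm_mul, norm_expMul, Real.norm_of_nonneg (Real.exp_pos _).le, div_one] at this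
  have e : Real.exp (-2 * Real.pi * z.im) =
      Real.exp (-2 * Real.pi * c * z.im) * Real.exp (-2 * Real.pi * (1 - c) * z.im) := by
    rw [← Real.exp_add]
    ring_nf
  rw [e] at this
  have h2 : ‖f z‖ ≤ D * Real.exp (-2 * Real.pi * (1 - c) * z.im) := by
    refine le_of_mul_le_mul_left ?_ (Real.exp_pos (-2 * Real.pi * c * z.im))
    linarith
  exact h2.trans (by gcongr; exact le_max_left _ _)

theorem expMul_one_vadd (c : ℝ) (z : ℍ) :
    expMul c ((1 : ℝ) +ᵥ z) = Complex.exp (2 * Real.pi * Complex.I * c) * expMul c z := by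
  rw [expMul, expMul, UpperHalfPlane.coe_vadd, ← Complex.exp_add]
  push_cast
  ring_nf

theorem isBoundedAtImInfty_of_classP {k : ℤ} {f : ℍ → ℂ} (hf : f ∈ classP)
    (hT : f ∣[k] ModularGroup.T = f) : IsBoundedAtImInfty f := by
  obtain ⟨C, A, _, h⟩ := decay_of_growth hf (c := 1) one_pos fun z => by
    rw [expMul_one_vadd, ← slash_T_apply k f z, hT, Complex.ofReal_one, mul_one,
      Complex.exp_two_pi_mul_I, one_mul]
  rw [isBoundedAtImInfty_iff]
  exact ⟨C, A, fun z hz => by simpa using h z hz⟩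

theorem decay_of_antiperiodic {k : ℤ} {f : ℍ → ℂ} (hf : f ∈ classP)
    (hT : f ∣[k] ModularGroup.T = -f) : ∃ C A : ℝ, 0 ≤ C ∧ ∀ z : ℍ, A ≤ z.im →
      ‖f z‖ ≤ C * Real.exp (-Real.pi * z.im) := by
  obtain ⟨C, A, hC, h⟩ := decay_of_growth hf (c := 1 / 2) (by norm_num) fun z => by
    have e : (2 * Real.pi * Complex.I * ((1 / 2 : ℝ) : ℂ)) = Real.pi * Complex.I := by
      push_cast
      ring
    rw [expMul_one_vadd, ← slash_T_apply k f z, hT, e, Complex.exp_pi_mul_I]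
    simp
  refine ⟨C, A, hC, fun z hz => (h z hz).trans_eq ?_⟩
  ring_nf

/-- A function in `𝒫` invariant under the generators is a modular form of level one. -/
theorem exists_modularForm {k : ℤ} {f : ℍ → ℂ} (hf : f ∈ classP)
    (hS : f ∣[k] ModularGroup.S = f) (hT : f ∣[k] ModularGroup.T = f) :
    ∃ g : ModularForm 𝒮ℒ k, (g : ℍ → ℂ) = f :=
  ⟨modularFormOfBounded f hf.1 hS hT (isBoundedAtImInfty_of_classP hf hT), rfl⟩

theorem modularForm_mem_classP {k : ℤ} (g : ModularForm 𝒮ℒ k) : (g : ℍ → ℂ) ∈ classP := by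
  refine ⟨g.holo', ?_⟩
  rcases lt_or_ge k 0 with hk | hk
  · rw [ModularFormClass.levelOne_neg_weight_eq_zero hk g]
    exact (classP.zero_mem).2
  · obtain ⟨C, hC⟩ := ModularFormClass.exists_bound hk g
    lift k to ℕ using hk
    have h0 : 0 ≤ C := by
      have := (norm_nonneg _).trans (hC UpperHalfPlane.I)
      exact nonneg_of_mul_nonneg_left this (lt_max_of_lt_left one_pos)
    refine moderateGrowth_of_im_bound C k h0 fun z => (hC z).trans ?_
    have := z.im_pos
    gcongr
    rw [max_le_iff]
    have h1 : (0 : ℝ) ≤ 1 / z.im := by positivity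
    refine ⟨one_le_pow₀ (by linarith), ?_⟩
    rw [zpow_natCast, ← one_div_pow]
    gcongr
    linarith

/-! ### The Eisenstein series `E₂` -/

theorem coe_S_smul (z : ℍ) : ((ModularGroup.S • z : ℍ) : ℂ) = -1 / z := by
  rw [UpperHalfPlane.modular_S_smul]
  simp [neg_div]

theorem coe_one_vadd (z : ℍ) : (((1 : ℝ) +ᵥ z : ℍ) : ℂ) = 1 + z := by
  rw [UpperHalfPlane.coe_vadd, Complex.ofReal_one]

theorem slash_S_eq_iff {k : ℤ} {f g : ℍ → ℂ} :
    f ∣[k] ModularGroup.S = g ↔ ∀ z : ℍ, f (ModularGroup.S • z) = (z : ℂ) ^ k * g z := by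
  rw [funext_iff]
  refine forall_congr' fun z => ?_
  have := zpow_ne_zero k z.ne_zero
  rw [slash_S_apply, zpow_neg, ← div_eq_mul_inv, div_eq_iff this, mul_comm]

theorem slash_T_eq_iff {k : ℤ} {f g : ℍ → ℂ} :
    f ∣[k] ModularGroup.T = g ↔ ∀ z : ℍ, f ((1 : ℝ) +ᵥ z) = g z := by
  rw [funext_iff]
  exact forall_congr' fun z => by rw [slash_T_apply]

theorem E2_S_smul (z : ℍ) :
    E₂ (ModularGroup.S • z) = (z : ℂ) ^ 2 * E₂ z - 6 * Complex.I / Real.pi * z := by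
  have hz := z.ne_zero
  have hpi : (Real.pi : ℂ) ≠ 0 := by exact_mod_cast Real.pi_ne_zero
  have h := EisensteinSeries.G2_S_transform z
  simp only [E₂, EisensteinSeries.E2, Pi.smul_apply, smul_eq_mul, riemannZeta_two]
  have h2 : EisensteinSeries.G2 (ModularGroup.S • z) =
      (z : ℂ) ^ 2 * EisensteinSeries.G2 z - 2 * Real.pi * Complex.I * z := by
    rw [h]
    field_simp
    ring
  rw [h2]
  field_simp

theorem E2_slash_T (k : ℤ) : E₂ ∣[k] ModularGroup.T = E₂ := by
  have h := EisensteinSeries.E2_slash_action ModularGroup.T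
  rw [EisensteinSeries.D2_T, smul_zero, sub_zero] at h
  rw [slash_T_eq_iff] at h ⊢
  exact h

theorem E2_one_vadd (z : ℍ) : E₂ ((1 : ℝ) +ᵥ z) = E₂ z :=
  slash_T_eq_iff.mp (E2_slash_T 0) z

/-- From `exp x ≥ x⁴/4!`. The fourth power is chosen so that, against `σ₁(n) ≤ n²`, the series of
`E₂` is still dominated by `∑ 1/n²`. -/
theorem norm_qParam_pow_le (z : ℍ) (n : ℕ) (hn : 0 < n) :
    ‖Complex.exp (2 * Real.pi * Complex.I * z) ^ n‖ ≤ 24 * (1 / z.im) ^ 4 * (1 / (n : ℝ) ^ 4) := by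
  have hy := z.im_pos
  have hn' : (0 : ℝ) < n := by exact_mod_cast hn
  rw [norm_pow, Complex.norm_exp, ← Real.exp_nat_mul]
  have e : (2 * Real.pi * Complex.I * (z : ℂ)).re = -(2 * Real.pi * z.im) := by simp
  rw [e]
  have h1 := Real.pow_div_factorial_le_exp (x := n * z.im) (by positivity) 4
  have h2 : Real.exp (n * -(2 * Real.pi * z.im)) ≤ Real.exp (-(n * z.im)) := by
    apply Real.exp_le_exp.mpr
    nlinarith [Real.pi_gt_three, mul_pos hn' hy]
  refine h2.trans ?_
  rw [Real.exp_neg]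
  have h3 : (0 : ℝ) < (n * z.im) ^ 4 / 24 := by positivity
  have h4 : (n * z.im) ^ 4 / 24 ≤ Real.exp (n * z.im) := by
    simpa [Nat.factorial] using h1
  refine (inv_anti₀ h3 h4).trans_eq ?_
  field_simp

theorem E2_mem_classP : E₂ ∈ classP := by
  refine ⟨E2_mdifferentiable, ?_⟩
  have hs : Summable fun n : ℕ+ => 1 / ((n : ℕ) : ℝ) ^ 2 :=
    (Real.summable_one_div_nat_pow.mpr one_lt_two).comp_injective PNat.coe_injective
  set K := ∑' n : ℕ+, 1 / ((n : ℕ) : ℝ) ^ 2 with hK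
  have hK0 : 0 ≤ K := tsum_nonneg fun n => by positivity
  refine moderateGrowth_of_im_bound (1 + 576 * K) 4 (by positivity) fun z => ?_
  have hy := z.im_pos
  have hb : ‖∑' n : ℕ+, (ArithmeticFunction.sigma 1 (n : ℕ) : ℂ) *
      Complex.exp (2 * Real.pi * Complex.I * z) ^ (n : ℕ)‖ ≤ 24 * (1 / z.im) ^ 4 * K := by
    refine tsum_of_norm_bounded (hs.hasSum.mul_left (24 * (1 / z.im) ^ 4)) fun n => ?_
    have hn' : (0 : ℝ) < (n : ℕ) := by exact_mod_cast n.pos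
    rw [norm_mul, Complex.norm_natCast]
    have h1 : ((ArithmeticFunction.sigma 1 (n : ℕ) : ℕ) : ℝ) ≤ ((n : ℕ) : ℝ) ^ 2 := by
      exact_mod_cast ArithmeticFunction.sigma_le_pow_succ 1 n
    calc _ ≤ ((n : ℕ) : ℝ) ^ 2 * (24 * (1 / z.im) ^ 4 * (1 / ((n : ℕ) : ℝ) ^ 4)) :=
          mul_le_mul h1 (norm_qParam_pow_le z n n.pos) (norm_nonneg _) (by positivity)
      _ = _ := by field_simp
  have e : E₂ z = 1 - 24 * ∑' n : ℕ+, (ArithmeticFunction.sigma 1 (n : ℕ) : ℂ) *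
      Complex.exp (2 * Real.pi * Complex.I * z) ^ (n : ℕ) := by
    rw [E₂, EisensteinSeries.E2_eq_tsum_cexp]
  rw [e]
  have h1 : (0 : ℝ) ≤ 1 / z.im := by positivity
  have h2 : (1 : ℝ) ≤ (1 + 1 / z.im) ^ 4 := one_le_pow₀ (by linarith)
  have h3 : (1 / z.im) ^ 4 ≤ (1 + 1 / z.im) ^ 4 := pow_le_pow_left₀ h1 (by linarith) 4
  refine (norm_sub_le _ _).trans ?_
  rw [norm_one, norm_mul, Complex.norm_ofNat]
  nlinarith

/-- The functions `1, E₂, E₂²` are linearly independent over level one modular forms. -/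
theorem eq_zero_of_E2_relation {a b c : ℤ} {f g h : ℍ → ℂ}
    (hab : b = a + 2) (hbc : c = b + 2)
    (hfS : f ∣[a] ModularGroup.S = f) (hgS : g ∣[b] ModularGroup.S = g)
    (hhS : h ∣[c] ModularGroup.S = h)
    (hfT : f ∣[a] ModularGroup.T = f) (hgT : g ∣[b] ModularGroup.T = g)
    (hhT : h ∣[c] ModularGroup.T = h)
    (H : E₂ ^ 2 * f + E₂ * g + h = 0) : f = 0 ∧ g = 0 ∧ h = 0 := by
  subst hab
  subst hbc
  rw [slash_S_eq_iff] at hfS hgS hhS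
  rw [slash_T_eq_iff] at hfT hgT hhT
  have H0 : ∀ z, E₂ z ^ 2 * f z + E₂ z * g z + h z = 0 := fun z => congrFun H z
  set ε : ℂ := -(6 * Complex.I / Real.pi) with hε
  have hpi : (Real.pi : ℂ) ≠ 0 := by exact_mod_cast Real.pi_ne_zero
  have hε0 : ε ≠ 0 := by simp [hε, hpi]
  -- The relation at `-1/z`, cleared of the common power of `z`.
  have H1 : ∀ z : ℍ, (z * E₂ z + ε) ^ 2 * f z + z * (z * E₂ z + ε) * g z + z ^ 2 * h z = 0 := by
    intro z
    have hz := z.ne_zero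
    have := H0 (ModularGroup.S • z)
    rw [E2_S_smul, hfS, hgS, hhS, zpow_add₀ hz, zpow_add₀ hz, zpow_add₀ hz] at this
    have hza := zpow_ne_zero a hz
    refine mul_left_cancel₀ (mul_ne_zero hza (pow_ne_zero 2 hz)) ?_
    rw [hε]
    rw [zpow_two] at this
    linear_combination this
  have key : ∀ z, f z = 0 ∧ g z = 0 ∧ h z = 0 := by
    intro z
    have h0 := H0 z
    have h1 := H1 z
    -- Under `z ↦ z + 1` only the explicit variable changes. After subtracting multiples of `h0` the
    -- relation is affine in that variable, and its values at `z` and `z + 1` make both coefficients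
    -- vanish.
    have h2 := H1 ((1 : ℝ) +ᵥ z)
    rw [E2_one_vadd, hfT, hgT, hhT, coe_one_vadd] at h2
    have e1 : (2 * z * E₂ z + ε) * f z + z * g z = 0 := by
      refine mul_left_cancel₀ hε0 ?_
      linear_combination h1 - z ^ 2 * h0
    have e2 : (2 * (1 + z) * E₂ z + ε) * f z + (1 + z) * g z = 0 := by
      refine mul_left_cancel₀ hε0 ?_
      linear_combination h2 - (1 + z) ^ 2 * h0
    have e3 : f z = 0 := by
      refine mul_left_cancel₀ hε0 ?_
      linear_combination (1 + z) * e1 - z * e2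
    have e4 : g z = 0 := by
      rw [e3] at e1 e2
      linear_combination e2 - e1
    refine ⟨e3, e4, ?_⟩
    rw [e3, e4] at h0
    linear_combination h0
  exact ⟨funext fun z => (key z).1, funext fun z => (key z).2.1, funext fun z => (key z).2.2⟩

/-- Decomposition of a triple of functions transforming like `1, z, z²` in weight `-2`. -/
theorem exists_E2_decomposition {k : ℤ} {p f h : ℍ → ℂ} (hp : p ∈ classP) (hf : f ∈ classP)
    (hh : h ∈ classP) (pT : p ∣[k] ModularGroup.T = p) (fT : f ∣[k] ModularGroup.T = f + p)
    (hT : h ∣[k] ModularGroup.T = h + (2 : ℂ) • f + p) (pS : p ∣[k] ModularGroup.S = h)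
    (hS : h ∣[k] ModularGroup.S = p) (fS : f ∣[k] ModularGroup.S = -f) :
    ∃ (a : ModularForm 𝒮ℒ (k - 2)) (b : ModularForm 𝒮ℒ k) (c : ModularForm 𝒮ℒ (k + 2)),
      f = phi2 * a + phi0 * b + phiNeg2 * c := by
  rw [slash_T_eq_iff] at pT fT hT
  rw [slash_S_eq_iff] at pS fS hS
  simp only [Pi.add_apply, Pi.smul_apply, Pi.neg_apply, smul_eq_mul] at fT hT fS
  have hpi : (Real.pi : ℂ) ≠ 0 := by exact_mod_cast Real.pi_ne_zero
  -- Normalised so that `e = ε E₂` satisfies `e(-1/z) = z² e(z) + z`.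
  set ε : ℂ := Real.pi * Complex.I / 6 with hε
  have hε0 : ε ≠ 0 := by simp [hε, hpi]
  have hεinv : 6 * Complex.I / Real.pi = -1 / ε := by
    rw [hε]
    field_simp
    rw [Complex.I_sq]
  let ζ : ℍ → ℂ := fun z => z
  have hζ : ζ ∈ classP := classP.coe
  set e : ℍ → ℂ := ε • E₂ with he
  have heP : e ∈ classP := classP.smul_mem ε E2_mem_classP
  have eS : ∀ z : ℍ, e (ModularGroup.S • z) = z ^ 2 * e z + z := by
    intro z
    simp only [he, Pi.smul_apply, smul_eq_mul]
    rw [E2_S_smul, hεinv]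
    field_simp
    ring
  have eT : ∀ z : ℍ, e ((1 : ℝ) +ᵥ z) = e z := by
    intro z
    simp only [he, Pi.smul_apply]
    rw [E2_one_vadd]
  have ζS : ∀ z : ℍ, ζ (ModularGroup.S • z) = -1 / z := coe_S_smul
  have ζT : ∀ z : ℍ, ζ ((1 : ℝ) +ᵥ z) = 1 + z := coe_one_vadd
  have ζ' : ∀ z : ℍ, ζ z = z := fun z => rfl
  -- With `P(X) = h - 2fX + pX²`, the three forms are `a = P(z)`, `b = P'(z) + 2ea` and `c =
  -- P''(z)/2 + eb - e²a`. The terms in `e` cancel the failure of `P'(z)` and `P''(z)` to be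
  -- modular.
  obtain ⟨a, ha⟩ : ∃ a : ModularForm 𝒮ℒ (k - 2), (a : ℍ → ℂ) =
      h - (2 : ℂ) • (f * ζ) + p * ζ ^ 2 := by
    refine exists_modularForm ?_ ?_ ?_
    · exact classP.add_mem (classP.sub_mem hh (classP.smul_mem _ (classP.mul hf hζ))) (classP.mul hp (classP.pow hζ 2))
    · rw [slash_S_eq_iff]
      intro z
      have hz := z.ne_zero
      simp only [Pi.add_apply, Pi.sub_apply, Pi.smul_apply, Pi.mul_apply, Pi.pow_apply, smul_eq_mul,
        ζS, pS, fS, hS, ζ', zpow_sub₀ hz, zpow_ofNat]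
      field_simp
      ring
    · rw [slash_T_eq_iff]
      intro z
      simp only [Pi.add_apply, Pi.sub_apply, Pi.smul_apply, Pi.mul_apply, Pi.pow_apply, smul_eq_mul,
        ζT, pT, fT, hT, ζ']
      ring
  have haS := slash_S_eq_iff.mp (modularForm_slash a ModularGroup.S)
  have haT := slash_T_eq_iff.mp (modularForm_slash a ModularGroup.T)
  have haz : ∀ z, a z = h z - 2 * (f z * z) + p z * z ^ 2 := fun z => congrFun ha z
  obtain ⟨b, hb⟩ : ∃ b : ModularForm 𝒮ℒ k, (b : ℍ → ℂ) =
      (2 : ℂ) • (p * ζ) - (2 : ℂ) • f + (2 : ℂ) • (e * a) := by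
    have hae := modularForm_mem_classP a
    refine exists_modularForm ?_ ?_ ?_
    · exact classP.add_mem (classP.sub_mem (classP.smul_mem _ (classP.mul hp hζ)) (classP.smul_mem _ hf))
        (classP.smul_mem _ (classP.mul heP hae))
    · rw [slash_S_eq_iff]
      intro z
      have hz := z.ne_zero
      simp only [Pi.add_apply, Pi.sub_apply, Pi.smul_apply, Pi.mul_apply, smul_eq_mul, ζS, pS, fS,
        haS, eS, ζ', zpow_sub₀ hz, zpow_ofNat]
      rw [haz]
      field_simp
      ring
    · rw [slash_T_eq_iff]
      intro z
      simp only [Pi.add_apply, Pi.sub_apply, Pi.smul_apply, Pi.mul_apply, smul_eq_mul, ζT, pT, fT,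
        haT, eT, ζ']
      ring
  have hbS := slash_S_eq_iff.mp (modularForm_slash b ModularGroup.S)
  have hbT := slash_T_eq_iff.mp (modularForm_slash b ModularGroup.T)
  have hbz : ∀ z, b z = 2 * (p z * z) - 2 * f z + 2 * (e z * a z) := fun z => congrFun hb z
  obtain ⟨c, hc⟩ : ∃ c : ModularForm 𝒮ℒ (k + 2), (c : ℍ → ℂ) = p + e * b - e ^ 2 * a := by
    have hae := modularForm_mem_classP a
    have hbe := modularForm_mem_classP b
    refine exists_modularForm ?_ ?_ ?_
    · exact classP.sub_mem (classP.add_mem hp (classP.mul heP hbe)) (classP.mul (classP.pow heP 2) hae)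
    · rw [slash_S_eq_iff]
      intro z
      have hz := z.ne_zero
      simp only [Pi.add_apply, Pi.sub_apply, Pi.mul_apply, Pi.pow_apply, pS, haS, hbS, eS,
        zpow_sub₀ hz, zpow_add₀ hz, zpow_ofNat]
      rw [hbz, haz]
      field_simp
      ring
    · rw [slash_T_eq_iff]
      intro z
      simp only [Pi.add_apply, Pi.sub_apply, Pi.mul_apply, Pi.pow_apply, pT, haT, hbT, eT]
  have hcz : ∀ z, c z = p z + e z * b z - e z ^ 2 * a z := fun z => congrFun hc z
  -- Solving for `f` gives `f = (ze² + e)a - (ze + 1/2)b + zc`, where `ze² + e = ε²φ₂` and `ze + 1/2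
  -- = εφ₀`.
  refine ⟨ε ^ 2 • a, -ε • b, c, ?_⟩
  ext z
  have h3 : 3 * Complex.I / Real.pi = -1 / (2 * ε) := by
    have : 3 * Complex.I / Real.pi = (6 * Complex.I / Real.pi) / 2 := by ring
    rw [this, hεinv]
    ring
  have hez : e z = ε * E₂ z := rfl
  simp only [Pi.add_apply, Pi.mul_apply, phi2, phi0, phiNeg2, FunLike.coe_smul, Pi.smul_apply,
    smul_eq_mul]
  rw [hcz, hbz, haz, hεinv, h3, hez]
  field_simp
  ring

/-! ### Sums of three multiples of spaces of modular forms and their dimensions -/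

theorem mem_mulForms_sup {φ₁ φ₂ φ₃ : ℍ → ℂ} {a b c : ℤ} {f : ℍ → ℂ} :
    f ∈ mulForms φ₁ a ⊔ mulForms φ₂ b ⊔ mulForms φ₃ c ↔
      ∃ (x : ModularForm 𝒮ℒ a) (y : ModularForm 𝒮ℒ b) (w : ModularForm 𝒮ℒ c),
        f = φ₁ * x + φ₂ * y + φ₃ * w := by
  constructor
  · intro h
    obtain ⟨_, h1, _, ⟨w, rfl⟩, rfl⟩ := Submodule.mem_sup.mp h
    obtain ⟨_, ⟨x, rfl⟩, _, ⟨y, rfl⟩, rfl⟩ := Submodule.mem_sup.mp h1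
    exact ⟨x, y, w, rfl⟩
  · rintro ⟨x, y, w, rfl⟩
    exact Submodule.add_mem_sup (Submodule.add_mem_sup ⟨x, rfl⟩ ⟨y, rfl⟩) ⟨w, rfl⟩

/-- The map `(x, y, w) ↦ φ₁ x + φ₂ y + φ₃ w`. -/
def combineForms (φ₁ φ₂ φ₃ : ℍ → ℂ) (a b c : ℤ) :
    (ModularForm 𝒮ℒ a × ModularForm 𝒮ℒ b × ModularForm 𝒮ℒ c) →ₗ[ℂ] (ℍ → ℂ) where
  toFun v := φ₁ * v.1 + φ₂ * v.2.1 + φ₃ * v.2.2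
  map_add' v w := by
    ext z
    simp
    ring
  map_smul' t v := by
    ext z
    simp
    ring

theorem range_combineForms (φ₁ φ₂ φ₃ : ℍ → ℂ) (a b c : ℤ) :
    LinearMap.range (combineForms φ₁ φ₂ φ₃ a b c) =
      mulForms φ₁ a ⊔ mulForms φ₂ b ⊔ mulForms φ₃ c := by
  ext f
  rw [mem_mulForms_sup, LinearMap.mem_range]
  constructor
  · rintro ⟨v, rfl⟩
    exact ⟨v.1, v.2.1, v.2.2, rfl⟩
  · rintro ⟨x, y, w, rfl⟩
    exact ⟨(x, y, w), rfl⟩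

theorem hasDim_mulForms_sup {φ₁ φ₂ φ₃ : ℍ → ℂ} {a b c : ℤ}
    (H : ∀ (x : ModularForm 𝒮ℒ a) (y : ModularForm 𝒮ℒ b) (w : ModularForm 𝒮ℒ c),
      φ₁ * x + φ₂ * y + φ₃ * w = 0 → (x : ℍ → ℂ) = 0 ∧ (y : ℍ → ℂ) = 0 ∧ (w : ℍ → ℂ) = 0) :
    HasDim (mulForms φ₁ a ⊔ mulForms φ₂ b ⊔ mulForms φ₃ c)
      (Module.finrank ℂ (ModularForm 𝒮ℒ a) + Module.finrank ℂ (ModularForm 𝒮ℒ b) +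
        Module.finrank ℂ (ModularForm 𝒮ℒ c)) := by
  have hinj : Function.Injective (combineForms φ₁ φ₂ φ₃ a b c) := by
    rw [injective_iff_map_eq_zero]
    rintro ⟨x, y, w⟩ h
    obtain ⟨hx, hy, hw⟩ := H x y w h
    exact Prod.ext (DFunLike.coe_injective hx)
      (Prod.ext (DFunLike.coe_injective hy) (DFunLike.coe_injective hw))
  rw [← range_combineForms]
  refine ⟨inferInstance, ?_⟩
  rw [LinearMap.finrank_range_of_inj hinj, Module.finrank_prod, Module.finrank_prod]
  push_cast
  ring

theorem finrank_levelOne {k : ℤ} (hk : Even k) :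
    (Module.finrank ℂ (ModularForm 𝒮ℒ k) : ℤ) =
      if k < 0 then 0 else if k % 12 = 2 then k / 12 else k / 12 + 1 := by
  split_ifs with h1 h2
  · rw [Module.finrank, ModularForm.levelOne_neg_weight_rank_zero h1]
    simp
  · lift k to ℕ using not_lt.mp h1
    have h3 : k ≡ 2 [MOD 12] := by
      unfold Nat.ModEq
      omega
    rw [Module.finrank, ModularForm.dimension_level_one k (by exact_mod_cast hk), if_pos h3]
    simp
  · lift k to ℕ using not_lt.mp h1
    have h3 : ¬ k ≡ 2 [MOD 12] := by
      unfold Nat.ModEq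
      omega
    rw [Module.finrank, ModularForm.dimension_level_one k (by exact_mod_cast hk), if_neg h3]
    simp

theorem ceil_div_four (k : ℤ) : ⌈(k : ℚ) / 4⌉ = (k + 3) / 4 := by
  rw [Int.ceil_eq_iff]
  have h1 : 4 * ((k + 3) / 4) ≤ k + 3 := by omega
  have h2 : k ≤ 4 * ((k + 3) / 4) := by omega
  have h1' : (4 : ℚ) * (((k + 3) / 4 : ℤ) : ℚ) ≤ k + 3 := by exact_mod_cast h1
  have h2' : (k : ℚ) ≤ 4 * (((k + 3) / 4 : ℤ) : ℚ) := by exact_mod_cast h2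
  constructor <;> linarith

theorem finrank_sum_plus {k : ℤ} (hk : Even k) :
    (Module.finrank ℂ (ModularForm 𝒮ℒ (k - 2)) + Module.finrank ℂ (ModularForm 𝒮ℒ k) +
      Module.finrank ℂ (ModularForm 𝒮ℒ (k + 2)) : ℤ) = max 0 (⌈(k : ℚ) / 4⌉ + 1) := by
  rw [finrank_levelOne hk, finrank_levelOne (hk.sub even_two), finrank_levelOne (hk.add even_two),
    ceil_div_four]
  obtain ⟨m, rfl⟩ := hk
  split_ifs <;> omega

/-- The weights `k - 4, k - 2, k` are those of `finrank_sum_plus` centred at `k - 2`. -/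
theorem finrank_sum_minus {k : ℤ} (hk : Even k) :
    (Module.finrank ℂ (ModularForm 𝒮ℒ (k - 4)) + Module.finrank ℂ (ModularForm 𝒮ℒ (k - 2)) +
      Module.finrank ℂ (ModularForm 𝒮ℒ k) : ℤ) = max 0 (⌈((k : ℚ) - 2) / 4⌉ + 1) := by
  have h := finrank_sum_plus (hk.sub even_two)
  have e4 : k - 2 - 2 = k - 4 := by ring
  rw [e4, sub_add_cancel] at h
  rw [h]
  push_cast
  rfl

/-! ### The ideal `I₊` -/

theorem mem_Ann_idealPlus {k : ℤ} (hk : Even k) (f : ℍ → ℂ) :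
    f ∈ Ann k idealPlus ↔ f ∈ classP ∧ f ∣[k] ModularGroup.S = -f ∧
      (f ∣[k] ModularGroup.T - f) ∣[k] ModularGroup.T = f ∣[k] ModularGroup.T - f := by
  rw [idealPlus, mem_Ann_rightIdeal hk, slashR_S_add_one hk, slashR_T_sub_one_sq hk,
    add_eq_zero_iff_eq_neg, sub_eq_zero]

theorem mul_form_mem_Ann_idealPlus {k j : ℤ} (hk : Even k) {φ : ℍ → ℂ} (hφ : φ ∈ classP)
    (hS : φ ∣[k - j] ModularGroup.S = -φ)
    (hT : (φ ∣[k - j] ModularGroup.T - φ) ∣[k - j] ModularGroup.T = φ ∣[k - j] ModularGroup.T - φ)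
    (g : ModularForm 𝒮ℒ j) : φ * g ∈ Ann k idealPlus := by
  rw [mem_Ann_idealPlus hk]
  refine ⟨classP.mul hφ (modularForm_mem_classP g), ?_, ?_⟩
  · rw [mul_slash_sub k j, hS, modularForm_slash, neg_mul]
  · rw [mul_slash_sub k j, modularForm_slash, ← sub_mul, mul_slash_sub k j, modularForm_slash, hT]

theorem phiNeg2_mem_classP : phiNeg2 ∈ classP := classP.coe

theorem phi0_eq : phi0 = phiNeg2 * E₂ - (3 * Complex.I / Real.pi : ℂ) • 1 := by
  ext z
  simp [phi0, phiNeg2]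

theorem phi2_eq : phi2 = phiNeg2 * E₂ ^ 2 - (6 * Complex.I / Real.pi : ℂ) • E₂ := by
  ext z
  simp [phi2, phiNeg2]

theorem phi0_mem_classP : phi0 ∈ classP := by
  rw [phi0_eq]
  exact classP.sub_mem (classP.mul phiNeg2_mem_classP E2_mem_classP)
    (classP.smul_mem _ classP.one)

theorem phi2_mem_classP : phi2 ∈ classP := by
  rw [phi2_eq]
  exact classP.sub_mem (classP.mul phiNeg2_mem_classP (classP.pow E2_mem_classP 2))
    (classP.smul_mem _ E2_mem_classP)

theorem phiNeg2_slash_S : phiNeg2 ∣[(-2 : ℤ)] ModularGroup.S = -phiNeg2 := by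
  rw [slash_S_eq_iff]
  intro z
  have hz := z.ne_zero
  simp only [phiNeg2, Pi.neg_apply, coe_S_smul, zpow_neg, zpow_ofNat]
  field_simp

theorem phi0_slash_S : phi0 ∣[(0 : ℤ)] ModularGroup.S = -phi0 := by
  rw [slash_S_eq_iff]
  intro z
  have hz := z.ne_zero
  simp only [phi0, Pi.neg_apply, coe_S_smul, E2_S_smul, zpow_zero]
  field_simp
  ring

theorem phi2_slash_S : phi2 ∣[(2 : ℤ)] ModularGroup.S = -phi2 := by
  rw [slash_S_eq_iff]
  intro z
  have hz := z.ne_zero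
  simp only [phi2, Pi.neg_apply, coe_S_smul, E2_S_smul, zpow_ofNat]
  field_simp
  ring

theorem phiNeg2_slash_T (k : ℤ) : phiNeg2 ∣[k] ModularGroup.T - phiNeg2 = 1 := by
  ext z
  rw [Pi.sub_apply, slash_T_apply, phiNeg2, phiNeg2, coe_one_vadd]
  simp

theorem phi0_slash_T (k : ℤ) : phi0 ∣[k] ModularGroup.T - phi0 = E₂ := by
  ext z
  rw [Pi.sub_apply, slash_T_apply, phi0, phi0, coe_one_vadd, E2_one_vadd]
  ring

theorem phi2_slash_T (k : ℤ) : phi2 ∣[k] ModularGroup.T - phi2 = E₂ ^ 2 := by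
  ext z
  rw [Pi.sub_apply, slash_T_apply, phi2, phi2, coe_one_vadd, E2_one_vadd, Pi.pow_apply]
  ring

/-- For `f ∈ Ann_k(I₊, 𝒫)` and `p = f|(T - I)`, the translate of `p|S` by `T`. -/
theorem slash_relation_of_mem_idealPlus {k : ℤ} {f p : ℍ → ℂ}
    (hS : f ∣[k] ModularGroup.S = -f) (fT : f ∣[k] ModularGroup.T = f + p)
    (pT : p ∣[k] ModularGroup.T = p) :
    (p ∣[k] ModularGroup.S) ∣[k] ModularGroup.T = p ∣[k] ModularGroup.S + (2 : ℂ) • f + p := by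
  have fT' : f ∣[k] ModularGroup.T⁻¹ = f - p := by
    rw [← slash_T_slash_T_inv k (f - p), sub_slash, fT, pT, add_sub_cancel_right]
  -- With `f|S = -f`, the left side becomes `f - p|S` and the right side `p - f - p|S|T⁻¹`.
  have h1 := slash_STS k f
  rw [hS, SlashAction.neg_slash, SlashAction.neg_slash, fT, SlashAction.add_slash, hS, fT',
    sub_slash, hS, sub_slash, SlashAction.neg_slash, fT'] at h1
  have h2 : (p ∣[k] ModularGroup.S) ∣[k] ModularGroup.T⁻¹ =
      p ∣[k] ModularGroup.S + p - (2 : ℂ) • f := by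
    rw [two_smul]
    linear_combination h1
  have h3 := congrArg (fun u => u ∣[k] ModularGroup.T) h2
  simp only [slash_T_inv_slash_T, sub_slash, SlashAction.add_slash, fT, pT, two_smul] at h3
  rw [two_smul]
  linear_combination -h3

theorem Ann_idealPlus_eq {k : ℤ} (hk : Even k) :
    Ann k idealPlus = mulForms phi2 (k - 2) ⊔ mulForms phi0 k ⊔ mulForms phiNeg2 (k + 2) := by
  apply le_antisymm
  · intro f hf
    obtain ⟨hfP, hS, hT⟩ := (mem_Ann_idealPlus hk f).mp hf
    have hpP : f ∣[k] ModularGroup.T - f ∈ classP := classP.sub_mem (classP.slash_T hfP k) hfP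
    rw [mem_mulForms_sup]
    exact exists_E2_decomposition hpP hfP (classP.slash_S hpP k) hT (by abel)
      (slash_relation_of_mem_idealPlus hS (by abel) hT) rfl (slash_S_slash_S hk _) hS
  · have e2 : k - (k - 2) = 2 := by ring
    have e0 : k - k = 0 := by ring
    have em : k - (k + 2) = -2 := by ring
    refine sup_le (sup_le ?_ ?_) ?_
    · rintro _ ⟨g, rfl⟩
      refine mul_form_mem_Ann_idealPlus hk phi2_mem_classP ?_ ?_ g
      · rw [e2, phi2_slash_S]
      · rw [phi2_slash_T, slash_T_eq_iff]
        intro z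
        simp only [Pi.pow_apply, E2_one_vadd]
    · rintro _ ⟨g, rfl⟩
      refine mul_form_mem_Ann_idealPlus hk phi0_mem_classP ?_ ?_ g
      · rw [e0, phi0_slash_S]
      · rw [phi0_slash_T, E2_slash_T]
    · rintro _ ⟨g, rfl⟩
      refine mul_form_mem_Ann_idealPlus hk phiNeg2_mem_classP ?_ ?_ g
      · rw [em, phiNeg2_slash_S]
      · rw [phiNeg2_slash_T, slash_T_eq_iff]
        exact fun z => rfl

/-- Reduces the independence of `φ₂, φ₀, φ₋₂` over modular forms to that of `E₂², E₂, 1`. -/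
theorem phi_slash_T_sub {k : ℤ} (x : ModularForm 𝒮ℒ (k - 2)) (y : ModularForm 𝒮ℒ k)
    (w : ModularForm 𝒮ℒ (k + 2)) :
    (phi2 * x + phi0 * y + phiNeg2 * w) ∣[k] ModularGroup.T -
      (phi2 * x + phi0 * y + phiNeg2 * w) = E₂ ^ 2 * x + E₂ * y + w := by
  rw [SlashAction.add_slash, SlashAction.add_slash, mul_slash_sub k (k - 2), mul_slash_sub k k,
    mul_slash_sub k (k + 2), modularForm_slash, modularForm_slash, modularForm_slash]
  linear_combination x * phi2_slash_T (k - (k - 2)) + y * phi0_slash_T (k - k) +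
    w * phiNeg2_slash_T (k - (k + 2))

theorem eq_zero_of_E2_form_relation {k : ℤ} (x : ModularForm 𝒮ℒ (k - 2)) (y : ModularForm 𝒮ℒ k)
    (w : ModularForm 𝒮ℒ (k + 2)) (h : E₂ ^ 2 * x + E₂ * y + w = 0) :
    (x : ℍ → ℂ) = 0 ∧ (y : ℍ → ℂ) = 0 ∧ (w : ℍ → ℂ) = 0 :=
  eq_zero_of_E2_relation (a := k - 2) (b := k) (c := k + 2) (by ring) rfl
    (modularForm_slash _ _) (modularForm_slash _ _) (modularForm_slash _ _)
    (modularForm_slash _ _) (modularForm_slash _ _) (modularForm_slash _ _) h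

theorem hasDim_Ann_idealPlus {k : ℤ} (hk : Even k) :
    HasDim (Ann k idealPlus) (max 0 (⌈(k : ℚ) / 4⌉ + 1)) := by
  rw [Ann_idealPlus_eq hk, ← finrank_sum_plus hk]
  refine hasDim_mulForms_sup fun x y w h => eq_zero_of_E2_form_relation x y w ?_
  rw [← phi_slash_T_sub, h, SlashAction.zero_slash, sub_zero]

/-! ### The ideal `Ĩ₊` -/

theorem mem_Ann_idealTildePlus {k : ℤ} (hk : Even k) (f : ℍ → ℂ) :
    f ∈ Ann k idealTildePlus ↔ f ∈ classP ∧
      f ∣[k] ModularGroup.T - (2 : ℂ) • f + f ∣[k] ModularGroup.T⁻¹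
        - (2 : ℂ) • f ∣[k] ModularGroup.S = 0 ∧
      f = ((f ∣[k] ModularGroup.S) ∣[k] ModularGroup.T) ∣[k] ModularGroup.S := by
  rw [idealTildePlus, mem_Ann_rightIdeal hk, slashR_second_difference_sub hk,
    slashR_one_sub_STS hk, sub_eq_zero (b := SlashAction.map _ _ _)]

/-- Right multiplication by `(T - I) S`. -/
def slashTSubOneS (k : ℤ) : (ℍ → ℂ) →ₗ[ℂ] (ℍ → ℂ) where
  toFun f := (f ∣[k] ModularGroup.T - f) ∣[k] ModularGroup.S
  map_add' f g := by
    simp only [sub_slash, SlashAction.add_slash]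
    abel
  map_smul' c f := by
    simp only [sub_slash, ModularForm.SL_smul_slash, RingHom.id_apply, smul_sub]

theorem slashTSubOneS_apply (k : ℤ) (f : ℍ → ℂ) :
    slashTSubOneS k f = (f ∣[k] ModularGroup.T - f) ∣[k] ModularGroup.S := rfl

/-- For `h = p|S` with `p = f|(T - I)`, the relation of the `I₊` case gives `h|T = h + 2f + p` and
`h|T⁻¹ = h - 2f + p`. Their sum is the first defining relation of `Ĩ₊`, and their difference `4f`
recovers `f`. -/
theorem Ann_idealTildePlus_eq_map {k : ℤ} (hk : Even k) :
    Ann k idealTildePlus = (Ann k idealPlus).map (slashTSubOneS k) := by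
  ext h
  rw [Submodule.mem_map, mem_Ann_idealTildePlus hk]
  constructor
  · rintro ⟨hP, h1, h2⟩
    have tS : (h ∣[k] ModularGroup.T⁻¹) ∣[k] ModularGroup.S = h ∣[k] ModularGroup.T := by
      rw [slash_STS] at h2
      conv_rhs => rw [h2, slash_T_inv_slash_T]
    have tS' : (h ∣[k] ModularGroup.T) ∣[k] ModularGroup.S = h ∣[k] ModularGroup.T⁻¹ := by
      rw [← tS, slash_S_slash_S hk]
    have pT : (h ∣[k] ModularGroup.S) ∣[k] ModularGroup.T = h ∣[k] ModularGroup.S := by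
      conv_rhs => rw [h2, slash_S_slash_S hk]
    have h3 := congrArg (fun u => u ∣[k] ModularGroup.T) h1
    simp only [slash_T_inv_slash_T, sub_slash, SlashAction.add_slash, ModularForm.SL_smul_slash,
      pT, SlashAction.zero_slash] at h3
    set f := (1 / 4 : ℂ) • (h ∣[k] ModularGroup.T - h ∣[k] ModularGroup.T⁻¹) with hf
    have fS : f ∣[k] ModularGroup.S = -f := by
      rw [hf, ModularForm.SL_smul_slash, sub_slash, tS, tS']
      module
    have fT : f ∣[k] ModularGroup.T - f = h ∣[k] ModularGroup.S := by
      rw [hf, ModularForm.SL_smul_slash, sub_slash, slash_T_inv_slash_T]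
      have h4 : (h ∣[k] ModularGroup.T) ∣[k] ModularGroup.T = (2 : ℂ) • h ∣[k] ModularGroup.T - h +
          (2 : ℂ) • h ∣[k] ModularGroup.S := by
        linear_combination h3
      have h5 : h ∣[k] ModularGroup.T⁻¹ = (2 : ℂ) • h - h ∣[k] ModularGroup.T +
          (2 : ℂ) • h ∣[k] ModularGroup.S := by
        linear_combination h1
      rw [h4, h5]
      module
    refine ⟨f, (mem_Ann_idealPlus hk f).mpr ⟨?_, fS, by rw [fT, pT]⟩, ?_⟩
    · exact classP.smul_mem _ (classP.sub_mem (classP.slash_T hP k) (classP.slash_T_inv hP k))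
    · rw [slashTSubOneS_apply, fT, slash_S_slash_S hk]
  · rintro ⟨f, hf, rfl⟩
    obtain ⟨hfP, hS, hT⟩ := (mem_Ann_idealPlus hk f).mp hf
    rw [slashTSubOneS_apply]
    have hpP : f ∣[k] ModularGroup.T - f ∈ classP := classP.sub_mem (classP.slash_T hfP k) hfP
    obtain ⟨p, hp⟩ : ∃ p, f ∣[k] ModularGroup.T - f = p := ⟨_, rfl⟩
    have fT : f ∣[k] ModularGroup.T = f + p := by rw [← hp]; abel
    rw [hp] at hT hpP ⊢
    have h1 := slash_relation_of_mem_idealPlus hS fT hT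
    have hS' := slash_S_slash_S hk p
    refine ⟨classP.slash_S hpP k, ?_, by rw [hS', hT]⟩
    obtain ⟨h, hh⟩ : ∃ h, p ∣[k] ModularGroup.S = h := ⟨_, rfl⟩
    rw [hh] at h1 hS' ⊢
    have h2 : h ∣[k] ModularGroup.T⁻¹ = h - (2 : ℂ) • f + p := by
      rw [← slash_T_slash_T_inv k (h - (2 : ℂ) • f + p), SlashAction.add_slash, sub_slash,
        ModularForm.SL_smul_slash, h1, fT, hT]
      congr 1
      module
    rw [h1, h2, hS']
    module

theorem map_mulForms_slashTSubOneS {k j : ℤ} {φ ψ χ : ℍ → ℂ}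
    (hφ : φ ∣[k - j] ModularGroup.T - φ = χ) (hχ : χ ∣[k - j] ModularGroup.S = ψ) :
    (mulForms φ j).map (slashTSubOneS k) = mulForms ψ j := by
  have key : ∀ g : ModularForm 𝒮ℒ j, slashTSubOneS k (φ * g) = ψ * g := fun g => by
    rw [slashTSubOneS_apply, mul_slash_sub k j, modularForm_slash, ← sub_mul, hφ,
      mul_slash_sub k j, modularForm_slash, hχ]
  ext f
  rw [Submodule.mem_map]
  constructor
  · rintro ⟨_, ⟨g, rfl⟩, rfl⟩
    exact ⟨g, key g⟩
  · rintro ⟨g, rfl⟩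
    exact ⟨_, ⟨g, rfl⟩, key g⟩

theorem phiTilde2_eq : (E₂ ^ 2) ∣[(2 : ℤ)] ModularGroup.S = phiTilde2 := by
  ext z
  have hz := z.ne_zero
  rw [phiTilde2, slash_S_apply, slash_S_apply, Pi.pow_apply, zpow_neg, zpow_ofNat]
  field_simp

theorem phiTilde0_eq : E₂ ∣[(0 : ℤ)] ModularGroup.S = phiTilde0 := by
  ext z
  have hz := z.ne_zero
  rw [phiTilde0, slash_S_apply, slash_S_apply, neg_zero, zpow_zero, zpow_neg, zpow_ofNat]
  field_simp

theorem phiTildeNeg2_eq : (1 : ℍ → ℂ) ∣[(-2 : ℤ)] ModularGroup.S = phiTildeNeg2 := by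
  ext z
  rw [phiTildeNeg2, slash_S_apply, neg_neg, zpow_ofNat, Pi.one_apply, one_mul]

theorem Ann_idealTildePlus_eq {k : ℤ} (hk : Even k) :
    Ann k idealTildePlus =
      mulForms phiTilde2 (k - 2) ⊔ mulForms phiTilde0 k ⊔ mulForms phiTildeNeg2 (k + 2) := by
  have e2 : k - (k - 2) = 2 := by ring
  have e0 : k - k = 0 := by ring
  have em : k - (k + 2) = -2 := by ring
  rw [Ann_idealTildePlus_eq_map hk, Ann_idealPlus_eq hk, Submodule.map_sup, Submodule.map_sup,
    map_mulForms_slashTSubOneS (phi2_slash_T _) (by rw [e2, phiTilde2_eq]),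
    map_mulForms_slashTSubOneS (phi0_slash_T _) (by rw [e0, phiTilde0_eq]),
    map_mulForms_slashTSubOneS (phiNeg2_slash_T _) (by rw [em, phiTildeNeg2_eq])]

theorem hasDim_Ann_idealTildePlus {k : ℤ} (hk : Even k) :
    HasDim (Ann k idealTildePlus) (max 0 (⌈(k : ℚ) / 4⌉ + 1)) := by
  rw [Ann_idealTildePlus_eq hk, ← finrank_sum_plus hk]
  refine hasDim_mulForms_sup fun x y w h => eq_zero_of_E2_form_relation x y w ?_
  have e2 : k - (k - 2) = 2 := by ring
  have e0 : k - k = 0 := by ring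
  have em : k - (k + 2) = -2 := by ring
  rw [← SlashAction.slash_eq_zero_iff k ModularGroup.S, ← one_mul (w : ℍ → ℂ),
    SlashAction.add_slash, SlashAction.add_slash, mul_slash_sub k (k - 2), mul_slash_sub k k,
    mul_slash_sub k (k + 2), modularForm_slash, modularForm_slash, modularForm_slash, e2, e0, em,
    phiTilde2_eq, phiTilde0_eq, phiTildeNeg2_eq, h]

/-! ### Theta functions -/

theorem exp_pi_I_int (n : ℤ) : Complex.exp (Real.pi * Complex.I * n) = (-1) ^ n := by
  rw [mul_comm, Complex.exp_int_mul, Complex.exp_pi_mul_I]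

theorem theta00_eq (z : ℂ) : theta00 z = jacobiTheta₂ 0 z :=
  tsum_congr fun n => by simp [jacobiTheta₂_term]

theorem theta01_eq (z : ℂ) : theta01 z = jacobiTheta₂ (1 / 2) z :=
  tsum_congr fun n => by
    rw [jacobiTheta₂_term, ← exp_pi_I_int, ← Complex.exp_add]
    ring_nf

theorem theta10_eq (z : ℂ) :
    theta10 z = Complex.exp (Real.pi * Complex.I * z / 4) * jacobiTheta₂ (z / 2) z := by
  rw [theta10, jacobiTheta₂, ← tsum_mul_left]
  refine tsum_congr fun n => ?_
  rw [jacobiTheta₂_term, ← Complex.exp_add]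
  ring_nf

theorem theta00_add_one (z : ℂ) : theta00 (1 + z) = theta01 z :=
  tsum_congr fun n => by
    have h : ((-1 : ℂ)) ^ n = (-1) ^ (n ^ 2) := by
      rcases Int.even_or_odd n with h | h
      · rw [h.neg_one_zpow, (h.pow_of_ne_zero two_ne_zero).neg_one_zpow]
      · rw [h.neg_one_zpow, (h.pow).neg_one_zpow]
    rw [h, ← exp_pi_I_int, ← Complex.exp_add]
    push_cast
    ring_nf

theorem theta01_add_one (z : ℂ) : theta01 (1 + z) = theta00 z := by
  rw [← theta00_add_one, theta00_eq, theta00_eq, ← add_assoc, add_comm, one_add_one_eq_two,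
    jacobiTheta₂_add_right]

theorem theta10_add_one (z : ℂ) :
    theta10 (1 + z) = Complex.exp (Real.pi * Complex.I / 4) * theta10 z := by
  rw [theta10, theta10, ← tsum_mul_left]
  refine tsum_congr fun n => ?_
  have h : Complex.exp (Real.pi * Complex.I * ((n * (n + 1) : ℤ) : ℂ)) = 1 := by
    rw [exp_pi_I_int, (Int.even_mul_succ_self n).neg_one_zpow]
  have e : Real.pi * Complex.I * ((n : ℂ) + 1 / 2) ^ 2 * (1 + z) =
      Real.pi * Complex.I / 4 + Real.pi * Complex.I * ((n : ℂ) + 1 / 2) ^ 2 * z +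
        Real.pi * Complex.I * ((n * (n + 1) : ℤ) : ℂ) := by
    push_cast
    ring
  rw [e, Complex.exp_add, h, mul_one, Complex.exp_add]

theorem sqrt_pow_four (z : ℂ) : ((-Complex.I * z) ^ (1 / 2 : ℂ)) ^ 4 = -z ^ 2 := by
  rw [← Complex.cpow_nat_mul]
  have : ((4 : ℕ) : ℂ) * (1 / 2) = (2 : ℕ) := by norm_num
  rw [this, Complex.cpow_natCast, mul_pow, neg_sq, Complex.I_sq]
  ring

theorem theta00_S (z : ℍ) :
    theta00 (-1 / z) = (-Complex.I * z) ^ (1 / 2 : ℂ) * theta00 z := by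
  have h0 : (-Complex.I * z) ^ (1 / 2 : ℂ) ≠ 0 := by
    simp [Complex.cpow_eq_zero_iff, z.ne_zero]
  rw [theta00_eq, theta00_eq, jacobiTheta₂_functional_equation 0 z, zero_pow two_ne_zero,
    mul_zero, zero_div, Complex.exp_zero, mul_one, ← mul_assoc,
    mul_one_div_cancel h0, one_mul]

/-- The Gaussian factor in the functional equation of `jacobiTheta₂` at argument `1/2` is exactly
the exponential prefactor of `theta10_eq` at `-1/z`. -/
theorem theta10_S (z : ℍ) :
    theta10 (-1 / z) = (-Complex.I * z) ^ (1 / 2 : ℂ) * theta01 z := by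
  have hz := z.ne_zero
  have h0 : (-Complex.I * z) ^ (1 / 2 : ℂ) ≠ 0 := by
    simp [Complex.cpow_eq_zero_iff, z.ne_zero]
  have e1 : (-1 / (z : ℂ) / 2) = -(1 / 2 / z) := by field_simp
  have e2 : Real.pi * Complex.I * (-1 / (z : ℂ)) / 4 = -Real.pi * Complex.I * (1 / 2) ^ 2 / z := by
    field_simp
    norm_num
  rw [theta10_eq, theta01_eq, jacobiTheta₂_functional_equation (1 / 2) z, e1,
    jacobiTheta₂_neg_left, e2]
  field_simp

theorem U_S_smul (z : ℍ) : U (ModularGroup.S • z) = -z ^ 2 * U z := by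
  rw [U, U, coe_S_smul, theta00_S, mul_pow, sqrt_pow_four]

theorem V_S_smul (z : ℍ) : V (ModularGroup.S • z) = -z ^ 2 * W z := by
  rw [V, W, coe_S_smul, theta10_S, mul_pow, sqrt_pow_four]

theorem U_slash_S : U ∣[(2 : ℤ)] ModularGroup.S = -U := by
  rw [slash_S_eq_iff]
  intro z
  rw [U_S_smul, Pi.neg_apply, zpow_ofNat]
  ring

theorem V_slash_S : V ∣[(2 : ℤ)] ModularGroup.S = -W := by
  rw [slash_S_eq_iff]
  intro z
  rw [V_S_smul, Pi.neg_apply, zpow_ofNat]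
  ring

theorem W_slash_S : W ∣[(2 : ℤ)] ModularGroup.S = -V := by
  have h := slash_S_slash_S even_two V
  rw [V_slash_S, SlashAction.neg_slash] at h
  rw [← h, neg_neg]

theorem W_S_smul (z : ℍ) : W (ModularGroup.S • z) = -z ^ 2 * V z := by
  rw [slash_S_eq_iff.mp W_slash_S, Pi.neg_apply, zpow_ofNat]
  ring

theorem U_one_vadd (z : ℍ) : U ((1 : ℝ) +ᵥ z) = W z := by
  rw [U, W, coe_one_vadd, theta00_add_one]

theorem W_one_vadd (z : ℍ) : W ((1 : ℝ) +ᵥ z) = U z := by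
  rw [U, W, coe_one_vadd, theta01_add_one]

theorem V_one_vadd (z : ℍ) : V ((1 : ℝ) +ᵥ z) = -V z := by
  rw [V, V, coe_one_vadd, theta10_add_one, mul_pow, ← Complex.exp_nat_mul]
  have : ((4 : ℕ) : ℂ) * (Real.pi * Complex.I / 4) = Real.pi * Complex.I := by
    push_cast
    ring
  rw [this, Complex.exp_pi_mul_I, neg_one_mul]

theorem U_slash_T (k : ℤ) : U ∣[k] ModularGroup.T = W := slash_T_eq_iff.mpr U_one_vadd

theorem W_slash_T (k : ℤ) : W ∣[k] ModularGroup.T = U := slash_T_eq_iff.mpr W_one_vadd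

theorem V_slash_T (k : ℤ) : V ∣[k] ModularGroup.T = -V := slash_T_eq_iff.mpr V_one_vadd

/-! ### Holomorphy of the theta functions. -/

theorem differentiableAt_theta00 {z : ℂ} (hz : 0 < z.im) : DifferentiableAt ℂ theta00 z := by
  rw [funext theta00_eq]
  exact differentiableAt_jacobiTheta₂_snd 0 hz

theorem differentiableAt_theta01 {z : ℂ} (hz : 0 < z.im) : DifferentiableAt ℂ theta01 z := by
  rw [funext theta01_eq]
  exact differentiableAt_jacobiTheta₂_snd _ hz

theorem differentiableAt_theta10 {z : ℂ} (hz : 0 < z.im) : DifferentiableAt ℂ theta10 z := by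
  rw [funext theta10_eq]
  have h1 : DifferentiableAt ℂ (fun w : ℂ => jacobiTheta₂ (w / 2) w) z := by
    have h2 := (hasFDerivAt_jacobiTheta₂ (z / 2) hz).differentiableAt
    have h3 : DifferentiableAt ℂ (fun w : ℂ => (w / 2, w)) z := by fun_prop
    exact DifferentiableAt.comp (g := fun p : ℂ × ℂ => jacobiTheta₂ p.1 p.2)
      (f := fun w : ℂ => (w / 2, w)) z h2 h3
  fun_prop

theorem mdifferentiable_comp_coe {g : ℂ → ℂ} (hg : ∀ z : ℂ, 0 < z.im → DifferentiableAt ℂ g z) :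
    MDiff (fun z : ℍ => g z) := by
  rw [UpperHalfPlane.mdifferentiable_iff]
  have : DifferentiableOn ℂ g {z | 0 < z.im} := fun z hz => (hg z hz).differentiableWithinAt
  refine this.congr fun z hz => ?_
  simp [ofComplex_apply_of_im_pos hz]

theorem mdifferentiable_U : MDiff U :=
  mdifferentiable_comp_coe (g := fun z => theta00 z ^ 4) fun _ hz =>
    (differentiableAt_theta00 hz).pow 4

theorem mdifferentiable_V : MDiff V :=
  mdifferentiable_comp_coe (g := fun z => theta10 z ^ 4) fun _ hz =>
    (differentiableAt_theta10 hz).pow 4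

theorem mdifferentiable_W : MDiff W :=
  mdifferentiable_comp_coe (g := fun z => theta01 z ^ 4) fun _ hz =>
    (differentiableAt_theta01 hz).pow 4

/-! ### Asymptotics at the cusp -/

theorem tendsto_one_vadd_atImInfty :
    Tendsto (fun z : ℍ => (1 : ℝ) +ᵥ z) atImInfty atImInfty := by
  rw [atImInfty, tendsto_comap_iff]
  have : UpperHalfPlane.im ∘ (fun z : ℍ => (1 : ℝ) +ᵥ z) = UpperHalfPlane.im := by
    ext z
    simp [UpperHalfPlane.vadd_im]
  rw [this]
  exact tendsto_comap

/-- The bound `2/(exp(πy) - 1)` for `jacobiTheta` is at most `2/(πy)`. It serves both the limit at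
`i∞` and the growth near the real axis. -/
theorem norm_theta00_sub_one_le (z : ℍ) : ‖theta00 z - 1‖ ≤ 1 / z.im := by
  have hy := z.im_pos
  have h := norm_jacobiTheta_sub_one_le (τ := z) hy
  have e : jacobiTheta z = theta00 z := rfl
  rw [e] at h
  refine h.trans ?_
  have h1 : 0 < Real.pi * z.im := by positivity
  have h2 : Real.pi * z.im + 1 ≤ Real.exp (Real.pi * z.im) := Real.add_one_le_exp _
  have h3 : Real.exp (-Real.pi * (z : ℂ).im) = (Real.exp (Real.pi * z.im))⁻¹ := by
    rw [← Real.exp_neg, neg_mul]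
    rfl
  rw [h3]
  set E := Real.exp (Real.pi * z.im)
  have hE : 0 < E := by linarith
  have hE1 : 0 < E - 1 := by linarith
  have : 2 / (1 - E⁻¹) * E⁻¹ = 2 / (E - 1) := by
    have : 1 - E⁻¹ = (E - 1) / E := by field_simp
    rw [this]
    field_simp
  rw [this, div_le_div_iff₀ hE1 hy]
  nlinarith [Real.pi_gt_three]

theorem tendsto_theta00 : Tendsto (fun z : ℍ => theta00 z) atImInfty (𝓝 1) := by
  rw [tendsto_iff_norm_sub_tendsto_zero]
  refine squeeze_zero (fun _ => norm_nonneg _) norm_theta00_sub_one_le ?_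
  exact (tendsto_const_nhds.div_atTop tendsto_id).comp tendsto_comap

theorem tendsto_U : Tendsto U atImInfty (𝓝 1) := by
  have := tendsto_theta00.pow 4
  rw [one_pow] at this
  exact this

theorem tendsto_W : Tendsto W atImInfty (𝓝 1) := by
  have := tendsto_U.comp tendsto_one_vadd_atImInfty
  exact this.congr fun z => U_one_vadd z

theorem norm_jacobiTheta₂_term_half (n : ℤ) (z : ℂ) :
    ‖jacobiTheta₂_term n (z / 2) z‖ = Real.exp (-Real.pi * (n * (n + 1) : ℤ) * z.im) := by
  rw [norm_jacobiTheta₂_term]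
  congr 1
  have : (z / 2).im = z.im / 2 := by
    simp
  rw [this]
  push_cast
  ring

/-- The `n`-th term has norm `exp(-πn(n+1)y)`: only `n = 0` and `n = -1` survive, each contributing
1, and the values at `y = 1` dominate. -/
theorem tendsto_jacobiTheta₂_half :
    Tendsto (fun z : ℍ => jacobiTheta₂ ((z : ℂ) / 2) z) atImInfty (𝓝 2) := by
  have hnn : ∀ n : ℤ, 0 ≤ n * (n + 1) := fun n => by nlinarith [sq_nonneg (2 * n + 1), sq_nonneg n]
  have hs : Summable fun n : ℤ => Real.exp (-Real.pi * (n * (n + 1) : ℤ) * 1) := by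
    have := ((summable_jacobiTheta₂_term_iff (Complex.I / 2) Complex.I).mpr (by simp)).norm
    refine this.congr fun n => ?_
    rw [norm_jacobiTheta₂_term_half, Complex.I_im]
  have hlim : ∀ n : ℤ, Tendsto (fun z : ℍ => jacobiTheta₂_term n ((z : ℂ) / 2) z) atImInfty
      (𝓝 (if n ∈ ({0, -1} : Finset ℤ) then 1 else 0)) := by
    intro n
    split_ifs with h
    · have h0 : n = 0 ∨ n = -1 := by simpa using h
      refine tendsto_const_nhds.congr fun z => ?_
      rw [jacobiTheta₂_term]
      rcases h0 with rfl | rfl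
      · simp
      · symm
        rw [← Complex.exp_zero]
        congr 1
        push_cast
        ring
    · have h0 : 0 < n * (n + 1) := by
        refine lt_of_le_of_ne (hnn n) fun h' => h ?_
        rcases mul_eq_zero.mp h'.symm with h1 | h1
        · simp [h1]
        · have : n = -1 := by omega
          simp [this]
      rw [tendsto_zero_iff_norm_tendsto_zero]
      simp_rw [norm_jacobiTheta₂_term_half]
      have hc : -Real.pi * ((n * (n + 1) : ℤ) : ℝ) < 0 := by
        have : (0 : ℝ) < ((n * (n + 1) : ℤ) : ℝ) := by exact_mod_cast h0
        nlinarith [Real.pi_pos]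
      exact Real.tendsto_exp_atBot.comp
        ((tendsto_const_mul_atBot_of_neg hc).mpr tendsto_comap)
  have key := tendsto_tsum_of_dominated_convergence hs hlim (by
    filter_upwards [preimage_mem_comap (Ici_mem_atTop (1 : ℝ))] with z hz n
    rw [norm_jacobiTheta₂_term_half]
    apply Real.exp_le_exp.mpr
    have h1 : (0 : ℝ) ≤ ((n * (n + 1) : ℤ) : ℝ) := by exact_mod_cast hnn n
    have h2 : (1 : ℝ) ≤ (z : ℂ).im := hz
    have h3 : 0 ≤ Real.pi * ((n * (n + 1) : ℤ) : ℝ) := by positivity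
    nlinarith)
  have e : ∑' n : ℤ, (if n ∈ ({0, -1} : Finset ℤ) then (1 : ℂ) else 0) = 2 := by
    rw [tsum_eq_sum (s := {0, -1}) fun n hn => if_neg hn, Finset.sum_congr rfl fun n hn => if_pos hn]
    simp
  rw [e] at key
  exact key

/-- The function `V exp(-π i z)`, which tends to `16` at `i∞`. -/
def reducedV (z : ℍ) : ℂ := jacobiTheta₂ ((z : ℂ) / 2) z ^ 4

theorem tendsto_reducedV : Tendsto reducedV atImInfty (𝓝 16) := by
  have := tendsto_jacobiTheta₂_half.pow 4
  norm_num at this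
  exact this

theorem V_eq_expMul_mul : V = expMul (1 / 2) * reducedV := by
  ext z
  rw [V, theta10_eq, mul_pow, Pi.mul_apply, expMul, reducedV, ← Complex.exp_nat_mul]
  congr 2
  push_cast
  ring

theorem isZeroAtImInfty_V : IsZeroAtImInfty V := by
  have h1 : IsZeroAtImInfty (expMul (1 / 2) * (1 : ℍ → ℂ)) :=
    isZeroAtImInfty_expMul_mul (C := 1) (N := 0) (by norm_num) fun z _ => by simp
  rw [mul_one] at h1
  have := h1.mul tendsto_reducedV
  rw [zero_mul] at this
  rw [V_eq_expMul_mul]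
  exact this

/-! ### The Jacobi identity and the product of the theta functions -/

theorem cuspForm_eq_zero {k : ℤ} (hk : k < 12) (f : CuspForm 𝒮ℒ k) : f = 0 :=
  rank_zero_iff_forall_zero.mp (CuspForm.rank_eq_zero_of_weight_lt_twelve hk) f

/-- `S` and `T` both negate `U - V - W` in weight 2, and it vanishes at `i∞`. Its square is thus a
level one cusp form of weight 4, hence zero. -/
theorem U_eq_V_add_W : U = V + W := by
  have hT : (U - V - W) ∣[(2 : ℤ)] ModularGroup.T = -(U - V - W) := by
    rw [sub_slash, sub_slash, U_slash_T, V_slash_T, W_slash_T]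
    ring
  have hS : (U - V - W) ∣[(2 : ℤ)] ModularGroup.S = -(U - V - W) := by
    rw [sub_slash, sub_slash, U_slash_S, V_slash_S, W_slash_S]
    ring
  have hd : MDiff (U - V - W) := (mdifferentiable_U.sub mdifferentiable_V).sub mdifferentiable_W
  have hz : IsZeroAtImInfty (U - V - W) := by
    have := (tendsto_U.sub isZeroAtImInfty_V).sub tendsto_W
    simp only [sub_zero, sub_self] at this
    exact this
  have hz2 : IsZeroAtImInfty ((U - V - W) * (U - V - W)) := by
    have := hz.mul hz
    rw [mul_zero] at this
    exact this
  have h0 := cuspForm_eq_zero (k := 4) (by norm_num)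
    (cuspFormOfZero ((U - V - W) * (U - V - W)) (hd.mul hd)
      (by rw [mul_slash_sub 4 2]; norm_num; rw [hS]; ring)
      (by rw [mul_slash_sub 4 2]; norm_num; rw [hT]; ring) hz2)
  have h1 : (U - V - W) * (U - V - W) = 0 := congrArg (fun f : CuspForm 𝒮ℒ 4 => (f : ℍ → ℂ)) h0
  have h2 : U - V - W = 0 := funext fun z => mul_self_eq_zero.mp (congrFun h1 z)
  linear_combination h2

/-- The product `U V W`, a square root of a multiple of the discriminant. -/
def UVW : ℍ → ℂ := U * V * W

theorem mdifferentiable_UVW : MDiff UVW :=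
  (mdifferentiable_U.mul mdifferentiable_V).mul mdifferentiable_W

theorem UVW_slash_S : UVW ∣[(6 : ℤ)] ModularGroup.S = -UVW := by
  rw [UVW, mul_slash_sub 6 2, mul_slash_sub (6 - 2) 2]
  norm_num
  rw [U_slash_S, V_slash_S, W_slash_S]
  ring

theorem UVW_slash_T : UVW ∣[(6 : ℤ)] ModularGroup.T = -UVW := by
  rw [UVW, mul_slash_sub 6 2, mul_slash_sub (6 - 2) 2]
  norm_num
  rw [U_slash_T, V_slash_T, W_slash_T]
  ring

/-- Only `V` decays; once `exp(πiz)` is removed from it, the product tends to 16, which exceeds 1.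
-/
theorem exists_exp_le_norm_UVW : ∃ A : ℝ, ∀ z : ℍ, A ≤ z.im →
    Real.exp (-Real.pi * z.im) ≤ ‖UVW z‖ := by
  have h : Tendsto (fun z => ‖U z * reducedV z * W z‖) atImInfty (𝓝 16) := by
    have := ((tendsto_U.mul tendsto_reducedV).mul tendsto_W).norm
    rw [one_mul, mul_one, Complex.norm_ofNat] at this
    exact this
  have h1 := h.eventually (lt_mem_nhds (show (1 : ℝ) < 16 by norm_num))
  rw [atImInfty, eventually_comap, eventually_atTop] at h1
  obtain ⟨A, hA⟩ := h1
  refine ⟨A, fun z hz => ?_⟩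
  have h2 := hA z.im hz z rfl
  have e : UVW z = expMul (1 / 2) z * (U z * reducedV z * W z) := by
    rw [UVW, V_eq_expMul_mul]
    simp only [Pi.mul_apply]
    ring
  rw [e, norm_mul, norm_expMul]
  have e2 : -2 * Real.pi * (1 / 2) * z.im = -Real.pi * z.im := by ring
  rw [e2]
  exact le_mul_of_one_le_right (Real.exp_pos _).le h2.le

/-- The square is a cusp form of weight 12, hence a multiple of the discriminant, which has no
zeros. The multiple is nonzero by the lower bound near `i∞`. -/
theorem UVW_ne_zero (z : ℍ) : UVW z ≠ 0 := by
  have hz : IsZeroAtImInfty (UVW * UVW) := by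
    have h := ((tendsto_U.mul isZeroAtImInfty_V).mul tendsto_W)
    have := h.mul h
    simp only [mul_zero, zero_mul] at this
    exact this
  obtain ⟨c, hc⟩ := CuspForm.exists_smul_discriminant_of_weight_eq_twelve
    (cuspFormOfZero (UVW * UVW) (mdifferentiable_UVW.mul mdifferentiable_UVW)
      (by rw [mul_slash_sub 12 6]; norm_num; rw [UVW_slash_S]; ring)
      (by rw [mul_slash_sub 12 6]; norm_num; rw [UVW_slash_T]; ring) hz)
  have hc' : ∀ w, UVW w * UVW w = c * ModularForm.discriminant w := fun w =>
    (congrFun (congrArg (fun f : CuspForm 𝒮ℒ 12 => (f : ℍ → ℂ)) hc) w).symm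
  have hc0 : c ≠ 0 := by
    rintro rfl
    obtain ⟨A, hA⟩ := exists_exp_le_norm_UVW
    let w : ℍ := ⟨(max A 1 : ℝ) * Complex.I, by simp⟩
    have h1 := hA w (by simp [w, UpperHalfPlane.im])
    have h2 := hc' w
    rw [zero_mul, mul_self_eq_zero] at h2
    rw [h2, norm_zero] at h1
    exact absurd h1 (not_le.mpr (Real.exp_pos _))
  intro h
  have h1 := hc' z
  rw [h, zero_mul] at h1
  exact (mul_ne_zero hc0 (ModularForm.discriminant_ne_zero z)) h1.symm

theorem U_ne_zero (z : ℍ) : U z ≠ 0 := fun h => UVW_ne_zero z (by simp [UVW, h])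

theorem V_ne_zero (z : ℍ) : V z ≠ 0 := fun h => UVW_ne_zero z (by simp [UVW, h])

/-! ### Growth of `U`, `V` and `W`. -/

theorem norm_U_le (z : ℍ) : ‖U z‖ ≤ (1 + 1 / z.im) ^ 4 := by
  rw [U, norm_pow]
  gcongr
  have := norm_add_le (theta00 z - 1) 1
  rw [sub_add_cancel, norm_one] at this
  linarith [norm_theta00_sub_one_le z]

theorem norm_W_le (z : ℍ) : ‖W z‖ ≤ (1 + 1 / z.im) ^ 4 := by
  have := norm_U_le ((1 : ℝ) +ᵥ z)
  rwa [U_one_vadd, UpperHalfPlane.vadd_im] at this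

theorem norm_V_le (z : ℍ) : ‖V z‖ ≤ 2 * (1 + 1 / z.im) ^ 4 := by
  have h : V z = U z - W z := by rw [U_eq_V_add_W, Pi.add_apply, add_sub_cancel_right]
  rw [h]
  linarith [norm_sub_le (U z) (W z), norm_U_le z, norm_W_le z]

theorem U_mem_classP : U ∈ classP :=
  ⟨mdifferentiable_U, moderateGrowth_of_im_bound 1 4 zero_le_one fun z => by
    rw [one_mul]
    exact norm_U_le z⟩

theorem W_mem_classP : W ∈ classP := by
  rw [← U_slash_T 0]
  exact classP.slash_T U_mem_classP 0

theorem V_mem_classP : V ∈ classP := by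
  have : V = -(W ∣[(2 : ℤ)] ModularGroup.S) := by rw [W_slash_S, neg_neg]
  rw [this]
  exact classP.neg_mem (classP.slash_S W_mem_classP 2)

open Derivative

/-! ### The logarithmic derivative of the modular lambda function -/

/-- Cauchy's estimate for `f - l` on the unit disc about `z`, which lies high in the half-plane. -/
theorem tendsto_normalizedDeriv_zero {f : ℍ → ℂ} {l : ℂ} (hf : MDiff f)
    (h : Tendsto f atImInfty (𝓝 l)) : Tendsto (D f) atImInfty (𝓝 0) := by
  rw [Metric.tendsto_nhds] at h ⊢
  intro ε hε
  have h1 := h (ε / 2) (half_pos hε)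
  rw [atImInfty, eventually_comap, eventually_atTop] at h1 ⊢
  obtain ⟨A, hA⟩ := h1
  refine ⟨max A 0 + 2, ?_⟩
  rintro y hy z rfl
  have him : ∀ w ∈ Metric.closedBall (z : ℂ) 1, max A 0 < w.im := by
    intro w hw
    rw [mem_closedBall_iff_norm] at hw
    have h2 := (Complex.abs_im_le_norm (w - z)).trans hw
    rw [Complex.sub_im, abs_le] at h2
    have : (z : ℂ).im = z.im := rfl
    linarith [h2.1]
  have hd : DifferentiableOn ℂ (fun w => (f ∘ ofComplex) w - l) (Metric.closedBall (z : ℂ) 1) := by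
    refine ((UpperHalfPlane.mdifferentiable_iff.mp hf).mono fun w hw => ?_).sub_const l
    exact (le_max_right A 0).trans_lt (him w hw)
  have h2 := Complex.norm_deriv_le_of_forall_mem_sphere_norm_le (c := (z : ℂ)) (R := 1)
    (C := ε / 2) (f := fun w => (f ∘ ofComplex) w - l) one_pos
    (hd.diffContOnCl_ball le_rfl) fun w hw => by
      have hw' := him w (Metric.sphere_subset_closedBall hw)
      have hw0 : 0 < w.im := (le_max_right A 0).trans_lt hw'
      have h3 := hA w.im ((le_max_left A 0).trans hw'.le) ⟨w, hw0⟩ rfl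
      rw [dist_eq_norm] at h3
      rw [Function.comp_apply, ofComplex_apply_of_im_pos hw0]
      exact h3.le
  rw [deriv_sub_const] at h2
  rw [dist_zero_right, normalizedDerivOfComplex, norm_mul, norm_inv]
  have h4 : 1 ≤ ‖2 * (Real.pi : ℂ) * Complex.I‖ := by
    rw [norm_mul, norm_mul, Complex.norm_I, Complex.norm_ofNat, Complex.norm_real,
      Real.norm_of_nonneg Real.pi_pos.le]
    linarith [Real.pi_gt_three]
  calc _ ≤ 1 * (ε / 2 / 1) := by
        gcongr
        exact inv_le_one_of_one_le₀ h4
    _ < ε := by linarith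

/-- The Wronskian of `V` and `U`. -/
def wronskianVU : ℍ → ℂ := D V * U - V * D U

theorem mdifferentiable_wronskianVU : MDiff wronskianVU :=
  ((normalizedDerivOfComplex_mdifferentiable mdifferentiable_V).mul mdifferentiable_U).sub
    (mdifferentiable_V.mul (normalizedDerivOfComplex_mdifferentiable mdifferentiable_U))

/-- The point is that one anomaly `c` serves all functions in weight 2, so it cancels in the
Wronskian. -/
theorem exists_normalizedDeriv_slash_S :
    ∃ c : ℍ → ℂ, (∀ F' G' : ℍ → ℂ, MDiff F' → F' ∣[(2 : ℤ)] ModularGroup.S = G' →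
      D F' ∣[(4 : ℤ)] ModularGroup.S = D G' + c * G') := by
  refine ⟨fun z => ((2 : ℤ) : ℂ) * (2 * Real.pi * Complex.I)⁻¹ *
    (ModularGroup.S 1 0 / denom ModularGroup.S z), fun F' G' hF' h' => ?_⟩
  have := normalizedDerivOfComplex_SL_slash (k := 2) hF' (γ := ModularGroup.S)
  rw [h'] at this
  rw [this]
  exact (sub_add_cancel _ _).symm

theorem normalizedDeriv_slash_T {F G : ℍ → ℂ} {k : ℤ} (hF : MDiff F)
    (h : F ∣[k] ModularGroup.T = G) : D F ∣[k + 2] ModularGroup.T = D G := by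
  have := normalizedDerivOfComplex_SL_slash (k := k) hF (γ := ModularGroup.T)
  rw [h] at this
  rw [this]
  ext z
  simp [ModularGroup.T]

theorem D_U : D U = D V + D W := by
  conv_lhs => rw [U_eq_V_add_W]
  exact normalizedDerivOfComplex_add V W mdifferentiable_V mdifferentiable_W

theorem wronskianVU_slash_S : wronskianVU ∣[(6 : ℤ)] ModularGroup.S = -wronskianVU := by
  obtain ⟨c, hc⟩ := exists_normalizedDeriv_slash_S
  have hU := hc U _ mdifferentiable_U U_slash_S
  have hV := hc V _ mdifferentiable_V V_slash_S
  rw [normalizedDerivOfComplex_neg _ mdifferentiable_U] at hU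
  rw [normalizedDerivOfComplex_neg _ mdifferentiable_W] at hV
  rw [wronskianVU, sub_slash, mul_slash_sub 6 2, mul_slash_sub 6 4]
  norm_num
  rw [hU, hV, U_slash_S, V_slash_S, D_U, U_eq_V_add_W]
  ring

theorem wronskianVU_slash_T : wronskianVU ∣[(6 : ℤ)] ModularGroup.T = -wronskianVU := by
  have hU := normalizedDeriv_slash_T mdifferentiable_U (U_slash_T 2)
  have hV := normalizedDeriv_slash_T mdifferentiable_V (V_slash_T 2)
  rw [normalizedDerivOfComplex_neg _ mdifferentiable_V] at hV
  norm_num at hU hV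
  rw [wronskianVU, sub_slash, mul_slash_sub 6 2, mul_slash_sub 6 4]
  norm_num
  rw [hU, hV, U_slash_T, V_slash_T, D_U, U_eq_V_add_W]
  ring

theorem mdifferentiable_reducedV : MDiff reducedV := by
  have : reducedV = expMul (-(1 / 2)) * V := by
    rw [V_eq_expMul_mul]
    ext z
    rw [Pi.mul_apply, Pi.mul_apply, expMul, expMul, ← mul_assoc, ← Complex.exp_add]
    push_cast
    ring_nf
    simp
  rw [this]
  exact (mdifferentiable_expMul _).mul mdifferentiable_V

theorem D_expMul (c : ℝ) : D (expMul c) = (c : ℂ) • expMul c := by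
  ext z
  have h : (expMul c ∘ ofComplex) =ᶠ[𝓝 (z : ℂ)]
      fun w => Complex.exp (2 * Real.pi * Complex.I * c * w) := by
    filter_upwards [isOpen_upperHalfPlaneSet.mem_nhds z.im_pos] with w hw
    rw [Function.comp_apply, expMul, ofComplex_apply_of_im_pos hw]
  have h1 : HasDerivAt (fun w : ℂ => Complex.exp (2 * Real.pi * Complex.I * c * w))
      (Complex.exp (2 * Real.pi * Complex.I * c * z) * (2 * Real.pi * Complex.I * c * 1)) z :=
    ((hasDerivAt_id (z : ℂ)).const_mul _).cexp
  rw [normalizedDerivOfComplex, h.deriv_eq, h1.deriv, Pi.smul_apply, smul_eq_mul, expMul]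
  field_simp [Complex.two_pi_I_ne_zero]

/-- After cancelling `exp(πiz)` the derivatives of the convergent factors tend to 0, and the limit
is `(16/2)/16`. -/
theorem tendsto_wronskianVU_div :
    Tendsto (fun z => wronskianVU z / UVW z) atImInfty (𝓝 (1 / 2)) := by
  have hV : D V = expMul (1 / 2) * ((1 / 2 : ℂ) • reducedV + D reducedV) := by
    conv_lhs => rw [V_eq_expMul_mul]
    rw [normalizedDerivOfComplex_mul _ _ (mdifferentiable_expMul _) mdifferentiable_reducedV,
      D_expMul]
    ext z
    simp only [Pi.add_apply, Pi.mul_apply, Pi.smul_apply, smul_eq_mul]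
    push_cast
    ring
  have e : ∀ z, wronskianVU z / UVW z =
      ((1 / 2 * reducedV z + D reducedV z) * U z - reducedV z * D U z) /
        (U z * reducedV z * W z) := by
    intro z
    have h0 : expMul (1 / 2) z ≠ 0 := Complex.exp_ne_zero _
    symm
    rw [← mul_div_mul_left _ _ h0, wronskianVU, UVW, hV, V_eq_expMul_mul]
    simp only [Pi.add_apply, Pi.sub_apply, Pi.mul_apply, Pi.smul_apply, smul_eq_mul]
    congr 1 <;> ring
  have h := ((((tendsto_reducedV.const_mul (1 / 2)).add (tendsto_normalizedDeriv_zero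
    mdifferentiable_reducedV tendsto_reducedV)).mul tendsto_U).sub
    (tendsto_reducedV.mul (tendsto_normalizedDeriv_zero mdifferentiable_U tendsto_U))).div
    ((tendsto_U.mul tendsto_reducedV).mul tendsto_W) (by norm_num)
  norm_num at h
  refine (h.congr fun z => (e z).symm).trans_eq ?_
  norm_num

/-- Both sides have weight 6 and are negated by `S` and `T`. Multiplied by `UVW` they become cusp
forms of weight 12, both multiples of the discriminant, so their quotient is constant and is read
off at `i∞`. -/
theorem wronskianVU_eq : wronskianVU = (1 / 2 : ℂ) • UVW := by
  have hz : IsZeroAtImInfty UVW := by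
    have h := ((tendsto_U.mul isZeroAtImInfty_V).mul tendsto_W)
    simp only [mul_zero, zero_mul] at h
    exact h
  have hz2 : IsZeroAtImInfty (UVW * UVW) := by
    have := hz.mul hz
    simp only [mul_zero] at this
    exact this
  have hN : IsZeroAtImInfty (wronskianVU * UVW) := by
    have := tendsto_wronskianVU_div.mul hz2
    simp only [mul_zero] at this
    refine this.congr fun z => ?_
    have := UVW_ne_zero z
    simp only [Pi.mul_apply]
    field_simp
  have hform : ∀ f : ℍ → ℂ, MDiff f → f ∣[(6 : ℤ)] ModularGroup.S = -f →
      f ∣[(6 : ℤ)] ModularGroup.T = -f → IsZeroAtImInfty (f * UVW) →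
      ∃ c : ℂ, ∀ z, f z * UVW z = c * ModularForm.discriminant z := by
    intro f hf hS hT hfz
    obtain ⟨c, hc⟩ := CuspForm.exists_smul_discriminant_of_weight_eq_twelve
      (cuspFormOfZero (f * UVW) (hf.mul mdifferentiable_UVW)
        (by rw [mul_slash_sub 12 6]; norm_num; rw [UVW_slash_S, hS]; ring)
        (by rw [mul_slash_sub 12 6]; norm_num; rw [UVW_slash_T, hT]; ring) hfz)
    exact ⟨c, fun w => (congrFun (congrArg (fun f : CuspForm 𝒮ℒ 12 => (f : ℍ → ℂ)) hc) w).symm⟩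
  obtain ⟨a, ha⟩ := hform _ mdifferentiable_wronskianVU wronskianVU_slash_S wronskianVU_slash_T hN
  obtain ⟨b, hb⟩ := hform _ mdifferentiable_UVW UVW_slash_S UVW_slash_T hz2
  have hq : ∀ z, wronskianVU z / UVW z = a / b := by
    intro z
    have h1 := UVW_ne_zero z
    have h2 := ModularForm.discriminant_ne_zero z
    have hb0 : b ≠ 0 := by
      rintro rfl
      have := hb z
      rw [zero_mul] at this
      exact mul_ne_zero h1 h1 this
    rw [div_eq_div_iff h1 hb0]
    apply mul_right_cancel₀ (mul_ne_zero h1 h2)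
    linear_combination (b * ModularForm.discriminant z) * ha z
      - (a * ModularForm.discriminant z) * hb z
  have hab : a / b = 1 / 2 := tendsto_nhds_unique
    (tendsto_const_nhds.congr fun z => (hq z).symm) tendsto_wronskianVU_div
  ext z
  rw [Pi.smul_apply, smul_eq_mul, ← hab, ← hq z, div_mul_cancel₀ _ (UVW_ne_zero z)]

theorem deriv_comp_ofComplex {g : ℂ → ℂ} (z : ℍ) :
    deriv ((fun w : ℍ => g w) ∘ ofComplex) z = deriv g z := by
  refine Filter.EventuallyEq.deriv_eq ?_
  filter_upwards [isOpen_upperHalfPlaneSet.mem_nhds z.im_pos] with w hw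
  rw [Function.comp_apply, ofComplex_apply_of_im_pos hw]

theorem hasDerivAt_theta_pow (z : ℍ) :
    HasDerivAt (fun w => theta10 w ^ 4) (2 * Real.pi * Complex.I * D V z) z ∧
      HasDerivAt (fun w => theta00 w ^ 4) (2 * Real.pi * Complex.I * D U z) z := by
  have h : ∀ g : ℂ → ℂ, DifferentiableAt ℂ g z →
      HasDerivAt g (2 * Real.pi * Complex.I * D (fun w : ℍ => g w) z) z := by
    intro g hg
    rw [normalizedDerivOfComplex, deriv_comp_ofComplex, mul_inv_cancel_left₀ Complex.two_pi_I_ne_zero]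
    exact hg.hasDerivAt
  exact ⟨h _ ((differentiableAt_theta10 z.im_pos).pow 4),
    h _ ((differentiableAt_theta00 z.im_pos).pow 4)⟩

/-- `λ'/λ = 2πi (DV/V - DU/U)` is `2πi` times the Wronskian over `UV`, which `wronskianVU_eq` turns
into `πi W`. -/
theorem hasDerivAt_lam (z : ℍ) :
    HasDerivAt lam (Real.pi * Complex.I * W z * lam z) z := by
  obtain ⟨h1, h2⟩ := hasDerivAt_theta_pow z
  have h3 := h1.div h2 (U_ne_zero z)
  have e : Real.pi * Complex.I * W z * lam z =
      (2 * Real.pi * Complex.I * D V z * theta00 z ^ 4 - theta10 z ^ 4 *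
        (2 * Real.pi * Complex.I * D U z)) / (theta00 z ^ 4) ^ 2 := by
    have h4 := congrFun wronskianVU_eq z
    simp only [wronskianVU, UVW, Pi.sub_apply, Pi.mul_apply, Pi.smul_apply, smul_eq_mul] at h4
    have h5 := U_ne_zero z
    change _ = (2 * Real.pi * Complex.I * D V z * U z - V z *
        (2 * Real.pi * Complex.I * D U z)) / U z ^ 2
    have h6 : lam z = V z / U z := rfl
    rw [h6, eq_div_iff (pow_ne_zero 2 h5)]
    field_simp
    linear_combination (-2) * h4
  rw [e]
  exact h3

theorem lam_ne_zero (z : ℍ) : lam z ≠ 0 := div_ne_zero (V_ne_zero z) (U_ne_zero z)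

theorem logDeriv_lam (z : ℍ) : logDeriv lam z = Real.pi * Complex.I * W z := by
  rw [logDeriv_apply, (hasDerivAt_lam z).deriv, mul_div_cancel_right₀ _ (lam_ne_zero z)]

theorem logDeriv_lamS (z : ℍ) : logDeriv lamS z = -(Real.pi * Complex.I * V z) := by
  have hz := z.ne_zero
  have h1 : HasDerivAt (fun w : ℂ => -1 / w) (1 / (z : ℂ) ^ 2) z := by
    have := (hasDerivAt_const (z : ℂ) (-1 : ℂ)).div (hasDerivAt_id (z : ℂ)) hz
    refine this.congr_deriv ?_
    simp
  have h2 := hasDerivAt_lam (ModularGroup.S • z)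
  rw [coe_S_smul] at h2
  have h3 : HasDerivAt lamS _ (z : ℂ) := HasDerivAt.comp (z : ℂ) h2 h1
  have h4 := lam_ne_zero (ModularGroup.S • z)
  rw [coe_S_smul] at h4
  rw [logDeriv_apply, h3.deriv, W_S_smul, lamS]
  generalize lam (-1 / z) = l at h4 ⊢
  field_simp

/-! ### The logarithms of the modular lambda function -/

theorem norm_sub_le_of_hasDerivAt {g g' : ℂ → ℂ} {A C : ℝ}
    (h : ∀ w, A ≤ w.im → HasDerivAt g (g' w) w) (hC : ∀ w, A ≤ w.im → ‖g' w‖ ≤ C)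
    {z w : ℂ} (hz : A ≤ z.im) (hw : A ≤ w.im) : ‖g w - g z‖ ≤ C * ‖w - z‖ := by
  have hconv : Convex ℝ {w : ℂ | A ≤ w.im} := convex_halfSpace_im_ge A
  exact hconv.norm_image_sub_le_of_norm_hasDerivWithin_le
    (fun x hx => (h x hx).hasDerivWithinAt) (fun x hx => hC x hx) hz hw

theorem eq_of_hasDerivAt_zero {g : ℂ → ℂ} (h : ∀ z : ℍ, HasDerivAt g 0 z) (z w : ℍ) :
    g z = g w := by
  have := norm_sub_le_of_hasDerivAt (g := g) (g' := fun _ => 0) (A := min z.im w.im) (C := 0)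
    (fun v hv => h ⟨v, (lt_min z.im_pos w.im_pos).trans_le hv⟩) (fun v _ => by simp)
    (z := w) (w := z) (min_le_right _ _) (min_le_left _ _)
  rw [zero_mul, norm_le_zero_iff, sub_eq_zero] at this
  exact this

theorem V_periodic : Function.Periodic (V ∘ ofComplex) (2 : ℝ) := by
  intro w
  by_cases hw : 0 < w.im
  · have h2 : 0 < (w + (2 : ℝ)).im := by simpa using hw
    have h1 : V ⟨w + (2 : ℝ), h2⟩ = V ⟨w, hw⟩ := by
      have h3 := V_one_vadd ((1 : ℝ) +ᵥ ⟨w, hw⟩)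
      rw [V_one_vadd ⟨w, hw⟩, neg_neg] at h3
      rw [← h3]
      congr 1
      ext
      rw [coe_one_vadd, coe_one_vadd]
      change w + (2 : ℝ) = 1 + (1 + w)
      push_cast
      ring
    rw [Function.comp_apply, Function.comp_apply, ofComplex_apply_of_im_pos hw,
      ofComplex_apply_of_im_pos h2, h1]
  · have h2 : (w + (2 : ℝ)).im ≤ 0 := by simpa using hw
    rw [Function.comp_apply, Function.comp_apply, ofComplex_apply_of_im_nonpos h2,
      ofComplex_apply_of_im_nonpos (not_lt.mp hw)]

/-- As a function of `q = exp(πiz)`, `V` is holomorphic on the unit disc and vanishes at 0. A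
primitive `P` of `V/q` with `P(0) = 0` gives `g = -P(q)`. Both logarithms are expressed through `g`:
`ℒ_S = g` and `ℒ(z) = g(-1/z)`. -/
theorem exists_primitive_V : ∃ g : ℂ → ℂ,
    (∀ z : ℍ, HasDerivAt g (-(Real.pi * Complex.I * V z)) z) ∧
      Tendsto (fun z : ℍ => g z) atImInfty (𝓝 0) := by
  have hz := isZeroAtImInfty_V
  have hd := differentiableOn_cuspFunction_ball two_pos V_periodic mdifferentiable_V
    hz.isBoundedAtImInfty
  have hds : DifferentiableOn ℂ (dslope (cuspFunction 2 V) 0) (Metric.ball 0 1) :=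
    (Complex.differentiableOn_dslope (Metric.ball_mem_nhds 0 one_pos)).mpr hd
  obtain ⟨P, hP0, hP⟩ := (DifferentiableOn.isExactOn_ball hds).with_val_at 0 0
  have hq : ∀ z : ℍ, HasDerivAt (Function.Periodic.qParam 2)
      (Function.Periodic.qParam 2 z * (Real.pi * Complex.I)) (z : ℂ) := by
    intro z
    have := (((hasDerivAt_id (z : ℂ)).const_mul (2 * Real.pi * Complex.I)).div_const
      ((2 : ℝ) : ℂ)).cexp
    refine this.congr_deriv ?_
    rw [Function.Periodic.qParam, id, Complex.ofReal_ofNat]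
    ring
  refine ⟨fun w => -P (Function.Periodic.qParam 2 w), fun z => ?_, ?_⟩
  · have hlt := Function.Periodic.norm_qParam_lt_one two_pos z.im_pos
    have h1 := (HasDerivAt.comp (z : ℂ) (hP _ (mem_ball_zero_iff.mpr hlt)) (hq z)).neg
    refine h1.congr_deriv ?_
    have h2 := sub_smul_dslope (cuspFunction 2 V) 0 (Function.Periodic.qParam 2 z)
    rw [hz.cuspFunction_apply_zero two_pos, sub_zero, sub_zero, smul_eq_mul,
      eq_cuspFunction z two_ne_zero V_periodic] at h2
    rw [← h2]
    ring
  · have h1 : ContinuousAt P 0 := (hP 0 (Metric.mem_ball_self one_pos)).continuousAt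
    have h2 : Tendsto (fun w : ℂ => P w) (𝓝 0) (𝓝 0) := by
      have := h1.tendsto
      rwa [hP0] at this
    have h3 := (h2.comp (qParam_tendsto_atImInfty (h := 2) two_pos)).neg
    rw [neg_zero] at h3
    exact h3

theorem exists_norm_V_le_exp : ∃ C A : ℝ, 0 ≤ C ∧ 0 < A ∧ ∀ z : ℍ, A ≤ z.im →
    ‖V z‖ ≤ C * Real.exp (-Real.pi * z.im) := by
  obtain ⟨C, A, hC, h⟩ := decay_of_antiperiodic V_mem_classP (V_slash_T 0)
  exact ⟨C, max A 1, hC, lt_max_of_lt_right one_pos,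
    fun z hz => h z ((le_max_left _ _).trans hz)⟩

theorem continuousOn_of_eq_const_mul {f : ℂ → ℂ} {F : ℍ → ℂ} (hF : MDiff F) {c : ℂ}
    (h : ∀ z : ℍ, f z = c * F z) : ContinuousOn f {z : ℂ | 0 < z.im} := by
  refine (((UpperHalfPlane.mdifferentiable_iff.mp hF).continuousOn).const_mul c).congr
    fun z hz => ?_
  change f z = c * F (ofComplex z)
  rw [ofComplex_apply_of_im_pos hz]
  exact h ⟨z, hz⟩

theorem continuousOn_logDeriv_vertical {f : ℂ → ℂ} {F : ℍ → ℂ} (hF : MDiff F) {c : ℂ}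
    (h : ∀ z : ℍ, f z = c * F z) (x : ℝ) :
    ContinuousOn (fun t : ℝ => f (x + t * Complex.I) * Complex.I) (Set.Ioi 0) := by
  refine ((continuousOn_of_eq_const_mul hF h).comp (by fun_prop) fun t ht => ?_).mul continuousOn_const
  simpa using ht

theorem hasDerivAt_vertical (x t : ℝ) :
    HasDerivAt (fun s : ℝ => (x : ℂ) + s * Complex.I) Complex.I t := by
  have := ((Complex.ofRealCLM.hasDerivAt (x := t)).mul_const Complex.I).const_add (x : ℂ)
  refine this.congr_deriv ?_
  simp

theorem tendsto_vertical_atImInfty {g : ℂ → ℂ} {l : ℂ}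
    (h : Tendsto (fun z : ℍ => g z) atImInfty (𝓝 l)) (x : ℝ) :
    Tendsto (fun t : ℝ => g (x + t * Complex.I)) atTop (𝓝 l) := by
  rw [tendsto_def] at h ⊢
  intro s hs
  have h1 := h s hs
  obtain ⟨A, hA⟩ := (atImInfty_mem _).mp h1
  filter_upwards [Ici_mem_atTop A, Ioi_mem_atTop 0] with t ht ht0
  exact hA ⟨x + t * Complex.I, by simpa using ht0⟩ (by simpa [UpperHalfPlane.im] using ht)

theorem logLamS_eq {g : ℂ → ℂ} (h : ∀ z : ℍ, HasDerivAt g (-(Real.pi * Complex.I * V z)) z)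
    (h0 : Tendsto (fun z : ℍ => g z) atImInfty (𝓝 0)) (z : ℍ) : logLamS z = g z := by
  have hcont := continuousOn_logDeriv_vertical (f := logDeriv lamS) (c := -(Real.pi * Complex.I))
    mdifferentiable_V (fun w => by rw [logDeriv_lamS]; ring) z.re
  have hderiv : ∀ t ∈ Set.Ici z.im, HasDerivAt (fun t : ℝ => g (z.re + t * Complex.I))
      (logDeriv lamS (z.re + t * Complex.I) * Complex.I) t := by
    intro t ht
    have ht0 : 0 < t := z.im_pos.trans_le ht
    have h1 := h ⟨z.re + t * Complex.I, by simpa using ht0⟩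
    rw [← logDeriv_lamS] at h1
    exact HasDerivAt.comp t h1 (hasDerivAt_vertical z.re t)
  have hint : MeasureTheory.IntegrableOn
      (fun t : ℝ => logDeriv lamS (z.re + t * Complex.I) * Complex.I) (Set.Ioi z.im) := by
    have hc' := hcont.mono (Set.Ici_subset_Ioi.mpr z.im_pos)
    obtain ⟨C, A, hC, hA, hV⟩ := exists_norm_V_le_exp
    refine (MeasureTheory.integrable_norm_iff ?_).mp ?_
    · exact (hc'.mono Set.Ioi_subset_Ici_self).aestronglyMeasurable measurableSet_Ioi
    · refine integrable_of_isBigO_exp_neg Real.pi_pos hc'.norm ?_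
      refine IsBigO.of_bound (Real.pi * C) ?_
      filter_upwards [Ici_mem_atTop A] with t ht
      have ht0 : 0 < t := hA.trans_le ht
      have h1 := hV ⟨z.re + t * Complex.I, by simpa using ht0⟩ (by simpa [UpperHalfPlane.im] using ht)
      have h2 := logDeriv_lamS ⟨z.re + t * Complex.I, by simpa using ht0⟩
      have h3 : logDeriv lamS (z.re + t * Complex.I) = _ := h2
      rw [norm_norm, h3, norm_mul, norm_neg, norm_mul, norm_mul, Complex.norm_I, mul_one, mul_one,
        Complex.norm_real, Real.norm_of_nonneg Real.pi_pos.le, mul_assoc,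
        Real.norm_of_nonneg (Real.exp_pos _).le]
      refine mul_le_mul_of_nonneg_left (h1.trans_eq ?_) Real.pi_pos.le
      simp [UpperHalfPlane.im]
  have key := MeasureTheory.integral_Ioi_of_hasDerivAt_of_tendsto
    (hderiv z.im Set.self_mem_Ici).continuousAt.continuousWithinAt
    (fun t ht => hderiv t (Set.mem_Ici_of_Ioi ht)) hint (tendsto_vertical_atImInfty h0 z.re)
  rw [logLamS, key, zero_sub, neg_neg]
  congr 1
  exact Complex.re_add_im z

theorem hasDerivAt_neg_inv (z : ℍ) : HasDerivAt (fun w : ℂ => -1 / w) (1 / (z : ℂ) ^ 2) z := by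
  refine ((hasDerivAt_const (z : ℂ) (-1 : ℂ)).div (hasDerivAt_id (z : ℂ)) z.ne_zero).congr_deriv ?_
  simp

theorem hasDerivAt_comp_neg_inv {g : ℂ → ℂ}
    (h : ∀ z : ℍ, HasDerivAt g (-(Real.pi * Complex.I * V z)) z) (z : ℍ) :
    HasDerivAt (fun w => g (-1 / w)) (Real.pi * Complex.I * W z) z := by
  have h1 := h (ModularGroup.S • z)
  rw [coe_S_smul, V_S_smul] at h1
  refine (HasDerivAt.comp (z : ℂ) h1 (hasDerivAt_neg_inv z)).congr_deriv ?_
  have := z.ne_zero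
  field_simp

/-- Makes the integral defining `ℒ` converge at 0: on the imaginary axis `|W(iy)| = y⁻² |V(i/y)|`,
and the exponential decay of `V` beats `y⁻²`. -/
theorem exists_norm_W_vertical_le : ∃ C : ℝ, ∀ z : ℍ, z.re = 0 → ‖W z‖ ≤ C := by
  obtain ⟨C, A, hC, hA, h⟩ := exists_norm_V_le_exp
  refine ⟨max C ((1 + A) ^ 4), fun z hz => ?_⟩
  have hy := z.im_pos
  by_cases hzA : A ≤ 1 / z.im
  · refine le_max_of_le_left ?_
    have hz' : (z : ℂ) = z.im * Complex.I := by
      apply Complex.ext <;> simp [hz]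
    have hw : (ModularGroup.S • z).im = 1 / z.im := by
      change ((ModularGroup.S • z : ℍ) : ℂ).im = _
      rw [coe_S_smul, hz', neg_div, ← div_div, Complex.div_I]
      simp [← Complex.ofReal_inv]
    have h1 := h (ModularGroup.S • z) (hzA.trans_eq hw.symm)
    rw [V_S_smul, hw, norm_mul, norm_neg, norm_pow] at h1
    have h2 : ‖(z : ℂ)‖ = z.im := by
      rw [hz', norm_mul, Complex.norm_I, mul_one, Complex.norm_real, Real.norm_of_nonneg hy.le]
    rw [h2] at h1
    set s := 1 / z.im with hs
    have hs0 : 0 < s := by positivity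
    have h3 : s ^ 2 * Real.exp (-Real.pi * s) ≤ 1 := by
      have h4 : s ≤ Real.exp s := by linarith [Real.add_one_le_exp s]
      calc s ^ 2 * Real.exp (-Real.pi * s) ≤ Real.exp s ^ 2 * Real.exp (-Real.pi * s) := by gcongr
        _ = Real.exp (2 * s - Real.pi * s) := by
            rw [← Real.exp_nat_mul, ← Real.exp_add]
            push_cast
            ring_nf
        _ ≤ 1 := Real.exp_le_one_iff.mpr (by nlinarith [Real.pi_gt_three])
    have h5 : ‖W z‖ = s ^ 2 * (z.im ^ 2 * ‖W z‖) := by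
      rw [hs]
      field_simp
    calc ‖W z‖ = s ^ 2 * (z.im ^ 2 * ‖W z‖) := h5
      _ ≤ s ^ 2 * (C * Real.exp (-Real.pi * s)) := by gcongr
      _ = C * (s ^ 2 * Real.exp (-Real.pi * s)) := by ring
      _ ≤ C := mul_le_of_le_one_right hC h3
  · refine le_max_of_le_right ((norm_W_le z).trans ?_)
    rw [not_le] at hzA
    gcongr

/-- The function `g(-1/w)` is a primitive of `πi W`. The endpoint 0 contributes nothing, since
`-1/(it) = i/t` tends to `i∞` as `t → 0⁺`. -/
theorem logLam_eq {g : ℂ → ℂ} (h : ∀ z : ℍ, HasDerivAt g (-(Real.pi * Complex.I * V z)) z)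
    (h0 : Tendsto (fun z : ℍ => g z) atImInfty (𝓝 0)) (z : ℍ) : logLam z = g (-1 / z) := by
  have hG := hasDerivAt_comp_neg_inv h
  have hcont := continuousOn_logDeriv_vertical (f := logDeriv lam) (c := Real.pi * Complex.I)
    mdifferentiable_W (fun w => logDeriv_lam w) 0
  simp only [Complex.ofReal_zero, zero_add] at hcont
  have hderiv : ∀ t ∈ Set.Ioi (0 : ℝ), HasDerivAt (fun t : ℝ => g (-1 / (t * Complex.I)))
      (logDeriv lam (t * Complex.I) * Complex.I) t := by
    intro t ht
    have h1 := hG ⟨t * Complex.I, by simpa using ht⟩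
    rw [← logDeriv_lam] at h1
    have h2 := hasDerivAt_vertical 0 t
    simp only [Complex.ofReal_zero, zero_add] at h2
    exact HasDerivAt.comp (h₂ := fun w => g (-1 / w)) t h1 h2
  have hint : IntervalIntegrable (fun t : ℝ => logDeriv lam (t * Complex.I) * Complex.I)
      MeasureTheory.volume 0 z.im := by
    rw [intervalIntegrable_iff_integrableOn_Ioc_of_le z.im_pos.le]
    obtain ⟨C, hC⟩ := exists_norm_W_vertical_le
    have hfin : MeasureTheory.IsFiniteMeasure
        (MeasureTheory.volume.restrict (Set.Ioc (0 : ℝ) z.im)) := inferInstance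
    refine MeasureTheory.Integrable.of_bound (C := Real.pi * C)
      ((hcont.mono Set.Ioc_subset_Ioi_self).aestronglyMeasurable measurableSet_Ioc) ?_
    filter_upwards [MeasureTheory.ae_restrict_mem measurableSet_Ioc] with t ht
    have h1 := hC ⟨t * Complex.I, by simpa using ht.1⟩ (by simp [UpperHalfPlane.re])
    have h3 : logDeriv lam (t * Complex.I) = _ := logDeriv_lam ⟨t * Complex.I, by simpa using ht.1⟩
    rw [h3, norm_mul, norm_mul, norm_mul, Complex.norm_I, mul_one, mul_one,
      Complex.norm_real, Real.norm_of_nonneg Real.pi_pos.le]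
    exact mul_le_mul_of_nonneg_left h1 Real.pi_pos.le
  have hlim : Tendsto (fun t : ℝ => g (-1 / (t * Complex.I))) (𝓝[>] 0) (𝓝 0) := by
    have := (tendsto_vertical_atImInfty h0 0).comp tendsto_inv_nhdsGT_zero
    refine this.congr fun t => ?_
    simp only [Function.comp_apply, Complex.ofReal_zero, zero_add]
    congr 1
    push_cast
    rw [neg_div, one_div, mul_inv, Complex.inv_I, mul_neg, neg_neg]
  have k1 := intervalIntegral.integral_eq_sub_of_hasDerivAt_of_tendsto z.im_pos
    (fun t ht => hderiv t ht.1) hint hlim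
    ((hderiv z.im z.im_pos).continuousAt.tendsto.mono_left nhdsWithin_le_nhds)
  have k2 : ∫ x in (0 : ℝ)..z.re, logDeriv lam (x + z.im * Complex.I) =
      g (-1 / (z.re + z.im * Complex.I)) - g (-1 / ((0 : ℝ) + z.im * Complex.I)) := by
    have hd : ∀ x : ℝ, HasDerivAt (fun x : ℝ => g (-1 / (x + z.im * Complex.I)))
        (logDeriv lam (x + z.im * Complex.I)) x := by
      intro x
      have h1 := hG ⟨x + z.im * Complex.I, by simpa using z.im_pos⟩
      rw [← logDeriv_lam] at h1
      have h2 := (Complex.ofRealCLM.hasDerivAt (x := x)).add_const (z.im * Complex.I)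
      refine (HasDerivAt.comp (h₂ := fun w => g (-1 / w)) x h1 h2).congr_deriv ?_
      simp
    refine intervalIntegral.integral_eq_sub_of_hasDerivAt (fun x _ => hd x) ?_
    have hc : Continuous fun x : ℝ => logDeriv lam (x + z.im * Complex.I) := by
      exact (continuousOn_of_eq_const_mul mdifferentiable_W logDeriv_lam).comp_continuous (by fun_prop) fun x => by simpa using z.im_pos
    exact hc.intervalIntegrable _ _
  rw [logLam, k1, k2, Complex.ofReal_zero, zero_add, sub_zero, add_sub_cancel]
  congr 2
  exact Complex.re_add_im z

theorem mdifferentiable_of_hasDerivAt {g : ℂ → ℂ} {F : ℍ → ℂ} {g' : ℍ → ℂ} (h : ∀ z : ℍ, F z = g z)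
    (hg : ∀ z : ℍ, HasDerivAt g (g' z) z) : MDiff F := by
  rw [funext h]
  refine mdifferentiable_comp_coe fun z hz => ?_
  exact (hg ⟨z, hz⟩).differentiableAt

theorem logLam_eq_comp_S (z : ℍ) : logLam z = logLamS (ModularGroup.S • z) := by
  obtain ⟨g, hg, hg0⟩ := exists_primitive_V
  rw [logLam_eq hg hg0, logLamS_eq hg hg0, coe_S_smul]

/-- Since `V` changes sign, `g(z + 1) + g(z)` is constant, and it vanishes at `i∞`. -/
theorem logLamS_one_vadd (z : ℍ) : logLamS ((1 : ℝ) +ᵥ z) = -logLamS z := by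
  obtain ⟨g, hg, hg0⟩ := exists_primitive_V
  rw [logLamS_eq hg hg0, logLamS_eq hg hg0, coe_one_vadd]
  have hd : ∀ z : ℍ, HasDerivAt (fun w => g (1 + w) + g w) 0 z := by
    intro z
    have h1 := hg ((1 : ℝ) +ᵥ z)
    rw [coe_one_vadd, V_one_vadd] at h1
    have h2 := (HasDerivAt.comp (z : ℂ) h1 ((hasDerivAt_id (z : ℂ)).const_add 1)).add (hg z)
    refine h2.congr_deriv ?_
    ring
  have hlim : Tendsto (fun w : ℍ => g (1 + w) + g w) atImInfty (𝓝 0) := by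
    have h1 := (hg0.comp tendsto_one_vadd_atImInfty).add hg0
    rw [add_zero] at h1
    refine h1.congr fun w => ?_
    rw [Function.comp_apply, coe_one_vadd]
  have h3 : g (1 + z) + g z = 0 := tendsto_nhds_unique
    (tendsto_const_nhds.congr fun w => eq_of_hasDerivAt_zero hd z w) hlim
  linear_combination h3

/-- The derivative of `ℒ(z+1) - ℒ(z) + ℒ_S(z)` is `πi(U - W - V) = 0`. The constant is found at
`i∞`, where `ℒ_S → 0` and `ℒ' = πi W → πi`. -/
theorem logLam_one_vadd (z : ℍ) :
    logLam ((1 : ℝ) +ᵥ z) = logLam z - logLamS z + Real.pi * Complex.I := by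
  obtain ⟨g, hg, hg0⟩ := exists_primitive_V
  have hG := hasDerivAt_comp_neg_inv hg
  rw [logLam_eq hg hg0, logLam_eq hg hg0, logLamS_eq hg hg0, coe_one_vadd]
  have hd : ∀ z : ℍ, HasDerivAt (fun w => g (-1 / (1 + w)) - g (-1 / w) + g w) 0 z := by
    intro z
    have h1 := hG ((1 : ℝ) +ᵥ z)
    rw [coe_one_vadd, W_one_vadd] at h1
    have h2 := ((HasDerivAt.comp (h₂ := fun w => g (-1 / w)) (z : ℂ) h1
      ((hasDerivAt_id (z : ℂ)).const_add 1)).sub (hG z)).add (hg z)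
    refine h2.congr_deriv ?_
    rw [U_eq_V_add_W, Pi.add_apply]
    ring
  have hlim : Tendsto (fun w : ℍ => g (-1 / (1 + w)) - g (-1 / w) + g w) atImInfty
      (𝓝 (Real.pi * Complex.I)) := by
    suffices h : Tendsto (fun w : ℍ => g (-1 / (1 + w)) - g (-1 / w)) atImInfty
        (𝓝 (Real.pi * Complex.I)) by
      simpa using h.add hg0
    rw [Metric.tendsto_nhds]
    intro ε hε
    have hW := Metric.tendsto_nhds.mp (tendsto_W.const_mul (Real.pi * Complex.I)) (ε / 2)
      (half_pos hε)
    rw [atImInfty, eventually_comap, eventually_atTop] at hW ⊢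
    obtain ⟨A, hA⟩ := hW
    refine ⟨max A 1, ?_⟩
    rintro _ hz z rfl
    have hpos : ∀ w : ℂ, max A 1 ≤ w.im → 0 < w.im := fun w hw =>
      one_pos.trans_le ((le_max_right _ _).trans hw)
    -- Mean value inequality for `ℒ(w) - πiw` on the unit segment from `z` to `z + 1`.
    have h1 := norm_sub_le_of_hasDerivAt (g := fun w => g (-1 / w) - Real.pi * Complex.I * w)
      (g' := fun w => Real.pi * Complex.I * W (ofComplex w) - Real.pi * Complex.I)
      (A := max A 1) (C := ε / 2)
      (fun w hw => by
        have h2 := (hG ⟨w, hpos w hw⟩).sub ((hasDerivAt_id w).const_mul (Real.pi * Complex.I))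
        rw [mul_one] at h2
        rw [ofComplex_apply_of_im_pos (hpos w hw)]
        exact h2)
      (fun w hw => by
        have h2 := hA w.im ((le_max_left _ _).trans hw) ⟨w, hpos w hw⟩ rfl
        rw [dist_eq_norm, mul_one] at h2
        rw [ofComplex_apply_of_im_pos (hpos w hw)]
        exact h2.le)
      (z := (z : ℂ)) (w := 1 + z) hz (by simpa using hz)
    rw [add_sub_cancel_right, norm_one, mul_one] at h1
    rw [dist_eq_norm]
    refine lt_of_le_of_lt ?_ (half_lt_self hε)
    refine (le_of_eq ?_).trans h1
    congr 1
    ring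
  have h3 : g (-1 / (1 + z)) - g (-1 / z) + g z = Real.pi * Complex.I := tendsto_nhds_unique
    (tendsto_const_nhds.congr fun w => eq_of_hasDerivAt_zero hd z w) hlim
  linear_combination h3

/-- Integrating upwards from `z` by the fixed length `max A 0` reaches the region where `|g| < 1`.
On the way the derivative is at most `2π(1 + 1/Im z)⁴`. -/
theorem logLamS_mem_classP : logLamS ∈ classP := by
  obtain ⟨g, hg, hg0⟩ := exists_primitive_V
  refine ⟨mdifferentiable_of_hasDerivAt (logLamS_eq hg hg0) hg, ?_⟩
  have h1 := hg0.norm.eventually (gt_mem_nhds (show ‖(0 : ℂ)‖ < 1 by simp))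
  rw [atImInfty, eventually_comap, eventually_atTop] at h1
  obtain ⟨A, hA⟩ := h1
  refine moderateGrowth_of_im_bound (1 + Real.pi * 2 * (max A 0)) 4 (by positivity) fun z => ?_
  have hy := z.im_pos
  rw [logLamS_eq hg hg0]
  have h2 := norm_sub_le_of_hasDerivAt (g := g)
    (g' := fun w => -(Real.pi * Complex.I * V (ofComplex w)))
    (A := z.im) (C := Real.pi * (2 * (1 + 1 / z.im) ^ 4))
    (fun w hw => by
      rw [ofComplex_apply_of_im_pos (hy.trans_le hw)]
      exact hg ⟨w, hy.trans_le hw⟩)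
    (fun w hw => by
      have hw0 := hy.trans_le hw
      rw [ofComplex_apply_of_im_pos hw0, norm_neg, norm_mul, norm_mul, Complex.norm_I, mul_one,
        Complex.norm_real, Real.norm_of_nonneg Real.pi_pos.le]
      refine mul_le_mul_of_nonneg_left ((norm_V_le ⟨w, hw0⟩).trans ?_) Real.pi_pos.le
      have : z.im ≤ UpperHalfPlane.im ⟨w, hw0⟩ := hw
      gcongr)
    (z := z + (max A 0 : ℝ) * Complex.I) (w := z) (by simp) (by simp)
  have h3 := hA (z.im + max A 0) (by linarith [le_max_left A 0])
    ⟨z + (max A 0 : ℝ) * Complex.I, by simpa using by positivity⟩ (by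
      change Complex.im (_ + _) = _
      simp)
  have h4 : ‖(z : ℂ) - (z + (max A 0 : ℝ) * Complex.I)‖ = max A 0 := by
    rw [sub_add_cancel_left, norm_neg, norm_mul, Complex.norm_I, mul_one, Complex.norm_real,
      Real.norm_of_nonneg (le_max_right _ _)]
  rw [h4] at h2
  have h5 : (1 : ℝ) ≤ (1 + 1 / z.im) ^ 4 := one_le_pow₀ (by
    have : 0 < 1 / z.im := by positivity
    linarith)
  have h6 := norm_sub_norm_le (g z) (g (z + (max A 0 : ℝ) * Complex.I))
  have h7 : ‖g (z + (max A 0 : ℝ) * Complex.I)‖ < 1 := h3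
  nlinarith [h5, h6, h7, h2]

theorem logLamS_slash_S : logLamS ∣[(0 : ℤ)] ModularGroup.S = logLam := by
  rw [slash_S_eq_iff]
  intro z
  rw [zpow_zero, one_mul, logLam_eq_comp_S]

theorem logLam_slash_S : logLam ∣[(0 : ℤ)] ModularGroup.S = logLamS := by
  rw [← logLamS_slash_S, slash_S_slash_S Even.zero]

theorem logLam_mem_classP : logLam ∈ classP := by
  rw [← logLamS_slash_S]
  exact classP.slash_S logLamS_mem_classP 0

theorem logLamS_slash_T (k : ℤ) : logLamS ∣[k] ModularGroup.T = -logLamS :=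
  slash_T_eq_iff.mpr logLamS_one_vadd

/-- The constant `π i` as a function. -/
def piI : ℍ → ℂ := fun _ => Real.pi * Complex.I

theorem piI_slash_T (k : ℤ) : piI ∣[k] ModularGroup.T = piI := slash_T_eq_iff.mpr fun _ => rfl

theorem logLam_slash_T (k : ℤ) : logLam ∣[k] ModularGroup.T = logLam - logLamS + piI :=
  slash_T_eq_iff.mpr logLam_one_vadd

/-! ### Division by `U V W` and the standard representation -/

/-- In `n / UVW` the signs cancel and there are no poles. The decay `exp(-πy)` forced by
antiperiodicity of `n` matches the lower bound for `UVW`, so the quotient is bounded at `i∞`. -/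
theorem exists_modularForm_mul_UVW {k : ℤ} {n : ℍ → ℂ} (hn : n ∈ classP)
    (hS : n ∣[k + 6] ModularGroup.S = -n) (hT : n ∣[k + 6] ModularGroup.T = -n) :
    ∃ m : ModularForm 𝒮ℒ k, n = UVW * m := by
  obtain ⟨m, hm⟩ : ∃ m : ℍ → ℂ, m = fun z => n z / UVW z := ⟨_, rfl⟩
  have hnm : UVW * m = n := by
    ext z
    rw [hm, Pi.mul_apply, mul_div_cancel₀ _ (UVW_ne_zero z)]
  have hmd : MDiff m := by
    rw [UpperHalfPlane.mdifferentiable_iff]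
    have h1 := (UpperHalfPlane.mdifferentiable_iff.mp hn.1).div
      (UpperHalfPlane.mdifferentiable_iff.mp mdifferentiable_UVW) fun z _ => UVW_ne_zero _
    rw [hm]
    exact h1
  have hslash : ∀ γ : SL(2, ℤ), n ∣[k + 6] γ = -n → UVW ∣[(6 : ℤ)] γ = -UVW → m ∣[k] γ = m := by
    intro γ h1 h2
    rw [← hnm, mul_comm, mul_slash_sub (k + 6) 6, add_sub_cancel_right, h2] at h1
    ext z
    apply mul_left_cancel₀ (UVW_ne_zero z)
    have h3 := congrFun h1 z
    simp only [Pi.mul_apply, Pi.neg_apply] at h3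
    linear_combination -h3
  have hb : IsBoundedAtImInfty m := by
    obtain ⟨C, A, hC, h1⟩ := decay_of_antiperiodic hn hT
    obtain ⟨B, h2⟩ := exists_exp_le_norm_UVW
    rw [isBoundedAtImInfty_iff]
    refine ⟨C, max A B, fun z hz => ?_⟩
    have h3 := h1 z ((le_max_left _ _).trans hz)
    have h4 := h2 z ((le_max_right _ _).trans hz)
    rw [hm]
    change ‖n z / UVW z‖ ≤ C
    rw [norm_div, div_le_iff₀ (norm_pos_iff.mpr (UVW_ne_zero z))]
    exact h3.trans (mul_le_mul_of_nonneg_left h4 hC)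
  exact ⟨modularFormOfBounded m hmd (hslash _ hS UVW_slash_S) (hslash _ hT UVW_slash_T) hb,
    hnm.symm⟩

theorem exists_const_mul_eq {k : ℤ} {c : ℂ} (hc : c ≠ 0) (a : ModularForm 𝒮ℒ k) :
    ∃ x : ModularForm 𝒮ℒ k, ((fun _ => c : ℍ → ℂ) * (x : ℍ → ℂ)) = a := by
  refine ⟨c⁻¹ • a, ?_⟩
  ext z
  simp [hc]

/-- The image of `psiTilde4 = U² - V²` under `S`. -/
def psiTilde4S : ℍ → ℂ := U ^ 2 - W ^ 2

theorem sq_slash (f : ℍ → ℂ) (γ : SL(2, ℤ)) :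
    (f ^ 2) ∣[(4 : ℤ)] γ = (f ∣[(2 : ℤ)] γ) ^ 2 := by
  rw [pow_two, mul_slash_sub 4 2, pow_two]
  norm_num

theorem sq_slash_T (k : ℤ) (f : ℍ → ℂ) :
    (f ^ 2) ∣[k] ModularGroup.T = (f ∣[k] ModularGroup.T) ^ 2 := by
  ext z
  simp only [slash_T_apply, Pi.pow_apply]

theorem psiTilde4_slash_S : psiTilde4 ∣[(4 : ℤ)] ModularGroup.S = psiTilde4S := by
  rw [psiTilde4, psiTilde4S, sub_slash, sq_slash, sq_slash, U_slash_S, V_slash_S, neg_sq, neg_sq]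

theorem psiTilde4S_slash_S : psiTilde4S ∣[(4 : ℤ)] ModularGroup.S = psiTilde4 := by
  rw [← psiTilde4_slash_S, slash_S_slash_S (by decide)]

theorem psiTilde4_slash_T (k : ℤ) : psiTilde4 ∣[k] ModularGroup.T = psiTilde4 - psiTilde4S := by
  rw [psiTilde4, psiTilde4S, sub_slash, sq_slash_T, sq_slash_T, U_slash_T, V_slash_T]
  ring

theorem psiTilde4S_slash_T (k : ℤ) : psiTilde4S ∣[k] ModularGroup.T = -psiTilde4S := by
  rw [psiTilde4S, sub_slash, sq_slash_T, sq_slash_T, U_slash_T, W_slash_T]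
  ring

theorem psiTilde4_mem_classP : psiTilde4 ∈ classP :=
  classP.sub_mem (classP.pow U_mem_classP 2) (classP.pow V_mem_classP 2)

theorem psiTilde4S_mem_classP : psiTilde4S ∈ classP :=
  classP.sub_mem (classP.pow U_mem_classP 2) (classP.pow W_mem_classP 2)

/-- Cramer's rule: as `U² - V² = W(U + V)` and `U² - W² = V(U + W)`, the determinant is `-VW(2U + V
+ W) = -3UVW`. -/
theorem psiTilde_cramer {a b h p : ℍ → ℂ} (h1 : h = psiTilde4 * a + W * b)
    (h2 : p = psiTilde4S * a - V * b) :
    h * V + p * W = 3 * UVW * a ∧ h * psiTilde4S - p * psiTilde4 = 3 * UVW * b := by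
  rw [h1, h2, psiTilde4, psiTilde4S, UVW, U_eq_V_add_W]
  constructor <;> ring

theorem eq_of_three_UVW_mul {a b : ℍ → ℂ} (h : 3 * UVW * a = 3 * UVW * b) : a = b := by
  ext z
  have h1 := congrFun h z
  simp only [Pi.mul_apply, Pi.ofNat_apply] at h1
  exact mul_left_cancel₀ (mul_ne_zero three_ne_zero (UVW_ne_zero z)) h1

theorem eq_zero_of_psiTilde_relation {a b : ℍ → ℂ} (h1 : psiTilde4 * a + W * b = 0)
    (h2 : psiTilde4S * a - V * b = 0) : a = 0 ∧ b = 0 := by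
  obtain ⟨h3, h4⟩ := psiTilde_cramer h1.symm h2.symm
  exact ⟨eq_of_three_UVW_mul (by rw [← h3]; ring), eq_of_three_UVW_mul (by rw [← h4]; ring)⟩

/-- Pairs of functions on which `S` and `T` act through the standard representation. -/
theorem exists_psiTilde_decomposition {k : ℤ} {h p : ℍ → ℂ} (hP : h ∈ classP) (pP : p ∈ classP)
    (hS : h ∣[k] ModularGroup.S = p) (pS : p ∣[k] ModularGroup.S = h)
    (hT : h ∣[k] ModularGroup.T = h - p) (pT : p ∣[k] ModularGroup.T = -p) :
    ∃ (a : ModularForm 𝒮ℒ (k - 4)) (b : ModularForm 𝒮ℒ (k - 2)),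
      h = psiTilde4 * a + W * b ∧ p = psiTilde4S * a - V * b := by
  have e4 : k - 4 + 6 = k + 2 := by ring
  have e2 : k - 2 + 6 = k + 4 := by ring
  -- The two numerators of Cramer's rule are negated by `S` and `T`, hence divisible by `UVW`.
  have n4 : ∃ a : ModularForm 𝒮ℒ (k - 4), h * V + p * W = UVW * a := by
    refine exists_modularForm_mul_UVW (classP.add_mem (classP.mul hP V_mem_classP)
      (classP.mul pP W_mem_classP)) ?_ ?_ <;>
    rw [e4, SlashAction.add_slash, mul_slash_sub (k + 2) 2, mul_slash_sub (k + 2) 2,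
      add_sub_cancel_right]
    · rw [hS, pS, V_slash_S, W_slash_S]
      ring
    · rw [hT, pT, V_slash_T, W_slash_T, U_eq_V_add_W]
      ring
  have n2 : ∃ b : ModularForm 𝒮ℒ (k - 2), h * psiTilde4S - p * psiTilde4 = UVW * b := by
    refine exists_modularForm_mul_UVW (classP.sub_mem (classP.mul hP psiTilde4S_mem_classP)
      (classP.mul pP psiTilde4_mem_classP)) ?_ ?_ <;>
    rw [e2, sub_slash, mul_slash_sub (k + 4) 4, mul_slash_sub (k + 4) 4, add_sub_cancel_right]
    · rw [hS, pS, psiTilde4_slash_S, psiTilde4S_slash_S]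
      ring
    · rw [hT, pT, psiTilde4_slash_T, psiTilde4S_slash_T]
      ring
  obtain ⟨a', ha'⟩ := n4
  obtain ⟨b', hb'⟩ := n2
  obtain ⟨a, ha⟩ := exists_const_mul_eq three_ne_zero a'
  obtain ⟨b, hb⟩ := exists_const_mul_eq three_ne_zero b'
  have h3 : (fun _ => 3 : ℍ → ℂ) = 3 := rfl
  rw [h3] at ha hb
  rw [← ha] at ha'
  rw [← hb] at hb'
  refine ⟨a, b, eq_of_three_UVW_mul ?_, eq_of_three_UVW_mul ?_⟩
  · have : 3 * UVW = V * psiTilde4 + W * psiTilde4S := by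
      rw [psiTilde4, psiTilde4S, UVW, U_eq_V_add_W]
      ring
    linear_combination h * this + psiTilde4 * ha' + W * hb'
  · have : 3 * UVW = V * psiTilde4 + W * psiTilde4S := by
      rw [psiTilde4, psiTilde4S, UVW, U_eq_V_add_W]
      ring
    linear_combination p * this + psiTilde4S * ha' - V * hb'

/-! ### The ideal `Ĩ₋` -/

theorem mem_Ann_idealTildeMinus {k : ℤ} (hk : Even k) (f : ℍ → ℂ) :
    f ∈ Ann k idealTildeMinus ↔ f ∈ classP ∧
      f ∣[k] ModularGroup.T - (2 : ℂ) • f + f ∣[k] ModularGroup.T⁻¹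
        + (2 : ℂ) • f ∣[k] ModularGroup.S = 0 ∧
      ((f ∣[k] ModularGroup.S) ∣[k] ModularGroup.T) ∣[k] ModularGroup.S = -f := by
  rw [idealTildeMinus, mem_Ann_rightIdeal hk, slashR_second_difference_add hk,
    slashR_one_add_STS hk, add_comm f, add_eq_zero_iff_eq_neg (b := f)]

theorem mem_Ann_idealTildeMinus_of_slash {k : ℤ} (hk : Even k) {f p c : ℍ → ℂ} (hf : f ∈ classP)
    (hS : f ∣[k] ModularGroup.S = p) (hT : f ∣[k] ModularGroup.T = f - p + c)
    (pT : p ∣[k] ModularGroup.T = -p) (cT : c ∣[k] ModularGroup.T = c) :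
    f ∈ Ann k idealTildeMinus := by
  have hT' : f ∣[k] ModularGroup.T⁻¹ = f - p - c := by
    have h1 : (f - p - c) ∣[k] ModularGroup.T = f := by
      rw [sub_slash, sub_slash, hT, pT, cT]
      ring
    rw [← h1, slash_T_slash_T_inv, h1]
  rw [mem_Ann_idealTildeMinus hk]
  refine ⟨hf, ?_, ?_⟩
  · rw [hT, hT', hS]
    module
  · rw [hS, pT, SlashAction.neg_slash, ← hS, slash_S_slash_S hk]

/-- Put `c = f|T - f + f|S`. The first relation gives `2c = f|T - f|T⁻¹`, and the second, through
`slash_STS`, shows that `S` exchanges `f|T` with `-f|T⁻¹`, so `c|S = c`. Slashing the first relation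
with `T` gives `c|T = c`. -/
theorem slash_of_mem_Ann_idealTildeMinus {k : ℤ} (hk : Even k) {f : ℍ → ℂ}
    (hf : f ∈ Ann k idealTildeMinus) :
    (f ∣[k] ModularGroup.S) ∣[k] ModularGroup.T = -(f ∣[k] ModularGroup.S) ∧
      ∃ c : ModularForm 𝒮ℒ k, f ∣[k] ModularGroup.T = f - f ∣[k] ModularGroup.S + c := by
  obtain ⟨hP, h1, h2⟩ := (mem_Ann_idealTildeMinus hk f).mp hf
  have pT : (f ∣[k] ModularGroup.S) ∣[k] ModularGroup.T = -(f ∣[k] ModularGroup.S) := by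
    rw [← SlashAction.neg_slash, ← h2, slash_S_slash_S hk]
  refine ⟨pT, ?_⟩
  rw [slash_STS] at h2
  have tS : (f ∣[k] ModularGroup.T⁻¹) ∣[k] ModularGroup.S = -(f ∣[k] ModularGroup.T) := by
    rw [← SlashAction.neg_slash, ← h2, slash_T_inv_slash_T]
  have tS' : (f ∣[k] ModularGroup.T) ∣[k] ModularGroup.S = -(f ∣[k] ModularGroup.T⁻¹) := by
    rw [← neg_eq_iff_eq_neg, ← SlashAction.neg_slash, ← tS, slash_S_slash_S hk]
  have h3 := congrArg (fun u => u ∣[k] ModularGroup.T) h1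
  simp only [slash_T_inv_slash_T, sub_slash, SlashAction.add_slash, pT, SlashAction.zero_slash, two_smul] at h3
  rw [two_smul, two_smul] at h1
  obtain ⟨c, hc⟩ : ∃ c, c = f ∣[k] ModularGroup.T - f + f ∣[k] ModularGroup.S := ⟨_, rfl⟩
  have hc2 : (2 : ℂ) • c = f ∣[k] ModularGroup.T - f ∣[k] ModularGroup.T⁻¹ := by
    rw [two_smul, hc]
    linear_combination h1
  have cP : c ∈ classP := by
    rw [hc]
    exact classP.add_mem (classP.sub_mem (classP.slash_T hP k) hP) (classP.slash_S hP k)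
  have cS : c ∣[k] ModularGroup.S = c := by
    apply smul_right_injective (ℍ → ℂ) (two_ne_zero (α := ℂ))
    simp only
    rw [← ModularForm.SL_smul_slash, hc2, sub_slash, tS, tS']
    ring
  have cT : c ∣[k] ModularGroup.T = c := by
    rw [hc, SlashAction.add_slash, sub_slash, pT]
    linear_combination h3
  obtain ⟨g, hg⟩ := exists_modularForm cP cS cT
  refine ⟨g, ?_⟩
  rw [hg, hc]
  ring

theorem pi_mul_I_ne_zero : (Real.pi : ℂ) * Complex.I ≠ 0 :=
  mul_ne_zero (Complex.ofReal_ne_zero.mpr Real.pi_ne_zero) Complex.I_ne_zero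

theorem eq_zero_of_piI_mul {a : ℍ → ℂ} (h : piI * a = 0) : a = 0 :=
  funext fun z => (mul_eq_zero.mp (congrFun h z)).resolve_left pi_mul_I_ne_zero

theorem psiTilde_sum_slash {k : ℤ} (x : ModularForm 𝒮ℒ (k - 4)) (y : ModularForm 𝒮ℒ (k - 2))
    (w : ModularForm 𝒮ℒ k) :
    (psiTilde4 * x + psiTilde2 * y + psiTilde0 * w) ∣[k] ModularGroup.S =
        psiTilde4S * x - V * y + logLamS * w ∧
      (psiTilde4 * x + psiTilde2 * y + psiTilde0 * w) ∣[k] ModularGroup.T =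
        (psiTilde4 * x + psiTilde2 * y + psiTilde0 * w) -
          (psiTilde4S * x - V * y + logLamS * w) + piI * w ∧
      (psiTilde4S * x - V * y + logLamS * w) ∣[k] ModularGroup.T =
        -(psiTilde4S * x - V * y + logLamS * w) := by
  have e4 : k - (k - 4) = 4 := by ring
  have e2 : k - (k - 2) = 2 := by ring
  have e0 : k - k = 0 := by ring
  simp only [SlashAction.add_slash, sub_slash, mul_slash_sub k (k - 4) _ x,
    mul_slash_sub k (k - 2) _ y, mul_slash_sub k k _ w, modularForm_slash, e4, e2, e0, psiTilde2,
    psiTilde0, psiTilde4_slash_S, psiTilde4_slash_T, psiTilde4S_slash_T, W_slash_S, W_slash_T,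
    V_slash_T, logLam_slash_S, logLam_slash_T, logLamS_slash_T]
  refine ⟨by ring, ?_, by ring⟩
  rw [U_eq_V_add_W]
  ring

theorem Ann_idealTildeMinus_eq {k : ℤ} (hk : Even k) :
    Ann k idealTildeMinus =
      mulForms psiTilde4 (k - 4) ⊔ mulForms psiTilde2 (k - 2) ⊔ mulForms psiTilde0 k := by
  ext f
  rw [mem_mulForms_sup]
  constructor
  · intro hf
    have hP := hf.1
    obtain ⟨pT, c, hT⟩ := slash_of_mem_Ann_idealTildeMinus hk hf
    -- With `w = c/(πi)`, subtracting `ℒ w` removes `c` from the action of `T`, leaving a pair of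
    -- standard type.
    obtain ⟨w, hw⟩ := exists_const_mul_eq pi_mul_I_ne_zero c
    change piI * w = c at hw
    obtain ⟨h, hh⟩ : ∃ h, h = f - logLam * w := ⟨_, rfl⟩
    have e0 : k - k = 0 := by ring
    have hS : h ∣[k] ModularGroup.S = f ∣[k] ModularGroup.S - logLamS * w := by
      rw [hh, sub_slash, mul_slash_sub k k, modularForm_slash, e0, logLam_slash_S]
    have hhP : h ∈ classP := by
      rw [hh]
      exact classP.sub_mem hP (classP.mul logLam_mem_classP (modularForm_mem_classP w))
    obtain ⟨x, y, h1, -⟩ := exists_psiTilde_decomposition hhP (classP.slash_S hhP k) rfl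
      (slash_S_slash_S hk h)
      (by
        rw [hS, hh, sub_slash, mul_slash_sub k k, modularForm_slash, logLam_slash_T, hT, ← hw]
        ring)
      (by
        rw [hS, sub_slash, mul_slash_sub k k, modularForm_slash, logLamS_slash_T, pT]
        ring)
    refine ⟨x, y, w, ?_⟩
    rw [psiTilde2, psiTilde0, ← h1, hh, sub_add_cancel]
  · rintro ⟨x, y, w, rfl⟩
    obtain ⟨h1, h2, h3⟩ := psiTilde_sum_slash x y w
    refine mem_Ann_idealTildeMinus_of_slash hk ?_ h1 h2 h3 ?_
    · exact classP.add_mem (classP.add_mem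
        (classP.mul psiTilde4_mem_classP (modularForm_mem_classP x))
        (classP.mul W_mem_classP (modularForm_mem_classP y)))
        (classP.mul logLam_mem_classP (modularForm_mem_classP w))
    · rw [mul_slash_sub k k, modularForm_slash, piI_slash_T]

theorem hasDim_Ann_idealTildeMinus {k : ℤ} (hk : Even k) :
    HasDim (Ann k idealTildeMinus) (max 0 (⌈((k : ℚ) - 2) / 4⌉ + 1)) := by
  rw [Ann_idealTildeMinus_eq hk, ← finrank_sum_minus hk]
  refine hasDim_mulForms_sup fun x y w h => ?_
  obtain ⟨h1, h2, -⟩ := psiTilde_sum_slash x y w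
  rw [h, SlashAction.zero_slash] at h1 h2
  -- If the combination vanishes, so does its `S`-translate, and the `T`-relation reduces to `πi w =
  -- 0`.
  rw [← h1, sub_self, zero_add] at h2
  have hw := eq_zero_of_piI_mul h2.symm
  rw [hw, mul_zero, add_zero] at h h1
  obtain ⟨hx, hy⟩ := eq_zero_of_psiTilde_relation h h1.symm
  exact ⟨hx, hy, hw⟩

/-! ### The ideal `I₋` -/

theorem mem_Ann_idealMinus {k : ℤ} (hk : Even k) (f : ℍ → ℂ) :
    f ∈ Ann k idealMinus ↔ f ∈ classP ∧ f ∣[k] ModularGroup.S = f ∧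
      (f ∣[k] ModularGroup.T - f) ∣[k] ModularGroup.T = f ∣[k] ModularGroup.T - f := by
  rw [idealMinus, mem_Ann_rightIdeal hk, slashR_S_sub_one hk, slashR_T_sub_one_sq hk,
    sub_eq_zero, sub_eq_zero]

/-- For `f ∈ Ann_k(I₋, 𝒫)` and `g = f|(T - I)`, the translate of `g|S` by `T`. -/
theorem slash_relation_of_mem_idealMinus {k : ℤ} {f g : ℍ → ℂ}
    (hS : f ∣[k] ModularGroup.S = f) (fT : f ∣[k] ModularGroup.T = f + g)
    (gT : g ∣[k] ModularGroup.T = g) :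
    (g ∣[k] ModularGroup.S) ∣[k] ModularGroup.T = -g - g ∣[k] ModularGroup.S := by
  have fT' : f ∣[k] ModularGroup.T⁻¹ = f - g := by
    rw [← slash_T_slash_T_inv k (f - g), sub_slash, fT, gT, add_sub_cancel_right]
  have h1 := slash_STS k f
  rw [hS, fT, SlashAction.add_slash, hS, fT', sub_slash, hS, sub_slash, fT'] at h1
  have h2 : (g ∣[k] ModularGroup.S) ∣[k] ModularGroup.T⁻¹ = -g - g ∣[k] ModularGroup.S := by
    linear_combination h1
  have h3 := congrArg (fun u => u ∣[k] ModularGroup.T) h2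
  simp only [slash_T_inv_slash_T, sub_slash, SlashAction.neg_slash, gT] at h3
  linear_combination h3

/-- If `h|T = h - p` and `p|T = -p`, then `2h - p` is `T`-invariant. `ξ₄` and `ξ₂` are these
invariant vectors for the pairs `(U² - V², U² - W²)` and `(W, -V)`. -/
theorem xi4_eq : xi4 = 2 * psiTilde4 - psiTilde4S := by
  rw [xi4, psiTilde4, psiTilde4S]
  ring

theorem xi2_eq : xi2 = 2 * W + V := by
  rw [xi2, U_eq_V_add_W]
  ring

theorem two_mul_slash (k : ℤ) (f : ℍ → ℂ) (γ : SL(2, ℤ)) : (2 * f) ∣[k] γ = 2 * f ∣[k] γ := by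
  rw [two_mul, two_mul, SlashAction.add_slash]

theorem xi4_slash_S : xi4 ∣[(4 : ℤ)] ModularGroup.S = 2 * psiTilde4S - psiTilde4 := by
  rw [xi4_eq, sub_slash, two_mul_slash, psiTilde4_slash_S, psiTilde4S_slash_S]

theorem xi2_slash_S : xi2 ∣[(2 : ℤ)] ModularGroup.S = -(2 * V) - W := by
  rw [xi2_eq, SlashAction.add_slash, two_mul_slash, W_slash_S, V_slash_S]
  ring

theorem xi4_slash_T (k : ℤ) : xi4 ∣[k] ModularGroup.T = xi4 := by
  rw [xi4_eq, sub_slash, two_mul_slash, psiTilde4_slash_T, psiTilde4S_slash_T]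
  ring

theorem xi2_slash_T (k : ℤ) : xi2 ∣[k] ModularGroup.T = xi2 := by
  rw [xi2, SlashAction.add_slash, U_slash_T, W_slash_T, add_comm]

theorem log_combination_slash_S {k : ℤ} (hk : Even k) (ξ : ℍ → ℂ) :
    (ξ * logLam + (ξ ∣[k] ModularGroup.S) * logLamS) ∣[k] ModularGroup.S =
      ξ * logLam + (ξ ∣[k] ModularGroup.S) * logLamS := by
  rw [SlashAction.add_slash, mul_slash_sub k 0, mul_slash_sub k 0, sub_zero, logLam_slash_S,
    logLamS_slash_S, slash_S_slash_S hk, add_comm]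

/-- The term `-ξ ℒ_S` from `ℒ|T` cancels against `(-ξ)(-ℒ_S)` from `ζ ℒ_S`, leaving only the
constant `πi` times `ξ`. -/
theorem log_combination_slash_T (k : ℤ) {ξ ζ : ℍ → ℂ} (h1 : ξ ∣[k] ModularGroup.T = ξ)
    (h2 : ζ ∣[k] ModularGroup.T = -ξ - ζ) :
    (ξ * logLam + ζ * logLamS) ∣[k] ModularGroup.T = ξ * logLam + ζ * logLamS + piI * ξ := by
  rw [SlashAction.add_slash, mul_slash_sub k 0, mul_slash_sub k 0, sub_zero, logLam_slash_T,
    logLamS_slash_T, h1, h2]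
  ring

theorem psi4_slash_S : psi4 ∣[(4 : ℤ)] ModularGroup.S = psi4 :=
  log_combination_slash_S (by decide) xi4

theorem psi2_slash_S : psi2 ∣[(2 : ℤ)] ModularGroup.S = psi2 :=
  log_combination_slash_S even_two xi2

theorem psi4_slash_T (k : ℤ) : psi4 ∣[k] ModularGroup.T = psi4 + piI * xi4 := by
  refine log_combination_slash_T k (xi4_slash_T k) ?_
  rw [xi4_slash_S, xi4_eq, sub_slash, two_mul_slash, psiTilde4_slash_T, psiTilde4S_slash_T]
  ring

theorem psi2_slash_T (k : ℤ) : psi2 ∣[k] ModularGroup.T = psi2 + piI * xi2 := by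
  refine log_combination_slash_T k (xi2_slash_T k) ?_
  rw [xi2_slash_S, xi2_eq, sub_slash, SlashAction.neg_slash, two_mul_slash, V_slash_T, W_slash_T,
    U_eq_V_add_W]
  ring

theorem xi4_mem_classP : xi4 ∈ classP := by
  rw [xi4_eq, two_mul]
  exact classP.sub_mem (classP.add_mem psiTilde4_mem_classP psiTilde4_mem_classP)
    psiTilde4S_mem_classP

theorem xi2_mem_classP : xi2 ∈ classP := classP.add_mem U_mem_classP W_mem_classP

theorem log_combination_mem_classP {ξ : ℍ → ℂ} (hξ : ξ ∈ classP) (k : ℤ) :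
    ξ * logLam + (ξ ∣[k] ModularGroup.S) * logLamS ∈ classP :=
  classP.add_mem (classP.mul hξ logLam_mem_classP)
    (classP.mul (classP.slash_S hξ k) logLamS_mem_classP)

theorem psi_sum_slash {k : ℤ} (x : ModularForm 𝒮ℒ (k - 4)) (y : ModularForm 𝒮ℒ (k - 2)) :
    (psi4 * x + psi2 * y) ∣[k] ModularGroup.S = psi4 * x + psi2 * y ∧
      (psi4 * x + psi2 * y) ∣[k] ModularGroup.T =
        psi4 * x + psi2 * y + piI * (xi4 * x + xi2 * y) ∧
      (piI * (xi4 * x + xi2 * y)) ∣[k] ModularGroup.T = piI * (xi4 * x + xi2 * y) ∧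
      (xi4 * x + xi2 * y) ∣[k] ModularGroup.S =
        (2 * psiTilde4S - psiTilde4) * x + (-(2 * V) - W) * y := by
  have e4 : k - (k - 4) = 4 := by ring
  have e2 : k - (k - 2) = 2 := by ring
  refine ⟨?_, ?_, ?_, ?_⟩
  · rw [SlashAction.add_slash, mul_slash_sub k (k - 4), mul_slash_sub k (k - 2), modularForm_slash,
      modularForm_slash, e4, e2, psi4_slash_S, psi2_slash_S]
  · rw [SlashAction.add_slash, mul_slash_sub k (k - 4), mul_slash_sub k (k - 2), modularForm_slash,
      modularForm_slash, psi4_slash_T, psi2_slash_T]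
    ring
  · rw [mul_comm, mul_slash_sub k 0, SlashAction.add_slash, mul_slash_sub _ (k - 4),
      mul_slash_sub _ (k - 2), modularForm_slash, modularForm_slash, xi4_slash_T, xi2_slash_T,
      piI_slash_T]
  · rw [SlashAction.add_slash, mul_slash_sub k (k - 4), mul_slash_sub k (k - 2), modularForm_slash,
      modularForm_slash, e4, e2, xi4_slash_S, xi2_slash_S]

theorem Ann_idealMinus_eq {k : ℤ} (hk : Even k) :
    Ann k idealMinus = mulForms psi4 (k - 4) ⊔ mulForms psi2 (k - 2) ⊔ mulForms psi0 k := by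
  ext f
  rw [mem_mulForms_sup, mem_Ann_idealMinus hk]
  have hψ : ∀ (x : ModularForm 𝒮ℒ (k - 4)) (y : ModularForm 𝒮ℒ (k - 2)),
      psi4 * x + psi2 * y ∈ classP := fun x y => classP.add_mem
    (classP.mul (log_combination_mem_classP xi4_mem_classP 4) (modularForm_mem_classP x))
    (classP.mul (log_combination_mem_classP xi2_mem_classP 2) (modularForm_mem_classP y))
  constructor
  · rintro ⟨hP, hS, gT⟩
    have gP : f ∣[k] ModularGroup.T - f ∈ classP := classP.sub_mem (classP.slash_T hP k) hP
    obtain ⟨g, hg⟩ : ∃ g, f ∣[k] ModularGroup.T - f = g := ⟨_, rfl⟩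
    have fT : f ∣[k] ModularGroup.T = f + g := by rw [← hg]; ring
    rw [hg] at gT gP
    have pT := slash_relation_of_mem_idealMinus hS fT gT
    have pS := slash_S_slash_S hk g
    have pP := classP.slash_S gP k
    obtain ⟨p, hp⟩ : ∃ p, g ∣[k] ModularGroup.S = p := ⟨_, rfl⟩
    rw [hp] at pT pS pP
    have hadd : ∀ {u v : ℍ → ℂ}, u ∈ classP → v ∈ classP → 2 * u + v ∈ classP :=
      fun hu hv => by
        rw [two_mul]
        exact classP.add_mem (classP.add_mem hu hu) hv
    -- Change of basis: from `g|T = g` and `p|T = -g - p`, the pair `2g + p`, `2p + g` is of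
    -- standard type.
    obtain ⟨a, b, h1, h2⟩ := exists_psiTilde_decomposition (k := k) (h := 2 * g + p)
      (p := 2 * p + g) (hadd gP pP) (hadd pP gP)
      (by rw [SlashAction.add_slash, two_mul_slash, hp, pS])
      (by rw [SlashAction.add_slash, two_mul_slash, hp, pS])
      (by
        rw [SlashAction.add_slash, two_mul_slash, gT, pT]
        ring)
      (by
        rw [SlashAction.add_slash, two_mul_slash, gT, pT]
        ring)
    -- The 3 undoes the change of basis, `3g = 2(2g + p) - (2p + g)`; the `πi` is the one in the
    -- `T`-translates of `ψ₄` and `ψ₂`.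
    have h3 : (3 : ℂ) * (Real.pi * Complex.I) ≠ 0 := mul_ne_zero three_ne_zero pi_mul_I_ne_zero
    obtain ⟨x, hx⟩ := exists_const_mul_eq h3 a
    obtain ⟨y, hy⟩ := exists_const_mul_eq h3 b
    have e3 : (fun _ => 3 * (Real.pi * Complex.I) : ℍ → ℂ) = 3 * piI := rfl
    rw [e3] at hx hy
    rw [← hx, ← hy] at h1 h2
    have hgxy : g = piI * (xi4 * x + xi2 * y) := by
      ext z
      have h4 := congrFun h1 z
      have h5 := congrFun h2 z
      rw [xi4_eq, xi2_eq]
      simp only [Pi.add_apply, Pi.sub_apply, Pi.mul_apply, Pi.ofNat_apply] at h4 h5 ⊢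
      linear_combination (2 / 3) * h4 - (1 / 3) * h5
    obtain ⟨k1, k2, -, -⟩ := psi_sum_slash x y
    obtain ⟨w, hw⟩ := exists_modularForm (k := k) (f := f - (psi4 * x + psi2 * y))
      (classP.sub_mem hP (hψ x y)) (by rw [sub_slash, hS, k1])
      (by
        rw [sub_slash, fT, k2, ← hgxy]
        ring)
    refine ⟨x, y, w, ?_⟩
    rw [hw, psi0]
    ring
  · rintro ⟨x, y, w, rfl⟩
    obtain ⟨k1, k2, k3, -⟩ := psi_sum_slash x y
    rw [psi0, one_mul]
    refine ⟨classP.add_mem (hψ x y) (modularForm_mem_classP w), ?_, ?_⟩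
    · rw [SlashAction.add_slash, k1, modularForm_slash]
    · have e : (psi4 * x + psi2 * y + w) ∣[k] ModularGroup.T - (psi4 * x + psi2 * y + w) =
          piI * (xi4 * x + xi2 * y) := by
        rw [SlashAction.add_slash, k2, modularForm_slash]
        ring
      rw [e, k3]

theorem hasDim_Ann_idealMinus {k : ℤ} (hk : Even k) :
    HasDim (Ann k idealMinus) (max 0 (⌈((k : ℚ) - 2) / 4⌉ + 1)) := by
  rw [Ann_idealMinus_eq hk, ← finrank_sum_minus hk]
  refine hasDim_mulForms_sup fun x y w h => ?_
  obtain ⟨-, h1, -, h2⟩ := psi_sum_slash x y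
  have h3 := congrArg (fun u => u ∣[k] ModularGroup.T) h
  simp only [psi0, one_mul] at h h3
  rw [SlashAction.add_slash, h1, modularForm_slash, SlashAction.zero_slash] at h3
  have h4 : xi4 * x + xi2 * y = 0 := eq_zero_of_piI_mul (by linear_combination h3 - h)
  rw [h4, SlashAction.zero_slash] at h2
  -- The vanishing of `ξ₄x + ξ₂y` and of its `S`-translate gives two equations; inverting the change
  -- of basis returns them to the standard pair, with a factor 3.
  have h5 : psiTilde4 * (3 * ⇑x) + W * (3 * ⇑y) = 0 := by
    rw [xi4_eq, xi2_eq] at h4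
    linear_combination 2 * h4 - h2
  have h6 : psiTilde4S * (3 * ⇑x) - V * (3 * ⇑y) = 0 := by
    rw [xi4_eq, xi2_eq] at h4
    linear_combination h4 - 2 * h2
  obtain ⟨hx, hy⟩ := eq_zero_of_psiTilde_relation h5 h6
  have h30 : ∀ u : ℍ → ℂ, 3 * u = 0 → u = 0 := fun u hu =>
    funext fun z => (mul_eq_zero.mp (congrFun hu z)).resolve_left three_ne_zero
  have hx0 := h30 _ hx
  have hy0 := h30 _ hy
  refine ⟨hx0, hy0, ?_⟩
  rw [hx0, hy0] at h
  linear_combination h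

end ModularAnn

end

theorem mainTheorem11 (k : ℤ) (hk : Even k) :
    -- the ideal `I₊`
    ((Ann k idealPlus : Set (ℍ → ℂ)) =
        {f | f ∈ classP ∧ slashR k f ((T - 1) ^ 2) = 0 ∧ slashR k f (S + 1) = 0} ∧
      Ann k idealPlus =
        mulForms phi2 (k - 2) ⊔ mulForms phi0 k ⊔ mulForms phiNeg2 (k + 2) ∧
      HasDim (Ann k idealPlus) (max 0 (⌈(k : ℚ) / 4⌉ + 1))) ∧
    -- the ideal `I₋`
    ((Ann k idealMinus : Set (ℍ → ℂ)) =
        {f | f ∈ classP ∧ slashR k f ((T - 1) ^ 2) = 0 ∧ slashR k f (S - 1) = 0} ∧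
      Ann k idealMinus =
        mulForms psi4 (k - 4) ⊔ mulForms psi2 (k - 2) ⊔ mulForms psi0 k ∧
      HasDim (Ann k idealMinus) (max 0 (⌈((k : ℚ) - 2) / 4⌉ + 1))) ∧
    -- the ideal `Ĩ₊`
    ((Ann k idealTildePlus : Set (ℍ → ℂ)) =
        {f | f ∈ classP ∧ slashR k f (T - 2 + Tinv - 2 * S) = 0 ∧
          slashR k f (1 - S * T * S) = 0} ∧
      Ann k idealTildePlus =
        mulForms phiTilde2 (k - 2) ⊔ mulForms phiTilde0 k ⊔ mulForms phiTildeNeg2 (k + 2) ∧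
      HasDim (Ann k idealTildePlus) (max 0 (⌈(k : ℚ) / 4⌉ + 1))) ∧
    -- the ideal `Ĩ₋`
    ((Ann k idealTildeMinus : Set (ℍ → ℂ)) =
        {f | f ∈ classP ∧ slashR k f (T - 2 + Tinv + 2 * S) = 0 ∧
          slashR k f (1 + S * T * S) = 0} ∧
      Ann k idealTildeMinus =
        mulForms psiTilde4 (k - 4) ⊔ mulForms psiTilde2 (k - 2) ⊔ mulForms psiTilde0 k ∧
      HasDim (Ann k idealTildeMinus) (max 0 (⌈((k : ℚ) - 2) / 4⌉ + 1))) := by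
  refine ⟨⟨?_, Ann_idealPlus_eq hk, hasDim_Ann_idealPlus hk⟩,
    ⟨?_, Ann_idealMinus_eq hk, hasDim_Ann_idealMinus hk⟩,
    ⟨coe_Ann_rightIdeal hk _ _, Ann_idealTildePlus_eq hk, hasDim_Ann_idealTildePlus hk⟩,
    ⟨coe_Ann_rightIdeal hk _ _, Ann_idealTildeMinus_eq hk, hasDim_Ann_idealTildeMinus hk⟩⟩
  · rw [idealPlus, coe_Ann_rightIdeal hk]
    simp only [and_comm]
  · rw [idealMinus, coe_Ann_rightIdeal hk]
    simp only [and_comm]
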